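/- **Setting.** Minkowski space $\mathbb{R}\times\mathbb{R}^3$ has Cartesian coordinates $(t,x)$, signature $(+,-,-,-)$, $r=|x|$, $u=t-r$, $v=t+r$, $\langle a\rangle=(1+a^2)^{1/2}$ and $\square=\partial_t^2-\Delta$. For $j\in\mathbb{N}_0$ and $\delta\in\mathbb{R}$, $H^j_\delta(\mathbb{R}^3,\mathbb{C})$ is the weighted Sobolev space with norm $$\|f\|_{j,\delta}^2=\sum_{n=0}^{j}\big\|\langle r\rangle^{-(\delta+3/2)+n}D^nf\big\|_{L^2(\mathbb{R}^3)}^2 .$$ Consider any spherical coordinates $(r,\theta,\varphi)$ with respect to a positively oriented orthonormal frame of $\mathbb{R}^3$, and the null tetrad $$l=\tfrac{1}{\sqrt2}(\partial_t+\partial_r),\quad n=\tfrac{1}{\sqrt2}(\partial_t-\partial_r),\quad m=\tfrac{1}{r\sqrt2}\Big(\partial_\theta+\tfrac{i}{\sin\theta}\partial_\varphi\Big),\quad \overline m .$$ The corresponding derivatives are $D,D',\boldsymbol\delta,\boldsymbol\delta'$. Let $\slashed\nabla=-\overline m\,\boldsymbol\delta-m\,\boldsymbol\delta'$ be the gradient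 on the spheres of radius $r$, and let $\slashed\nabla^m$ be its $m$-th power, a tensor whose Cartesian components are $\slashed\nabla_{a_1}\cdots\slashed\nabla_{a_m}$. Let $(o^A,\iota^A)$ be a spin basis with $l^a=o^A\overline o^{A'}$, $m^a=o^A\overline\iota^{A'}$, $n^a=\iota^A\overline\iota^{A'}$. The null components of a spinor field $\phi_{A\dots F}$ of valence $2s$ are $\phi_{\mathbf i}=\iota^A\cdots\iota^C\,o^D\cdots o^F\phi_{A\dots F}$, with $\mathbf i$ factors $\iota$ and $2s-\mathbf i$ factors $o$. Pointwise norms of spinors and tensors are taken with respect to Cartesian components and a constant spin basis that is orthonormal for the Hermitian product defined by $\partial_t$. **Proposition 6.3 (decay estimates for arbitrary spin).** Let $2s\in\mathbb{N}_0$, let $(k,l,m)$ be a triple of non-negative integers with sum $n$, let $\delta\in\mathbb{R}\setminus\mathbb{Z}$, let $\xi_1^{A'},\dots,\xi_{2s}^{A'}$ be constant spinors and let $\theta_0>0$. There is a constant $c$, depending only on these data, such that the following holds for every integer $j>2+2s+n$. Let $\chi$ be a (continuous, weak) solution in $t\ge0$ of $$\square\chi=0,\qquad \chi|_{t=0}\in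 H^j_\delta(\mathbb{R}^3,\mathbb{C}),\qquad \partial_t\chi|_{t=0}\in H^{j-1}_{\delta-1}(\mathbb{R}^3,\mathbb{C}),$$ let $I_{p,\delta}=\|\chi|_{t=0}\|_{p,\delta}+\|\partial_t\chi|_{t=0}\|_{p-1,\delta-1}$, and let $$\phi_{A\dots F}=\xi_1^{A'}\cdots\xi_{2s}^{F'}\nabla_{AA'}\cdots\nabla_{FF'}\chi .$$ Then $\chi$ is of class $C^{n+2s}$ in $t>0$, and for all $\mathbf i\in\{0,1,\dots,2s\}$: 1. In the interior region, for all $t\ge0$ and $x\in\mathbb{R}^3$ with $t>3r$, $$|\nabla^n\phi_{A\dots F}|\le c\,\langle t\rangle^{\delta-2s-n}\,I_{n+2s+3,\delta}.$$ 2. If $1+\delta-l-\mathbf i<0$, then in the exterior region, for all $t\ge0$ and $x\in\mathbb{R}^3$ with $3r>t>\tfrac r3$, with $r>1$ if $m\ge1$, and with $\theta\in[\theta_0,\pi-\theta_0]$, $$|D^kD'^l\slashed\nabla^m\phi_{\mathbf i}|\le c\,\frac{\langle u\rangle^{1+\delta-\mathbf i-l}}{\langle v\rangle^{1+2s-\mathbf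 i+k+m}}\,I_{n+2s+3,\delta}.$$ 3. If $1+\delta-l-\mathbf i>0$, then for the same $(t,x)$ as in 2, $$|D^kD'^l\slashed\nabla^m\phi_{\mathbf i}|\le c\,\langle v\rangle^{\delta-2s-l-k-m}\,I_{n+2s+3,\delta}.$$ The constant $c$ does not depend on the frame defining the spherical coordinates, so every direction of $x$ is covered by a suitable choice of frame when $\theta_0\le\pi/2$. -/

import Mathlib

open MeasureTheory
open scoped ContDiff

namespace SpinDecay

noncomputable section

/-! ### Minkowski space, the weighted Sobolev spaces and the wave equation -/

/-- The time slice `ℝ³`, with its Euclidean norm. -/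
abbrev Space : Type := EuclideanSpace ℝ (Fin 3)

/-- Minkowski space with its Cartesian coordinates `(t, x)`. -/
abbrev Mink : Type := ℝ × Space

/-- The Japanese bracket `⟨a⟩ = (1 + a²)^{1/2}`. -/
def bracket (a : ℝ) : ℝ := Real.sqrt (1 + a ^ 2)

/-- The Cartesian derivative `∂_α ψ (x) = ∂_{α 0} ⋯ ∂_{α (n-1)} ψ (x)` on `ℝ³`. -/
def spacePartial {n : ℕ} (α : Fin n → Fin 3) (ψ : Space → ℝ) (x : Space) : ℝ :=
  iteratedFDeriv ℝ n ψ x (fun k => EuclideanSpace.single (α k) 1)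

/-- `g` is the weak derivative `∂_α f`. -/
def IsWeakDeriv {n : ℕ} (α : Fin n → Fin 3) (f g : Space → ℂ) : Prop :=
  LocallyIntegrable f ∧ LocallyIntegrable g ∧
    ∀ ψ : Space → ℝ, ContDiff ℝ ∞ ψ → HasCompactSupport ψ →
      ∫ x, spacePartial α ψ x • f x = (-1 : ℝ) ^ n • ∫ x, ψ x • g x

/-- The norm
`‖f‖_{j,δ} = (∑_{n ≤ j} ‖⟨r⟩^{n - (δ + 3/2)} Dⁿ f‖²_{L²(ℝ³)})^{1/2}`, where
`|Dⁿ f|² = ∑_α |∂_α f|²` over all index tuples `α` of length `n`.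
Weak derivatives are unique almost everywhere, so the infimum is the value of the integral at the
weak derivative, and it is `∞` if the weak derivative does not exist. -/
def sobolevNorm (j : ℕ) (δ : ℝ) (f : Space → ℂ) : ENNReal :=
  (∑ n ∈ Finset.range (j + 1), ∑ α : Fin n → Fin 3,
    ⨅ (g : Space → ℂ) (_ : IsWeakDeriv α f g),
      ∫⁻ x, ENNReal.ofReal ((bracket ‖x‖ ^ ((n : ℝ) - (δ + 3 / 2)) * ‖g x‖) ^ 2)) ^ (1 / 2 : ℝ)

/-- `f` belongs to the weighted Sobolev space `H^j_δ(ℝ³, ℂ)`. -/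
def MemSobolev (j : ℕ) (δ : ℝ) (f : Space → ℂ) : Prop := sobolevNorm j δ f < ⊤

/-- The Cartesian coordinate vectors `∂_t, ∂_1, ∂_2, ∂_3` of Minkowski space. -/
def coordVec : Fin 4 → Mink :=
  Fin.cons (1, 0) (fun i => (0, EuclideanSpace.single i 1))

/-- The partial derivative `∂_μ F` on Minkowski space. -/
def pd {E : Type} [NormedAddCommGroup E] [NormedSpace ℝ E] (μ : Fin 4) (F : Mink → E) :
    Mink → E :=
  fun p => fderiv ℝ F p (coordVec μ)

/-- The wave operator `□ = ∂_t² - ∂_1² - ∂_2² - ∂_3²`. -/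
def box {E : Type} [NormedAddCommGroup E] [NormedSpace ℝ E] (F : Mink → E) : Mink → E :=
  fun p => pd 0 (pd 0 F) p - ∑ i : Fin 3, pd i.succ (pd i.succ F) p

/-- `χ` is a solution in `t ≥ 0` of the Cauchy problem `□ χ = 0`, `χ|_{t=0} = f`,
`∂_t χ|_{t=0} = g`: a function that is continuous on `t ≥ 0` and satisfies the equation and the
initial conditions in the weak sense (test functions need not vanish at `t = 0`). -/
structure IsCauchySolution (χ : Mink → ℂ) (f g : Space → ℂ) : Prop where
  continuousOn : ContinuousOn χ {p | 0 ≤ p.1}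
  weak : ∀ ψ : Mink → ℝ, ContDiff ℝ ∞ ψ → HasCompactSupport ψ →
    ∫ p in {p : Mink | 0 ≤ p.1}, box ψ p • χ p =
      ∫ x : Space, (ψ (0, x) • g x - pd 0 ψ (0, x) • f x)

/-! ### Spinors and the field with a Hertz potential -/

/-- The identification of spin-vectors with complex vectors: `infeld A A'` lists the Cartesian
components `(v^0, v^1, v^2, v^3)` of the vector whose only nonzero spinor component is
`v^{AA'} = 1`, where
`v^{AA'} = 2^{-1/2} (v^0 + v^3, v^1 - i v^2; v^1 + i v^2, v^0 - v^3)`. -/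
def infeld (A A' : Fin 2) (μ : Fin 4) : ℂ :=
  (1 / (Real.sqrt 2 : ℂ)) *
    (![![![1, 0, 0, 1], ![0, 1, Complex.I, 0]],
       ![![0, 1, -Complex.I, 0], ![1, 0, 0, -1]]] : Fin 2 → Fin 2 → Fin 4 → ℂ) A A' μ

/-- The complex vector `v^a = κ^A λ̄^{A'}`. -/
def spinVec (κ lam : Fin 2 → ℂ) (μ : Fin 4) : ℂ :=
  ∑ A, ∑ A', κ A * (starRingEnd ℂ) (lam A') * infeld A A' μ

/-- The derivative `∇_{AA'}`, so that `v^{AA'} ∇_{AA'} = v^a ∂_a`. -/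
def nabla (A A' : Fin 2) (F : Mink → ℂ) : Mink → ℂ :=
  fun p => ∑ μ, infeld A A' μ * pd μ F p

/-- The components of the spinor field
`φ_{A…F} = ξ_1^{A'} ⋯ ξ_q^{F'} ∇_{AA'} ⋯ ∇_{FF'} χ` of valence `q`, in the constant spin basis. -/
def hertzField : (q : ℕ) → (Fin q → Fin 2 → ℂ) → (Mink → ℂ) → (Fin q → Fin 2) → Mink → ℂ
  | 0, _, χ, _ => χ
  | q + 1, ξ, χ, a => fun p =>
      ∑ A', ξ 0 A' * nabla (a 0) A' (hertzField q (Fin.tail ξ) χ (Fin.tail a)) p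

/-- The Cartesian derivative `∂_{α 0} ⋯ ∂_{α (n-1)} F` on Minkowski space. -/
def iterPd : (n : ℕ) → (Fin n → Fin 4) → (Mink → ℂ) → Mink → ℂ
  | 0, _, F => F
  | n + 1, α, F => pd (α 0) (iterPd n (Fin.tail α) F)

/-- The pointwise norm `|∇ⁿ φ_{A…F}|` of the full `n`-th derivative of a spinor field of
valence `q`. -/
def nablaNorm {q : ℕ} (n : ℕ) (φ : (Fin q → Fin 2) → Mink → ℂ) (p : Mink) : ℝ :=
  Real.sqrt (∑ α : Fin n → Fin 4, ∑ a : Fin q → Fin 2, ‖iterPd n α (φ a) p‖ ^ 2)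

/-! ### Spherical coordinates, null tetrad and spin basis

A matrix `U ∈ SU(2)` rotates the Cartesian frame of `ℝ³`; every positively oriented orthonormal
frame arises in this way. For `U = 1` the coordinates below are the usual ones,
`x = r (sin θ cos ϕ, sin θ sin ϕ, cos θ)`. -/

/-- The spinor `o^A` of the spin basis at the angles `(θ, ϕ)`. -/
def oSpinor (U : Matrix (Fin 2) (Fin 2) ℂ) (θ ϕ : ℝ) : Fin 2 → ℂ :=
  U.mulVec ![(Real.cos (θ / 2) : ℂ) * Complex.exp (-(Complex.I * (ϕ / 2 : ℝ))),
    (Real.sin (θ / 2) : ℂ) * Complex.exp (Complex.I * (ϕ / 2 : ℝ))]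

/-- The spinor `ι^A` of the spin basis at the angles `(θ, ϕ)`. -/
def iotaSpinor (U : Matrix (Fin 2) (Fin 2) ℂ) (θ ϕ : ℝ) : Fin 2 → ℂ :=
  U.mulVec ![-((Real.sin (θ / 2) : ℂ) * Complex.exp (-(Complex.I * (ϕ / 2 : ℝ)))),
    (Real.cos (θ / 2) : ℂ) * Complex.exp (Complex.I * (ϕ / 2 : ℝ))]

/-- The point `x ∈ ℝ³` with spherical coordinates `(r, θ, ϕ)`. Since
`l^a = o^A ō^{A'} = 2^{-1/2} (∂_t + ∂_r)`, the unit radial vector has the components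
`2^{1/2} l^1, 2^{1/2} l^2, 2^{1/2} l^3`. -/
def sphPoint (U : Matrix (Fin 2) (Fin 2) ℂ) (r θ ϕ : ℝ) : Space :=
  WithLp.toLp 2 fun i =>
    r * (Real.sqrt 2 * (spinVec (oSpinor U θ ϕ) (oSpinor U θ ϕ) i.succ).re)

/-- The spatial Cartesian components of `m^a = o^A ῑ^{A'}`; for `U = 1` this is
`2^{-1/2} (e_θ + i e_ϕ)`. -/
def mVec (U : Matrix (Fin 2) (Fin 2) ℂ) (θ ϕ : ℝ) (i : Fin 3) : ℂ :=
  spinVec (oSpinor U θ ϕ) (iotaSpinor U θ ϕ) i.succ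

/-- Functions of the coordinates `(t, r, θ, ϕ)`. -/
abbrev CoordFun : Type := ℝ → ℝ → ℝ → ℝ → ℂ

/-- `D = l^a ∇_a = 2^{-1/2} (∂_t + ∂_r)`. -/
def opD (F : CoordFun) : CoordFun := fun t r θ ϕ =>
  (1 / (Real.sqrt 2 : ℂ)) * (deriv (fun τ => F τ r θ ϕ) t + deriv (fun ρ => F t ρ θ ϕ) r)

/-- `D' = n^a ∇_a = 2^{-1/2} (∂_t - ∂_r)`. -/
def opD' (F : CoordFun) : CoordFun := fun t r θ ϕ =>
  (1 / (Real.sqrt 2 : ℂ)) * (deriv (fun τ => F τ r θ ϕ) t - deriv (fun ρ => F t ρ θ ϕ) r)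

/-- `δ = m^a ∇_a = (r 2^{1/2})⁻¹ (∂_θ + (i / sin θ) ∂_ϕ)`. -/
def opDelta (F : CoordFun) : CoordFun := fun t r θ ϕ =>
  (1 / ((r * Real.sqrt 2 : ℝ) : ℂ)) *
    (deriv (fun η => F t r η ϕ) θ +
      Complex.I / (Real.sin θ : ℂ) * deriv (fun η => F t r θ η) ϕ)

/-- `δ' = m̄^a ∇_a = (r 2^{1/2})⁻¹ (∂_θ - (i / sin θ) ∂_ϕ)`. -/
def opDelta' (F : CoordFun) : CoordFun := fun t r θ ϕ =>
  (1 / ((r * Real.sqrt 2 : ℝ) : ℂ)) *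
    (deriv (fun η => F t r η ϕ) θ -
      Complex.I / (Real.sin θ : ℂ) * deriv (fun η => F t r θ η) ϕ)

/-- The Cartesian component with index `i` of the gradient on the spheres of radius `r`,
`∇̸_a = - m̄_a δ - m_a δ'`. The metric is negative definite on `ℝ³`, so `m_i = - m^i`. -/
def angGrad (U : Matrix (Fin 2) (Fin 2) ℂ) (i : Fin 3) (F : CoordFun) : CoordFun :=
  fun t r θ ϕ => (starRingEnd ℂ) (mVec U θ ϕ i) * opDelta F t r θ ϕ + mVec U θ ϕ i * opDelta' F t r θ ϕ

/-- The Cartesian component `∇̸_{α 0} ⋯ ∇̸_{α (m-1)} F` of the `m`-th power of the operator `∇̸`. -/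
def angPow (U : Matrix (Fin 2) (Fin 2) ℂ) :
    (m : ℕ) → (Fin m → Fin 3) → CoordFun → CoordFun
  | 0, _, F => F
  | m + 1, α, F => angGrad U (α 0) (angPow U m (Fin.tail α) F)

/-- The null component
`φ_i = ι^A ⋯ ι^C o^D ⋯ o^F φ_{A…F}` (`i` factors `ι`, then `q - i` factors `o`), as a function of
the coordinates `(t, r, θ, ϕ)`. -/
def component (U : Matrix (Fin 2) (Fin 2) ℂ) {q : ℕ} (φ : (Fin q → Fin 2) → Mink → ℂ) (i : ℕ) :
    CoordFun := fun t r θ ϕ =>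
  ∑ a : Fin q → Fin 2,
    (∏ k : Fin q, (if (k : ℕ) < i then iotaSpinor U θ ϕ else oSpinor U θ ϕ) (a k)) *
      φ a (t, sphPoint U r θ ϕ)

/-- The pointwise norm `|D^k D'^l ∇̸^m F|` at the point with coordinates `(t, r, θ, ϕ)`. -/
def nullDerivNorm (U : Matrix (Fin 2) (Fin 2) ℂ) (k l m : ℕ) (F : CoordFun) (t r θ ϕ : ℝ) : ℝ :=
  Real.sqrt (∑ α : Fin m → Fin 3, ‖(opD^[k] (opD'^[l] (angPow U m α F))) t r θ ϕ‖ ^ 2)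

end

end SpinDecay

/-! Kirchhoff's formula reduces everything to one integral. With T f(t, x) = t · (mean of f over the
sphere of radius t about x), the solution is χ = ∂_t T f + T g. If |f| ≤ M⟨x⟩^β and |∂f|, |g| ≤
M⟨x⟩^(β-1), then |χ| is at most 5M⟨v⟩ times the mean of ⟨y⟩^(β-1) over that sphere (`Good.norm_le`).
On the sphere ⟨y⟩² is affine in one Cartesian coordinate, so Archimedes' formula (`integral_zonal`)
evaluates the mean exactly: it is (⟨v⟩^(1+β) - ⟨u⟩^(1+β)) / (2(1+β) r t) (`integral_bracket_rpow`).
The sign of 1+β decides which power dominates, and this is the dichotomy between the two exterior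
estimates. Since δ is not an integer, 1+β never vanishes for the orders β = δ - b that occur. In the
interior region ⟨y⟩ is comparable with ⟨t⟩ on the whole sphere, so no integration is needed.

Derivatives are handled by vector fields. Translations, scaling S, boosts L_i and rotations R_ij map
Kirchhoff solutions to Kirchhoff solutions with explicit data. Translations lower the order β by one
and the other fields keep it (`Good.act`). With ω = x/r one has (t+r)(∂_t+∂_r) = S + Σ ω_i L_i, and
a tangential derivative is r⁻¹ times a combination of rotations. Hence D and the angular gradient
each gain a factor comparable with 1/⟨v⟩, and only D' has to be paid for by a translation. The class
`Cl n b` records this: sums of c(θ,ϕ) r^(-p) (t+r)^(-a) Z with Z a word containing w ≤ b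
translations and p + a + w = n.

For the null components the constant spinors ξ are expanded in the conjugate spin basis, so each
factor of φ becomes a derivative along the tetrad. Only ι paired with ῑ gives D'. Moving the spin
basis through the derivatives costs 1/r and spin coefficients, and the one coefficient that could
create an additional ι is zero (`Cl.pat`). So φ_i lies in `Cl q i`, and D^k D'^l ∇̸^m φ_i lies in
`Cl (q+m+l+k) (i+l)`, which yields both exterior estimates (`Cl.bound`). Near the origin, where r⁻¹
is harmful and m = 0 is assumed, a cruder class without powers of r⁻¹ suffices (`Cl₀`).

Two facts connect this with the hypotheses. A weak solution agrees with Kirchhoff's formula for t >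
0: the advanced potential of an arbitrary η is an admissible test function, and its wave operator is
η on t ≥ 0 (`box_advPot`, `IsCauchySolution.eq_waveP`). Data in the weighted Sobolev spaces have
classical representatives with the pointwise bounds above, at the price of two derivatives. This
follows from a representation formula with kernels of size 1/|y| on balls of radius ⟨x⟩/2 and the
Cauchy–Schwarz inequality (`exists_sym_of_wSob`). -/

namespace SpinDecay

noncomputable section

set_option linter.unusedSectionVars false

/-! ### Averages over the unit sphere -/

/-- The unit sphere of `ℝ³`. -/
abbrev Sph : Type := Metric.sphere (0 : Space) 1

/-- The rotation invariant probability measure on the unit sphere. -/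
def sphMeas : Measure Sph :=
  ((volume : Measure Space).toSphere Set.univ)⁻¹ • (volume : Measure Space).toSphere

/-- The Cartesian basis vectors of `ℝ³`. -/
abbrev bas (i : Fin 3) : Space := EuclideanSpace.single i 1

/-- The partial derivative `∂_i f` on `ℝ³`. -/
def sd {E : Type} [NormedAddCommGroup E] [NormedSpace ℝ E] (i : Fin 3) (f : Space → E) :
    Space → E :=
  fun x => fderiv ℝ f x (bas i)

lemma toSphere_univ_ne_zero : (volume : Measure Space).toSphere Set.univ ≠ 0 := by
  rw [Ne, Measure.measure_univ_eq_zero]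
  exact Measure.toSphere_ne_zero _

instance : IsProbabilityMeasure sphMeas where
  measure_univ := by
    rw [sphMeas, Measure.smul_apply, smul_eq_mul]
    exact ENNReal.inv_mul_cancel toSphere_univ_ne_zero (measure_ne_top _ _)

lemma norm_sph (z : Sph) : ‖(z : Space)‖ = 1 := by simp

/-- A linear isometry of `ℝ³` acting on the unit sphere. -/
def sphRot (R : Space ≃ₗᵢ[ℝ] Space) (z : Sph) : Sph := ⟨R z, by simp⟩

lemma continuous_sphRot (R : Space ≃ₗᵢ[ℝ] Space) : Continuous (sphRot R) := by
  unfold sphRot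
  fun_prop

-- The surface measure of a set is a multiple of the volume of the truncated cone over it, and
-- linear isometries preserve both such cones and volume.
open scoped Pointwise in
lemma measurePreserving_sphRot (R : Space ≃ₗᵢ[ℝ] Space) :
    MeasurePreserving (sphRot R) sphMeas sphMeas := by
  have key : MeasurePreserving (sphRot R) (volume : Measure Space).toSphere
      (volume : Measure Space).toSphere := by
    refine ⟨(continuous_sphRot R).measurable, ?_⟩
    ext s hs
    rw [Measure.map_apply (continuous_sphRot R).measurable hs,
      Measure.toSphere_apply' _ ((continuous_sphRot R).measurable hs),
      Measure.toSphere_apply' _ hs]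
    congr 1
    have : Set.Ioo (0 : ℝ) 1 • ((fun a : Sph => (a : Space)) '' (sphRot R ⁻¹' s)) =
        R ⁻¹' (Set.Ioo (0 : ℝ) 1 • ((fun a : Sph => (a : Space)) '' s)) := by
      ext x
      simp only [Set.mem_smul, Set.mem_image, Set.mem_preimage]
      constructor
      · rintro ⟨a, ha, _, ⟨z, hz, rfl⟩, rfl⟩
        exact ⟨a, ha, _, ⟨_, hz, rfl⟩, by simp [sphRot]⟩
      · rintro ⟨a, ha, _, ⟨z, hz, rfl⟩, h⟩
        refine ⟨a, ha, _, ⟨sphRot R.symm z, ?_, rfl⟩, ?_⟩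
        · simpa [sphRot] using hz
        · simp only [sphRot]
          rw [← map_smul, h]
          simp
    rw [this]
    exact (R.measurePreserving).measure_preimage_equiv _ (f := R.toMeasurableEquiv)
  refine ⟨key.measurable, ?_⟩
  rw [sphMeas, Measure.map_smul, key.map_eq]

section

variable {E : Type} [NormedAddCommGroup E] [NormedSpace ℝ E]

lemma integral_sphRot (R : Space ≃ₗᵢ[ℝ] Space) {H : Space → E} (hH : Continuous H) :
    ∫ z : Sph, H (R z) ∂sphMeas = ∫ z : Sph, H z ∂sphMeas := by
  have h := (measurePreserving_sphRot R).map_eq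
  conv_rhs => rw [← h]
  exact (integral_map (f := fun z : Sph => H z) (continuous_sphRot R).aemeasurable
    (hH.comp continuous_subtype_val).aestronglyMeasurable).symm

lemma continuous_integral_of_compact {X Z : Type*} [TopologicalSpace X] [FirstCountableTopology X]
    [LocallyCompactSpace X] [TopologicalSpace Z] [CompactSpace Z]
    [MeasurableSpace Z] [OpensMeasurableSpace Z] [SecondCountableTopology Z]
    {ν : Measure Z} [IsFiniteMeasure ν] {F : X → Z → E} (hF : Continuous (Function.uncurry F)) :
    Continuous fun x => ∫ z, F x z ∂ν := by
  have := continuous_parametric_integral_of_continuous (μ := ν) hF (isCompact_univ)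
  simpa using this

lemma integrable_of_compact {Z : Type*} [TopologicalSpace Z] [CompactSpace Z]
    [MeasurableSpace Z] [OpensMeasurableSpace Z] [SecondCountableTopology Z]
    {ν : Measure Z} [IsFiniteMeasure ν] {F : Z → E} (hF : Continuous F) : Integrable F ν :=
  hF.integrable_of_hasCompactSupport (HasCompactSupport.of_compactSpace F)

/-- On a compact neighbourhood of the point times the compact parameter space the derivative is
bounded, and this constant is the dominating function. -/
lemma hasFDerivAt_integral_of_compact {X Z : Type*} [NormedAddCommGroup X] [NormedSpace ℝ X]
    [LocallyCompactSpace X] [TopologicalSpace Z] [CompactSpace Z]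
    [MeasurableSpace Z] [OpensMeasurableSpace Z] [SecondCountableTopology Z]
    {ν : Measure Z} [IsFiniteMeasure ν] {F : X → Z → E} {F' : X → Z → X →L[ℝ] E}
    (hF : Continuous (Function.uncurry F)) (hF' : Continuous (Function.uncurry F'))
    (h : ∀ x z, HasFDerivAt (fun x => F x z) (F' x z) x) (x₀ : X) :
    HasFDerivAt (fun x => ∫ z, F x z ∂ν) (∫ z, F' x₀ z ∂ν) x₀ := by
  obtain ⟨K, hK, hx⟩ := exists_compact_mem_nhds x₀
  obtain ⟨C, hC⟩ := ((hK.prod (isCompact_univ (X := Z))).image hF').isBounded.exists_norm_le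
  refine hasFDerivAt_integral_of_dominated_of_fderiv_le (bound := fun _ => C) hx ?_ ?_ ?_ ?_ ?_ ?_
  · refine Filter.Eventually.of_forall fun x => ?_
    exact (hF.comp (by fun_prop : Continuous fun z => (x, z))).aestronglyMeasurable
  · exact integrable_of_compact (hF.comp (by fun_prop : Continuous fun z => (x₀, z)))
  · exact (hF'.comp (by fun_prop : Continuous fun z => (x₀, z))).aestronglyMeasurable
  · refine Filter.Eventually.of_forall fun z x hx => ?_
    exact hC _ ⟨(x, z), ⟨hx, trivial⟩, rfl⟩
  · exact integrable_const _
  · exact Filter.Eventually.of_forall fun z x _ => h x z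

/-- The rotation by the angle `s` in the plane of the coordinates `i ≠ j`. -/
def planeRot (i j : Fin 3) (s : ℝ) : Space →ₗ[ℝ] Space where
  toFun x := x + ((Real.cos s - 1) * x i - Real.sin s * x j) • bas i +
    (Real.sin s * x i + (Real.cos s - 1) * x j) • bas j
  map_add' x y := by
    ext k
    simp only [PiLp.add_apply, PiLp.smul_apply, smul_eq_mul, RingHom.id_apply]
    ring
  map_smul' a x := by
    ext k
    simp only [PiLp.add_apply, PiLp.smul_apply, smul_eq_mul, RingHom.id_apply]
    ring

lemma norm_planeRot {i j : Fin 3} (hij : i ≠ j) (s : ℝ) (x : Space) :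
    ‖planeRot i j s x‖ = ‖x‖ := by
  have h := Real.sin_sq_add_cos_sq s
  have h2 : Real.sin s ^ 2 = 1 - Real.cos s ^ 2 := by linarith
  rw [EuclideanSpace.norm_eq, EuclideanSpace.norm_eq]
  congr 1
  simp only [Fin.sum_univ_three, Real.norm_eq_abs, sq_abs]
  fin_cases i <;> fin_cases j <;> simp [planeRot] at hij ⊢ <;> ring_nf <;> rw [h2] <;> ring

/-- The mean of H over the rotated sphere does not depend on the angle s, and its derivative at s =
0 is the integral in question. Every integration by parts on the sphere below comes from this
identity. -/
lemma integral_rotation_generator {H : Space → E} (hH : ContDiff ℝ 1 H) (i j : Fin 3) :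
    ∫ z : Sph, ((z : Space) i • sd j H z - (z : Space) j • sd i H z) ∂sphMeas = 0 := by
  by_cases hij : i = j
  · subst hij; simp
  let R : ℝ → Space ≃ₗᵢ[ℝ] Space := fun s =>
    (⟨planeRot i j s, norm_planeRot hij s⟩ : Space →ₗᵢ[ℝ] Space).toLinearIsometryEquiv rfl
  have hR : ∀ s x, R s x = x + ((Real.cos s - 1) * x i - Real.sin s * x j) • bas i +
    (Real.sin s * x i + (Real.cos s - 1) * x j) • bas j := fun s x => rfl
  have hdR : ∀ s (x : Space), HasDerivAt (fun s => R s x)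
      ((-Real.sin s * x i - Real.cos s * x j) • bas i +
        (Real.cos s * x i - Real.sin s * x j) • bas j) s := by
    intro s x
    simp only [hR]
    have h1 := (((Real.hasDerivAt_cos s).sub_const 1).mul_const (x i)).sub
      ((Real.hasDerivAt_sin s).mul_const (x j))
    have h2 := ((Real.hasDerivAt_sin s).mul_const (x i)).add
      (((Real.hasDerivAt_cos s).sub_const 1).mul_const (x j))
    have := (((hasDerivAt_const s x).add (h1.smul_const (bas i))).add (h2.smul_const (bas j)))
    convert! this using 1
    simp [sub_eq_add_neg]
  have hc : ∀ s, ∫ z : Sph, H (R s z) ∂sphMeas = ∫ z : Sph, H z ∂sphMeas :=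
    fun s => integral_sphRot (R s) hH.continuous
  have hcoord : ∀ k : Fin 3, Continuous fun p : ℝ × Sph => (p.2 : Space) k := fun k => by fun_prop
  have hRc : Continuous fun p : ℝ × Sph => R p.1 (p.2 : Space) := by
    simp only [hR]; fun_prop
  have hH' : Continuous (fderiv ℝ H) := hH.continuous_fderiv (by norm_num)
  have hd := hasFDerivAt_integral_of_compact (ν := sphMeas) (X := ℝ) (Z := Sph)
    (F := fun s z => H (R s z))
    (F' := fun s z => ContinuousLinearMap.toSpanSingleton ℝ (fderiv ℝ H (R s z)
      ((-Real.sin s * (z : Space) i - Real.cos s * (z : Space) j) • bas i +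
        (Real.cos s * (z : Space) i - Real.sin s * (z : Space) j) • bas j)))
    (hH.continuous.comp hRc) (by
      refine (ContinuousLinearMap.toSpanSingletonCLE (𝕜 := ℝ) (E := E)).continuous.comp ?_
      refine (hH'.comp hRc).clm_apply ?_
      fun_prop) (fun s z => by
      have h1 := ((hH.differentiable (by norm_num)) (R s z)).hasFDerivAt.comp_hasDerivAt s (hdR s z)
      exact h1.hasFDerivAt) 0
  have h0 : HasDerivAt (fun s => ∫ z : Sph, H (R s z) ∂sphMeas) 0 0 := by
    simp only [hc]
    exact hasDerivAt_const _ _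
  have h3 := hd.hasDerivAt.unique h0
  rw [ContinuousLinearMap.integral_apply] at h3
  · rw [← h3]
    congr 1
    ext z
    have : R 0 (z : Space) = z := by simp [hR]
    simp [this, sd, sub_eq_neg_add]
  · refine integrable_of_compact ?_
    refine (ContinuousLinearMap.toSpanSingletonCLE (𝕜 := ℝ) (E := E)).continuous.comp ?_
    refine (hH'.comp (hRc.comp (by fun_prop : Continuous fun z : Sph => ((0 : ℝ), z)))).clm_apply ?_
    fun_prop

end

/-! ### Spherical means and the wave equation -/

section

variable {E : Type} [NormedAddCommGroup E] [NormedSpace ℝ E]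

lemma space_eq_sum (x : Space) : x = ∑ i : Fin 3, x i • bas i := by
  ext k
  fin_cases k <;> simp [Fin.sum_univ_three]

lemma fderiv_eq_sum_sd (f : Space → E) (y v : Space) :
    fderiv ℝ f y v = ∑ i, v i • sd i f y := by
  conv_lhs => rw [space_eq_sum v]
  simp [sd]

lemma contDiff_sd {n : ℕ} {f : Space → E} (hf : ContDiff ℝ (n + 1 : ℕ) f) (i : Fin 3) :
    ContDiff ℝ n (sd i f) := by
  unfold sd
  exact (hf.fderiv_right (m := n) (by norm_cast)).clm_apply contDiff_const

lemma continuous_sd {f : Space → E} (hf : ContDiff ℝ 1 f) (i : Fin 3) :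
    Continuous (sd i f) :=
  (contDiff_sd (n := 0) (by simpa using hf) i).continuous

/-- The weighted mean of `f` over the sphere of radius `|t|` about `x`. -/
def smean (k : Sph → ℝ) (f : Space → E) : Mink → E :=
  fun p => ∫ z : Sph, k z • f (p.2 + p.1 • (z : Space)) ∂sphMeas

lemma continuous_smean_integrand {k : Sph → ℝ} (hk : Continuous k) {f : Space → E}
    (hf : Continuous f) :
    Continuous fun q : Mink × Sph => k q.2 • f (q.1.2 + q.1.1 • (q.2 : Space)) := by
  fun_prop

lemma integrable_smean {k : Sph → ℝ} (hk : Continuous k) {f : Space → E}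
    (hf : Continuous f) (p : Mink) :
    Integrable (fun z : Sph => k z • f (p.2 + p.1 • (z : Space))) sphMeas :=
  integrable_of_compact (by fun_prop)

lemma continuous_smean {k : Sph → ℝ} (hk : Continuous k) {f : Space → E}
    (hf : Continuous f) : Continuous (smean k f) :=
  continuous_integral_of_compact (continuous_smean_integrand hk hf)

/-- The derivative of the integrand of `smean`. -/
def smeanDeriv (k : Sph → ℝ) (f : Space → E) (p : Mink) (z : Sph) : Mink →L[ℝ] E :=
  k z • (fderiv ℝ f (p.2 + p.1 • (z : Space))).comp
    (ContinuousLinearMap.snd ℝ ℝ Space +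
      (ContinuousLinearMap.fst ℝ ℝ Space).smulRight (z : Space))

lemma continuous_smeanDeriv {k : Sph → ℝ} (hk : Continuous k) {f : Space → E}
    (hf : ContDiff ℝ 1 f) : Continuous fun q : Mink × Sph => smeanDeriv k f q.1 q.2 := by
  have hf' : Continuous (fderiv ℝ f) := hf.continuous_fderiv (by norm_num)
  have h1 : Continuous fun q : Mink × Sph => fderiv ℝ f (q.1.2 + q.1.1 • (q.2 : Space)) :=
    hf'.comp (by fun_prop)
  have h2 : Continuous fun q : Mink × Sph =>
      (ContinuousLinearMap.fst ℝ ℝ Space).smulRight (q.2 : Space) := by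
    have := (ContinuousLinearMap.smulRightL ℝ Mink Space
      (ContinuousLinearMap.fst ℝ ℝ Space)).continuous
    exact this.comp (by fun_prop)
  unfold smeanDeriv
  exact (hk.comp continuous_snd).smul (h1.clm_comp (continuous_const.add h2))

lemma hasFDerivAt_smean {k : Sph → ℝ} (hk : Continuous k) {f : Space → E}
    (hf : ContDiff ℝ 1 f) (p : Mink) :
    HasFDerivAt (smean k f) (∫ z, smeanDeriv k f p z ∂sphMeas) p := by
  refine hasFDerivAt_integral_of_compact (continuous_smean_integrand hk hf.continuous)
    (continuous_smeanDeriv hk hf) (fun q z => ?_) p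
  have h1 : HasFDerivAt (fun q : Mink => q.2 + q.1 • (z : Space))
      (ContinuousLinearMap.snd ℝ ℝ Space +
        (ContinuousLinearMap.fst ℝ ℝ Space).smulRight (z : Space)) q :=
    hasFDerivAt_snd.add (hasFDerivAt_fst.smul_const _)
  exact (((hf.differentiable (by norm_num)) _).hasFDerivAt.comp q h1).const_smul (k z)

lemma integral_smeanDeriv_apply {k : Sph → ℝ} (hk : Continuous k) {f : Space → E}
    (hf : ContDiff ℝ 1 f) (p v : Mink) :
    (∫ z, smeanDeriv k f p z ∂sphMeas) v = ∫ z, smeanDeriv k f p z v ∂sphMeas := by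
  rw [ContinuousLinearMap.integral_apply]
  exact integrable_of_compact ((continuous_smeanDeriv hk hf).comp
    (by fun_prop : Continuous fun z : Sph => (p, z)))

lemma contDiff_one_smean {k : Sph → ℝ} (hk : Continuous k) {f : Space → E}
    (hf : ContDiff ℝ 1 f) : ContDiff ℝ 1 (smean k f) := by
  rw [contDiff_one_iff_fderiv]
  refine ⟨fun p => (hasFDerivAt_smean hk hf p).differentiableAt, ?_⟩
  have : fderiv ℝ (smean k f) = fun p => ∫ z, smeanDeriv k f p z ∂sphMeas :=
    funext fun p => (hasFDerivAt_smean hk hf p).fderiv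
  rw [this]
  exact continuous_integral_of_compact (continuous_smeanDeriv hk hf)

@[simp] lemma coordVec_zero : coordVec 0 = (1, 0) := rfl

@[simp] lemma coordVec_succ (i : Fin 3) : coordVec i.succ = (0, bas i) := rfl

lemma pd_succ_smean {k : Sph → ℝ} (hk : Continuous k) {f : Space → E}
    (hf : ContDiff ℝ 1 f) (i : Fin 3) : pd i.succ (smean k f) = smean k (sd i f) := by
  ext p
  rw [pd, (hasFDerivAt_smean hk hf p).fderiv, integral_smeanDeriv_apply hk hf]
  simp [smeanDeriv, smean, sd]

lemma pd_zero_smean {k : Sph → ℝ} (hk : Continuous k) {f : Space → E}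
    (hf : ContDiff ℝ 1 f) :
    pd 0 (smean k f) = fun p => ∑ i, smean (fun z => (z : Space) i * k z) (sd i f) p := by
  ext p
  rw [pd, (hasFDerivAt_smean hk hf p).fderiv, integral_smeanDeriv_apply hk hf]
  simp only [smean]
  rw [← integral_finsetSum _ fun i _ => integrable_smean (by fun_prop) (continuous_sd hf i) p]
  congr 1
  ext z
  simp only [smeanDeriv, coordVec_zero]
  simp [fderiv_eq_sum_sd, Finset.smul_sum, smul_smul, mul_comm]

lemma smean_coord_smul {k : Sph → ℝ} (hk : Continuous k) {f : Space → E}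
    (hf : Continuous f) (i : Fin 3) (p : Mink) :
    smean k (fun y => y i • f y) p =
      p.2 i • smean k f p + p.1 • smean (fun z => (z : Space) i * k z) f p := by
  simp only [smean]
  rw [← integral_smul, ← integral_smul, ← integral_add]
  · congr 1
    ext z
    simp only [PiLp.add_apply, PiLp.smul_apply, smul_eq_mul]
    module
  · exact (integrable_smean hk hf p).smul _
  · exact (integrable_smean (by fun_prop) hf p).smul _

lemma smean_add {k : Sph → ℝ} (hk : Continuous k) {f g : Space → E}
    (hf : Continuous f) (hg : Continuous g) (p : Mink) :
    smean k (fun y => f y + g y) p = smean k f p + smean k g p := by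
  simp only [smean, smul_add]
  exact integral_add (integrable_smean hk hf p) (integrable_smean hk hg p)

lemma smean_sub {k : Sph → ℝ} (hk : Continuous k) {f g : Space → E}
    (hf : Continuous f) (hg : Continuous g) (p : Mink) :
    smean k (fun y => f y - g y) p = smean k f p - smean k g p := by
  simp only [smean, smul_sub]
  exact integral_sub (integrable_smean hk hf p) (integrable_smean hk hg p)

lemma smean_sum {k : Sph → ℝ} (hk : Continuous k) {ι : Type*} (s : Finset ι) {f : ι → Space → E}
    (hf : ∀ i ∈ s, Continuous (f i)) (p : Mink) :
    smean k (fun y => ∑ i ∈ s, f i y) p = ∑ i ∈ s, smean k (f i) p := by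
  simp only [smean, Finset.smul_sum]
  exact integral_finsetSum _ fun i hi => integrable_smean hk (hf i hi) p

lemma hasFDerivAt_affine_comp {h : Space → E} (hh : ContDiff ℝ 1 h) (p : Mink) (y : Space) :
    HasFDerivAt (fun y : Space => h (p.2 + p.1 • y)) (p.1 • fderiv ℝ h (p.2 + p.1 • y)) y := by
  have h1 : HasFDerivAt (fun y : Space => p.2 + p.1 • y) (p.1 • ContinuousLinearMap.id ℝ Space) y :=
    ((hasFDerivAt_id y).const_smul p.1).const_add p.2
  have := ((hh.differentiable (by norm_num)) _).hasFDerivAt.comp y h1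
  convert! this using 1
  ext v
  simp

/-- This is `integral_rotation_generator` for y ↦ h(x + t y). The factor t of the chain rule is
kept, so that t = 0 needs no separate treatment. -/
lemma smean_rotation {h : Space → E} (hh : ContDiff ℝ 1 h) (i j : Fin 3) (p : Mink) :
    p.1 • smean (fun z => (z : Space) i * 1) (sd j h) p =
      p.1 • smean (fun z => (z : Space) j * 1) (sd i h) p := by
  have h0 := integral_rotation_generator (H := fun y : Space => h (p.2 + p.1 • y))
    (hh.comp (by fun_prop)) i j
  have h1 : ∀ (i : Fin 3) (y : Space), sd i (fun y : Space => h (p.2 + p.1 • y)) y =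
      p.1 • sd i h (p.2 + p.1 • y) := fun i y => by
    rw [sd, (hasFDerivAt_affine_comp hh p y).fderiv]; rfl
  simp only [h1] at h0
  have hi : ∀ i j : Fin 3, Integrable (fun z : Sph =>
      (z : Space) i • p.1 • sd j h (p.2 + p.1 • (z : Space))) sphMeas := fun i j =>
    integrable_of_compact (by have := continuous_sd hh j; fun_prop)
  rw [integral_sub (hi _ _) (hi _ _), sub_eq_zero] at h0
  simp only [smean, ← integral_smul, mul_one]
  simp only [smul_comm p.1]
  exact h0

/-- Sum over i the generators y_i ∂_j - y_j ∂_i applied to y_i h(x + t y). On |y| = 1 the terms with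
derivatives of h give t(∂_j h - y_j Σ y_i ∂_i h), and those from the factor y_i give y_j h - 3 y_j h
= -2 y_j h. The resulting identity is behind the wave equation, the moments and the flux along light
cones. -/
lemma smean_tangential {h : Space → E} (hh : ContDiff ℝ 1 h) (j : Fin 3) (p : Mink) :
    p.1 • (smean (fun _ => 1) (sd j h) p -
      ∑ i, smean (fun z => (z : Space) j * ((z : Space) i * 1)) (sd i h) p) =
      (2 : ℝ) • smean (fun z => (z : Space) j * 1) h p := by
  have hH : ∀ i : Fin 3, ContDiff ℝ 1 (fun y : Space => y i • h (p.2 + p.1 • y)) := fun i =>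
    ContDiff.smul (by fun_prop) (hh.comp (by fun_prop))
  have h0 := fun i => integral_rotation_generator (hH i) i j
  have h1 : ∀ (i l : Fin 3) (y : Space), sd l (fun y : Space => y i • h (p.2 + p.1 • y)) y =
      y i • p.1 • sd l h (p.2 + p.1 • y) + (if l = i then h (p.2 + p.1 • y) else 0) := by
    intro i l y
    have e : HasFDerivAt (fun y : Space => y i) (EuclideanSpace.proj i : Space →L[ℝ] ℝ) y :=
      (EuclideanSpace.proj i : Space →L[ℝ] ℝ).hasFDerivAt
    rw [sd, (e.fun_smul (hasFDerivAt_affine_comp hh p y)).fderiv]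
    by_cases hl : l = i
    · subst hl; simp [sd]
    · simp [sd, hl, Ne.symm hl]
  simp only [h1] at h0
  have hs : Continuous (fun y => h y) := hh.continuous
  have hsd := fun l => continuous_sd hh l
  have h2 : ∑ i, ∫ z : Sph, ((z : Space) i • ((z : Space) i • p.1 • sd j h (p.2 + p.1 • (z : Space))
      + (if j = i then h (p.2 + p.1 • (z : Space)) else 0))
      - (z : Space) j • ((z : Space) i • p.1 • sd i h (p.2 + p.1 • (z : Space))
      + (if i = i then h (p.2 + p.1 • (z : Space)) else 0))) ∂sphMeas = 0 :=
    Finset.sum_eq_zero fun i _ => by simpa only [eq_self_iff_true, if_true] using h0 i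
  rw [← integral_finsetSum] at h2
  · rw [← sub_eq_zero]
    rw [← h2]
    simp only [smean]
    rw [← integral_finsetSum, ← integral_sub, ← integral_smul, ← integral_smul, ← integral_sub]
    · congr 1
      ext z
      have hz : (z : Space) 0 ^ 2 + (z : Space) 1 ^ 2 + (z : Space) 2 ^ 2 = 1 := by
        have := EuclideanSpace.real_norm_sq_eq (z : Space)
        rw [norm_sph, Fin.sum_univ_three] at this
        linarith
      -- Only here is the sphere constraint used: the weight 1 is rewritten as |z|².
      have h3 : (1 : ℝ) • sd j h (p.2 + p.1 • (z : Space)) = ((z : Space) 0 ^ 2 + (z : Space) 1 ^ 2 +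
        (z : Space) 2 ^ 2) • sd j h (p.2 + p.1 • (z : Space)) := by rw [hz]
      simp only [Fin.sum_univ_three]
      rw [h3]
      fin_cases j <;> simp <;> module
    all_goals
      first
      | exact integrable_of_compact (by fun_prop)
      | exact fun i _ => integrable_of_compact (by fun_prop)
  · intro i _
    have := hsd j
    have := hsd i
    by_cases hji : j = i
    · simp only [hji, if_true]
      exact integrable_of_compact (by fun_prop)
    · simp only [hji, if_true, if_false]
      exact integrable_of_compact (by fun_prop)

/-- `T f` is the solution of the wave equation with the Cauchy data `(0, f)`. -/
def waveT (f : Space → E) : Mink → E := fun p => p.1 • smean (fun _ => 1) f p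

lemma continuous_waveT {f : Space → E} (hf : Continuous f) : Continuous (waveT f) :=
  continuous_fst.smul (continuous_smean continuous_const hf)

lemma contDiff_one_waveT {f : Space → E} (hf : ContDiff ℝ 1 f) : ContDiff ℝ 1 (waveT f) :=
  contDiff_fst.smul (contDiff_one_smean continuous_const hf)

lemma pd_fst_smul {F : Mink → E} {p : Mink} (hF : DifferentiableAt ℝ F p) (μ : Fin 4) :
    pd μ (fun p => p.1 • F p) p = p.1 • pd μ F p + (coordVec μ).1 • F p := by
  rw [pd, (hasFDerivAt_fst.fun_smul hF.hasFDerivAt).fderiv]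
  simp [pd]

lemma pd_succ_waveT {f : Space → E} (hf : ContDiff ℝ 1 f) (i : Fin 3) :
    pd i.succ (waveT f) = waveT (sd i f) := by
  ext p
  have := (contDiff_one_smean (k := fun _ => 1) continuous_const hf).differentiable (by norm_num) p
  unfold waveT
  rw [pd_fst_smul this, pd_succ_smean continuous_const hf]
  simp

lemma pd_zero_waveT {f : Space → E} (hf : ContDiff ℝ 1 f) :
    pd 0 (waveT f) = fun p => smean (fun _ => 1) f p +
      p.1 • ∑ i, smean (fun z => (z : Space) i * 1) (sd i f) p := by
  ext p
  have := (contDiff_one_smean (k := fun _ => 1) continuous_const hf).differentiable (by norm_num) p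
  unfold waveT
  rw [pd_fst_smul this, pd_zero_smean continuous_const hf]
  simp [add_comm]

lemma contDiff_one_pd_zero_waveT {f : Space → E} (hf : ContDiff ℝ 2 f) :
    ContDiff ℝ 1 (pd 0 (waveT f)) := by
  have h1 : ContDiff ℝ 1 f := hf.of_le (by norm_num)
  rw [pd_zero_waveT h1]
  refine (contDiff_one_smean continuous_const h1).add (contDiff_fst.smul
    (ContDiff.sum fun i _ => contDiff_one_smean (by fun_prop) (contDiff_sd (n := 1) hf i)))

/-- The Laplacian on `ℝ³`. -/
def lap (f : Space → E) : Space → E := fun x => ∑ i, sd i (sd i f) x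

lemma pd_add {F G : Mink → E} {p : Mink} (hF : DifferentiableAt ℝ F p)
    (hG : DifferentiableAt ℝ G p) (μ : Fin 4) :
    pd μ (fun p => F p + G p) p = pd μ F p + pd μ G p := by
  rw [pd, fderiv_fun_add hF hG]
  rfl

lemma pd_sub {F G : Mink → E} {p : Mink} (hF : DifferentiableAt ℝ F p)
    (hG : DifferentiableAt ℝ G p) (μ : Fin 4) :
    pd μ (fun p => F p - G p) p = pd μ F p - pd μ G p := by
  rw [pd, fderiv_fun_sub hF hG]
  rfl

lemma pd_sum {ι : Type*} (s : Finset ι) {F : ι → Mink → E} {p : Mink}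
    (hF : ∀ i ∈ s, DifferentiableAt ℝ (F i) p) (μ : Fin 4) :
    pd μ (fun p => ∑ i ∈ s, F i p) p = ∑ i ∈ s, pd μ (F i) p := by
  rw [pd, fderiv_fun_sum hF]
  simp [pd]

/-- For A the spherical mean, ∂_t²(tA) = 2∂_t A + t ∂_t² A involves first and second moments of
derivatives of f. `smean_tangential`, applied to each ∂_j f, combines them to t times the mean of
the Laplacian. -/
lemma pd_zero_pd_zero_waveT {f : Space → E} (hf : ContDiff ℝ 2 f) :
    pd 0 (pd 0 (waveT f)) = waveT (lap f) := by
  ext p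
  have h1 : ContDiff ℝ 1 f := hf.of_le (by norm_num)
  have hs : ∀ i, ContDiff ℝ 1 (sd i f) := fun i => contDiff_sd (n := 1) hf i
  have d1 := (contDiff_one_smean (k := fun _ => 1) continuous_const h1).differentiable
    (by norm_num) p
  have d2 : ∀ i : Fin 3, DifferentiableAt ℝ (smean (fun z => (z : Space) i * 1) (sd i f)) p :=
    fun i => (contDiff_one_smean (by fun_prop) (hs i)).differentiable (by norm_num) p
  have d3 : DifferentiableAt ℝ (fun p => ∑ i : Fin 3,
      smean (fun z => (z : Space) i * 1) (sd i f) p) p := by fun_prop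
  rw [pd_zero_waveT h1, pd_add d1 (by fun_prop), pd_fst_smul d3, pd_sum _ (fun i _ => d2 i),
    pd_zero_smean continuous_const h1]
  have h2 : ∀ i, pd 0 (smean (fun z => (z : Space) i * 1) (sd i f)) p =
      ∑ j, smean (fun z => (z : Space) j * ((z : Space) i * 1)) (sd j (sd i f)) p := fun i => by
    rw [pd_zero_smean (by fun_prop) (hs i)]
  simp only [h2]
  have h3 : waveT (lap f) p = p.1 • ∑ j, smean (fun _ => 1) (sd j (sd j f)) p := by
    rw [waveT]
    congr 1
    exact smean_sum continuous_const _ (fun i _ => continuous_sd (hs i) i) p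
  have h4 : ∀ j, p.1 • smean (fun _ => 1) (sd j (sd j f)) p =
      p.1 • (∑ i, smean (fun z => (z : Space) j * ((z : Space) i * 1)) (sd i (sd j f)) p) +
      (2 : ℝ) • smean (fun z => (z : Space) j * 1) (sd j f) p := fun j => by
    rw [← smean_tangential (hs j) j p]; module
  rw [h3, Finset.smul_sum (f := fun j => smean (fun _ => 1) (sd j (sd j f)) p),
    Finset.sum_congr rfl fun j _ => h4 j]
  simp only [Finset.smul_sum, coordVec_zero, one_smul, two_smul, Finset.sum_add_distrib]
  simp only [mul_left_comm]
  abel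

end

/-! ### Vector fields acting on solutions of the wave equation -/

section

variable {E : Type} [NormedAddCommGroup E] [NormedSpace ℝ E]

lemma sd_add {f g : Space → E} (hf : Differentiable ℝ f) (hg : Differentiable ℝ g) (i : Fin 3) :
    sd i (fun y => f y + g y) = fun y => sd i f y + sd i g y := by
  ext y
  rw [sd, fderiv_fun_add (hf y) (hg y)]
  rfl

lemma sd_coord_smul {f : Space → E} (hf : Differentiable ℝ f) (i j : Fin 3) :
    sd j (fun y => y i • f y) = fun y => (if j = i then f y else 0) + y i • sd j f y := by
  ext y
  have e : HasFDerivAt (fun y : Space => y i) (EuclideanSpace.proj i : Space →L[ℝ] ℝ) y :=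
    (EuclideanSpace.proj i : Space →L[ℝ] ℝ).hasFDerivAt
  rw [sd, (e.fun_smul (hf y).hasFDerivAt).fderiv]
  by_cases hl : j = i
  · subst hl; simp [sd, add_comm]
  · simp [sd, hl, Ne.symm hl]

lemma sd_comm {f : Space → E} (hf : ContDiff ℝ 2 f) (i j : Fin 3) :
    sd i (sd j f) = sd j (sd i f) := by
  have hd : Differentiable ℝ (fderiv ℝ f) :=
    (hf.fderiv_right (m := 1) (by norm_num)).differentiable (by norm_num)
  have h : ∀ (i j : Fin 3) (y : Space), sd i (sd j f) y = fderiv ℝ (fderiv ℝ f) y (bas i) (bas j) :=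
    fun i j y => by
      change fderiv ℝ (fun y => fderiv ℝ f y (bas j)) y (bas i) = _
      rw [fderiv_clm_apply (hd y) (differentiableAt_const _)]
      simp
  ext y
  rw [h, h]
  have := (hf.contDiffAt (x := y)).isSymmSndFDerivAt (by simp)
  exact this (bas i) (bas j)

lemma contDiff_succ_of_sd {n : ℕ} {f : Space → E} (hf : ContDiff ℝ 1 f)
    (h : ∀ i, ContDiff ℝ n (sd i f)) : ContDiff ℝ (n + 1 : ℕ) f := by
  have : ((n + 1 : ℕ) : WithTop ℕ∞) = (n : WithTop ℕ∞) + 1 := by norm_cast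
  rw [this, contDiff_succ_iff_fderiv]
  refine ⟨hf.differentiable (by norm_num), by simp, ?_⟩
  have e : fderiv ℝ f = fun y => ∑ i : Fin 3,
      (EuclideanSpace.proj i : Space →L[ℝ] ℝ).smulRight (sd i f y) := by
    ext y v
    rw [fderiv_eq_sum_sd]
    simp
  rw [e]
  refine ContDiff.sum fun i _ => ?_
  exact (ContinuousLinearMap.smulRightL ℝ Space E
    (EuclideanSpace.proj i : Space →L[ℝ] ℝ)).contDiff.comp (h i)

/-- The solution of the wave equation with the Cauchy data `(f, g)` (Kirchhoff's formula). -/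
def waveP (f g : Space → E) : Mink → E := fun p => pd 0 (waveT f) p + waveT g p

lemma continuous_pd_zero_waveT {f : Space → E} (hf : ContDiff ℝ 1 f) :
    Continuous (pd 0 (waveT f)) := by
  rw [pd_zero_waveT hf]
  refine (continuous_smean continuous_const hf.continuous).add (continuous_fst.smul
    (continuous_finsetSum _ fun i _ => continuous_smean (by fun_prop) (continuous_sd hf i)))

lemma continuous_waveP {f g : Space → E} (hf : ContDiff ℝ 1 f) (hg : Continuous g) :
    Continuous (waveP f g) :=
  (continuous_pd_zero_waveT hf).add (continuous_waveT hg)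

lemma contDiff_one_waveP {f g : Space → E} (hf : ContDiff ℝ 2 f) (hg : ContDiff ℝ 1 g) :
    ContDiff ℝ 1 (waveP f g) :=
  (contDiff_one_pd_zero_waveT hf).add (contDiff_one_waveT hg)

lemma pd_succ_pd_zero_waveT {f : Space → E} (hf : ContDiff ℝ 2 f) (i : Fin 3) :
    pd i.succ (pd 0 (waveT f)) = pd 0 (waveT (sd i f)) := by
  ext p
  have h1 : ContDiff ℝ 1 f := hf.of_le (by norm_num)
  have hs : ∀ i, ContDiff ℝ 1 (sd i f) := fun i => contDiff_sd (n := 1) hf i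
  have d1 := (contDiff_one_smean (k := fun _ => 1) continuous_const h1).differentiable
    (by norm_num) p
  have d2 : ∀ i : Fin 3, DifferentiableAt ℝ (smean (fun z => (z : Space) i * 1) (sd i f)) p :=
    fun i => (contDiff_one_smean (by fun_prop) (hs i)).differentiable (by norm_num) p
  have d3 : DifferentiableAt ℝ (fun p => ∑ i : Fin 3,
      smean (fun z => (z : Space) i * 1) (sd i f) p) p := by fun_prop
  rw [pd_zero_waveT h1, pd_zero_waveT (hs i), pd_add d1 (by fun_prop), pd_fst_smul d3,
    pd_sum _ (fun i _ => d2 i), pd_succ_smean continuous_const h1]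
  have h2 : ∀ j, pd i.succ (smean (fun z => (z : Space) j * 1) (sd j f)) p =
      smean (fun z => (z : Space) j * 1) (sd j (sd i f)) p := fun j => by
    rw [pd_succ_smean (by fun_prop) (hs j), sd_comm hf]
  simp only [h2, coordVec_succ, zero_smul, add_zero]

lemma pd_succ_waveP {f g : Space → E} (hf : ContDiff ℝ 2 f) (hg : ContDiff ℝ 1 g) (i : Fin 3) :
    pd i.succ (waveP f g) = waveP (sd i f) (sd i g) := by
  ext p
  unfold waveP
  rw [pd_add ((contDiff_one_pd_zero_waveT hf).differentiable (by norm_num) p)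
    ((contDiff_one_waveT hg).differentiable (by norm_num) p), pd_succ_pd_zero_waveT hf,
    pd_succ_waveT hg]

/-- The wave equation for T replaces ∂_t² T f by T(Δf), so Kirchhoff solutions are closed under ∂_t.
-/
lemma pd_zero_waveP {f g : Space → E} (hf : ContDiff ℝ 2 f) (hg : ContDiff ℝ 1 g) :
    pd 0 (waveP f g) = waveP g (lap f) := by
  ext p
  unfold waveP
  rw [pd_add ((contDiff_one_pd_zero_waveT hf).differentiable (by norm_num) p)
    ((contDiff_one_waveT hg).differentiable (by norm_num) p), pd_zero_pd_zero_waveT hf, add_comm]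

/-- The first moments `t² A[z_i f(x + t z)]`. -/
def waveV (i : Fin 3) (f : Space → E) : Mink → E :=
  fun p => p.1 • (p.1 • smean (fun z => (z : Space) i * 1) f p)

lemma contDiff_one_waveV {f : Space → E} (hf : ContDiff ℝ 1 f) (i : Fin 3) :
    ContDiff ℝ 1 (waveV i f) :=
  contDiff_fst.smul (contDiff_fst.smul (contDiff_one_smean (by fun_prop) hf))

/-- The derivative of t² A[z_i f] is 2t A[z_i f] + t² Σ_j A[z_i z_j ∂_j f], which `smean_tangential`
collapses to t² A[∂_i f]. -/
lemma pd_zero_waveV {f : Space → E} (hf : ContDiff ℝ 1 f) (i : Fin 3) (p : Mink) :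
    pd 0 (waveV i f) p = p.1 • waveT (sd i f) p := by
  have d := (contDiff_one_smean (k := fun z : Sph => (z : Space) i * 1) (by fun_prop)
    hf).differentiable (by norm_num) p
  unfold waveV
  rw [pd_fst_smul (by fun_prop), pd_fst_smul d, pd_zero_smean (by fun_prop) hf, waveT]
  have h := smean_tangential hf i p
  have h' : p.1 • smean (fun _ => 1) (sd i f) p =
      p.1 • (∑ j, smean (fun z => (z : Space) i * ((z : Space) j * 1)) (sd j f) p) +
      (2 : ℝ) • smean (fun z => (z : Space) i * 1) f p := by
    rw [← h]; module
  rw [h']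
  simp only [coordVec_zero, one_smul, mul_left_comm]
  module

/-- On the sphere of radius t about x the i-th coordinate is x_i + t z_i. -/
lemma waveT_coord_smul {f : Space → E} (hf : Continuous f) (i : Fin 3) :
    waveT (fun y => y i • f y) = fun p => p.2 i • waveT f p + waveV i f p := by
  ext p
  simp only [waveT, waveV, smean_coord_smul (k := fun _ => 1) continuous_const hf]
  module

lemma pd_zero_coord_smul {F : Mink → E} {p : Mink} (hF : DifferentiableAt ℝ F p) (i : Fin 3) :
    pd 0 (fun p => p.2 i • F p) p = p.2 i • pd 0 F p := by
  have e : HasFDerivAt (fun p : Mink => p.2 i)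
      ((EuclideanSpace.proj i : Space →L[ℝ] ℝ).comp (ContinuousLinearMap.snd ℝ ℝ Space)) p :=
    ((EuclideanSpace.proj i : Space →L[ℝ] ℝ).comp (ContinuousLinearMap.snd ℝ ℝ Space)).hasFDerivAt
  rw [pd, (e.fun_smul hF.hasFDerivAt).fderiv]
  simp [pd]

/-- The commutator of the solution operator with multiplication by a coordinate. In the rotations,
boosts and scaling below these corrections cancel or are absorbed in the data. -/
lemma waveP_coord_smul {f g : Space → E} (hf : ContDiff ℝ 1 f) (hg : Continuous g) (i : Fin 3)
    (p : Mink) :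
    waveP (fun y => y i • f y) (fun y => y i • g y) p =
      p.2 i • waveP f g p + (p.1 • waveT (sd i f) p + waveV i g p) := by
  have d := (contDiff_one_waveT hf).differentiable (by norm_num) p
  have e : DifferentiableAt ℝ (fun p : Mink => p.2 i) p := by fun_prop
  simp only [waveP]
  rw [waveT_coord_smul hf.continuous, waveT_coord_smul hg,
    pd_add (e.fun_smul d) ((contDiff_one_waveV hf i).differentiable (by norm_num) p),
    pd_zero_coord_smul d, pd_zero_waveV hf]
  module

lemma waveV_rotation {h : Space → E} (hh : ContDiff ℝ 1 h) (i j : Fin 3) :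
    waveV i (sd j h) = waveV j (sd i h) := by
  ext p
  simp only [waveV]
  rw [smean_rotation hh]

lemma waveT_add {f g : Space → E} (hf : Continuous f) (hg : Continuous g) :
    waveT (fun y => f y + g y) = fun p => waveT f p + waveT g p := by
  ext p
  simp only [waveT, smean_add (k := fun _ => 1) continuous_const hf hg, smul_add]

lemma waveT_sub {f g : Space → E} (hf : Continuous f) (hg : Continuous g) :
    waveT (fun y => f y - g y) = fun p => waveT f p - waveT g p := by
  ext p
  simp only [waveT, smean_sub (k := fun _ => 1) continuous_const hf hg, smul_sub]

lemma waveT_sum {ι : Type*} (s : Finset ι) {f : ι → Space → E} (hf : ∀ i ∈ s, Continuous (f i)) :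
    waveT (fun y => ∑ i ∈ s, f i y) = fun p => ∑ i ∈ s, waveT (f i) p := by
  ext p
  simp only [waveT, smean_sum (k := fun _ => 1) continuous_const s hf, Finset.smul_sum]

lemma waveP_sub {f f' g g' : Space → E} (hf : ContDiff ℝ 1 f) (hf' : ContDiff ℝ 1 f')
    (hg : Continuous g) (hg' : Continuous g') :
    waveP (fun y => f y - f' y) (fun y => g y - g' y) = fun p => waveP f g p - waveP f' g' p := by
  ext p
  simp only [waveP]
  rw [waveT_sub hf.continuous hf'.continuous, waveT_sub hg hg',
    pd_sub ((contDiff_one_waveT hf).differentiable (by norm_num) p)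
      ((contDiff_one_waveT hf').differentiable (by norm_num) p)]
  abel_nf

lemma waveP_sum {ι : Type*} (s : Finset ι) {f g : ι → Space → E}
    (hf : ∀ i ∈ s, ContDiff ℝ 1 (f i)) (hg : ∀ i ∈ s, Continuous (g i)) :
    waveP (fun y => ∑ i ∈ s, f i y) (fun y => ∑ i ∈ s, g i y) =
      fun p => ∑ i ∈ s, waveP (f i) (g i) p := by
  ext p
  simp only [waveP]
  rw [waveT_sum s fun i hi => (hf i hi).continuous, waveT_sum s hg,
    pd_sum s fun i hi => (contDiff_one_waveT (hf i hi)).differentiable (by norm_num) p,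
    Finset.sum_add_distrib]

/-- The corrections from `waveP_coord_smul` are t T(∂_i∂_j f) + V_i(∂_j g) and the same with i and j
exchanged. They agree, by symmetry of second derivatives and by `waveV_rotation`. -/
lemma waveP_rotation {f g : Space → E} (hf : ContDiff ℝ 2 f) (hg : ContDiff ℝ 1 g) (i j : Fin 3)
    (p : Mink) :
    p.2 i • pd j.succ (waveP f g) p - p.2 j • pd i.succ (waveP f g) p =
      waveP (fun y => y i • sd j f y - y j • sd i f y)
        (fun y => y i • sd j g y - y j • sd i g y) p := by
  have hs : ∀ i, ContDiff ℝ 1 (sd i f) := fun i => contDiff_sd (n := 1) hf i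
  have hc : ∀ i j : Fin 3, ContDiff ℝ 1 (fun y : Space => y i • sd j f y) := fun i j =>
    (by fun_prop : ContDiff ℝ 1 fun y : Space => y i).smul (hs j)
  have hg' := fun i => continuous_sd hg i
  rw [waveP_sub (hc i j) (hc j i) (by fun_prop) (by fun_prop)]
  simp only [waveP_coord_smul (hs _) (hg' _), pd_succ_waveP hf hg]
  rw [waveV_rotation hg, sd_comm hf i j]
  abel

/-- The data on the right are the values at t = 0 of the boosted solution and of its time
derivative, with ∂_t² replaced by Δ. -/
lemma waveP_boost {f g : Space → E} (hf : ContDiff ℝ 2 f) (hg : ContDiff ℝ 1 g) (i : Fin 3)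
    (p : Mink) :
    p.1 • pd i.succ (waveP f g) p + p.2 i • pd 0 (waveP f g) p =
      waveP (fun y => y i • g y) (fun y => y i • lap f y + sd i f y) p := by
  have hs : ∀ i, ContDiff ℝ 1 (sd i f) := fun i => contDiff_sd (n := 1) hf i
  have hss : ∀ j, Continuous (sd j (sd j f)) := fun j => continuous_sd (hs j) j
  have hl : Continuous (lap f) := continuous_finsetSum _ fun j _ => hss j
  have h1 : waveP (fun y => y i • g y) (fun y => y i • lap f y + sd i f y) p =
      waveP (fun y => y i • g y) (fun y => y i • lap f y) p + waveT (sd i f) p := by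
    simp only [waveP]
    rw [waveT_add (by fun_prop) (hs i).continuous]
    abel_nf
  have h2 : p.1 • pd 0 (waveT (sd i f)) p = waveT (sd i f) p + waveV i (lap f) p := by
    -- The first moments of ∂_j∂_i f against z_j are turned into those of ∂_j∂_j f against z_i by
    -- `smean_rotation`. This produces the Laplacian that cancels the correction from x_i ∂_t.
    rw [pd_zero_waveT (hs i), waveT, waveV]
    have : smean (fun z => (z : Space) i * 1) (lap f) p =
        ∑ j, smean (fun z => (z : Space) i * 1) (sd j (sd j f)) p :=
      smean_sum (by fun_prop) _ (fun j _ => hss j) p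
    rw [this]
    simp only [Finset.smul_sum, smul_add]
    congr 1
    refine Finset.sum_congr rfl fun j _ => ?_
    rw [smean_rotation (hs j), sd_comm hf]
  rw [h1, waveP_coord_smul hg hl, pd_succ_waveP hf hg, pd_zero_waveP hf hg]
  rw [waveP, smul_add, h2]
  abel

/-- The additional g in the second datum is the commutator [∂_t, S] = ∂_t evaluated at t = 0. -/
lemma waveP_scaling {f g : Space → E} (hf : ContDiff ℝ 2 f) (hg : ContDiff ℝ 1 g) (p : Mink) :
    p.1 • pd 0 (waveP f g) p + ∑ i : Fin 3, p.2 i • pd i.succ (waveP f g) p =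
      waveP (fun y => ∑ i, y i • sd i f y) (fun y => (∑ i, y i • sd i g y) + g y) p := by
  have hs : ∀ i, ContDiff ℝ 1 (sd i f) := fun i => contDiff_sd (n := 1) hf i
  have hss : ∀ j, Continuous (sd j (sd j f)) := fun j => continuous_sd (hs j) j
  have hc : ∀ i j : Fin 3, ContDiff ℝ 1 (fun y : Space => y i • sd j f y) := fun i j =>
    (by fun_prop : ContDiff ℝ 1 fun y : Space => y i).smul (hs j)
  have hg' := fun i => continuous_sd hg i
  have hgc := hg.continuous
  have h1 : waveP (fun y => ∑ i, y i • sd i f y) (fun y => (∑ i, y i • sd i g y) + g y) p =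
      waveP (fun y => ∑ i, y i • sd i f y) (fun y => ∑ i, y i • sd i g y) p + waveT g p := by
    simp only [waveP]
    rw [waveT_add (by fun_prop) (by fun_prop)]
    abel_nf
  have h2 : p.1 • pd 0 (waveT g) p = waveT g p + ∑ i, waveV i (sd i g) p := by
    rw [pd_zero_waveT hg]
    simp only [waveT, waveV, Finset.smul_sum, smul_add]
  have h3 : waveT (lap f) p = ∑ j, waveT (sd j (sd j f)) p :=
    congrFun (waveT_sum Finset.univ fun j _ => hss j) p
  rw [h1, waveP_sum Finset.univ (fun i _ => hc i i) (fun i _ => by fun_prop)]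
  simp only [waveP_coord_smul (hs _) (hg' _), pd_succ_waveP hf hg, pd_zero_waveP hf hg]
  rw [waveP, smul_add, h2, h3, Finset.smul_sum]
  simp only [Finset.sum_add_distrib]
  abel

end

/-! ### Classes of weighted functions -/

lemma one_le_bracket (a : ℝ) : 1 ≤ bracket a := by
  rw [bracket, Real.one_le_sqrt]
  nlinarith [sq_nonneg a]

lemma bracket_pos (a : ℝ) : 0 < bracket a := lt_of_lt_of_le one_pos (one_le_bracket a)

lemma abs_le_bracket (a : ℝ) : |a| ≤ bracket a := by
  rw [bracket, ← Real.sqrt_sq_eq_abs]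
  exact Real.sqrt_le_sqrt (by linarith)

/-- `f` is of class `C^a` and `|∂^α f| ≤ M ⟨x⟩^{β - |α|}` for `|α| ≤ a`. -/
def Sym : ℕ → ℝ → ℝ → (Space → ℂ) → Prop
  | 0, β, M, f => Continuous f ∧ ∀ x, ‖f x‖ ≤ M * bracket ‖x‖ ^ β
  | a + 1, β, M, f => ContDiff ℝ 1 f ∧ (∀ x, ‖f x‖ ≤ M * bracket ‖x‖ ^ β) ∧
      ∀ i, Sym a (β - 1) M (sd i f)

lemma Sym.bound {a : ℕ} {β M : ℝ} {f : Space → ℂ} (h : Sym a β M f) (x : Space) :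
    ‖f x‖ ≤ M * bracket ‖x‖ ^ β := by
  cases a
  · exact h.2 x
  · exact h.2.1 x

lemma Sym.nonneg {a : ℕ} {β M : ℝ} {f : Space → ℂ} (h : Sym a β M f) : 0 ≤ M := by
  have := (norm_nonneg _).trans (h.bound 0)
  simpa [bracket] using this

lemma Sym.contDiff {a : ℕ} {β M : ℝ} {f : Space → ℂ} (h : Sym a β M f) : ContDiff ℝ a f := by
  induction a generalizing β f with
  | zero => exact contDiff_zero.2 h.1
  | succ a ih => exact contDiff_succ_of_sd h.1 fun i => ih (h.2.2 i)

lemma Sym.continuous {a : ℕ} {β M : ℝ} {f : Space → ℂ} (h : Sym a β M f) : Continuous f :=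
  h.contDiff.continuous

lemma Sym.pred {a : ℕ} {β M : ℝ} {f : Space → ℂ} (h : Sym (a + 1) β M f) : Sym a β M f := by
  induction a generalizing β f with
  | zero => exact ⟨h.continuous, h.bound⟩
  | succ a ih => exact ⟨h.1, h.bound, fun i => ih (h.2.2 i)⟩

lemma Sym.mono {a : ℕ} {β M M' : ℝ} {f : Space → ℂ} (h : Sym a β M f) (hM : M ≤ M') :
    Sym a β M' f := by
  have hb : ∀ x, ‖f x‖ ≤ M' * bracket ‖x‖ ^ β := fun x => (h.bound x).trans
    (mul_le_mul_of_nonneg_right hM (Real.rpow_nonneg (bracket_pos _).le _))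
  induction a generalizing β f with
  | zero => exact ⟨h.continuous, hb⟩
  | succ a ih =>
    refine ⟨h.1, hb, fun i => ih (h.2.2 i) fun x => ((h.2.2 i).bound x).trans
      (mul_le_mul_of_nonneg_right hM (Real.rpow_nonneg (bracket_pos _).le _))⟩

lemma Sym.add {a : ℕ} {β M M' : ℝ} {f g : Space → ℂ} (hf : Sym a β M f) (hg : Sym a β M' g) :
    Sym a β (M + M') (fun x => f x + g x) := by
  have hb : ∀ {a : ℕ} {β : ℝ} {f g : Space → ℂ}, Sym a β M f → Sym a β M' g →
      ∀ x, ‖f x + g x‖ ≤ (M + M') * bracket ‖x‖ ^ β := fun hf hg x => by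
    rw [add_mul]
    exact norm_add_le_of_le (hf.bound x) (hg.bound x)
  induction a generalizing β f g with
  | zero => exact ⟨hf.continuous.add hg.continuous, hb hf hg⟩
  | succ a ih =>
    refine ⟨hf.1.add hg.1, hb hf hg, fun i => ?_⟩
    rw [sd_add (hf.1.differentiable (by norm_num)) (hg.1.differentiable (by norm_num))]
    exact ih (hf.2.2 i) (hg.2.2 i)

lemma Sym.neg {a : ℕ} {β M : ℝ} {f : Space → ℂ} (hf : Sym a β M f) :
    Sym a β M (fun x => -f x) := by
  induction a generalizing β f with
  | zero => exact ⟨hf.continuous.neg, fun x => by simpa using hf.bound x⟩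
  | succ a ih =>
    refine ⟨hf.1.neg, fun x => by simpa using hf.bound x, fun i => ?_⟩
    have : sd i (fun x => -f x) = fun x => -sd i f x := by
      ext x; simp [sd]
    rw [this]
    exact ih (hf.2.2 i)

lemma Sym.zero (a : ℕ) {β M : ℝ} (hM : 0 ≤ M) : Sym a β M (fun _ => 0) := by
  have hb : ∀ (β : ℝ) (x : Space), ‖(0 : ℂ)‖ ≤ M * bracket ‖x‖ ^ β := fun β x => by
    simpa using mul_nonneg hM (Real.rpow_nonneg (bracket_pos _).le _)
  induction a generalizing β with
  | zero => exact ⟨continuous_const, hb β⟩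
  | succ a ih =>
    refine ⟨contDiff_const, hb β, fun i => ?_⟩
    have : sd i (fun _ : Space => (0 : ℂ)) = fun _ => 0 := by
      ext x; simp [sd]
    rw [this]
    exact ih

/-- Each derivative can fall on the coordinate at the price of one more copy of f, which is already
of the right order. Up to a derivatives therefore give the factor a + 1. -/
lemma Sym.coord_smul {a : ℕ} {β M : ℝ} {f : Space → ℂ} (hf : Sym a β M f) (i : Fin 3) :
    Sym a (β + 1) ((a + 1) * M) (fun x => x i • f x) := by
  have hb : ∀ x, ‖x i • f x‖ ≤ (a + 1) * M * bracket ‖x‖ ^ (β + 1) := fun x => by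
    rw [norm_smul, Real.rpow_add_one (bracket_pos _).ne']
    have h1 : ‖x i‖ ≤ bracket ‖x‖ := (PiLp.norm_apply_le x i).trans
      ((le_abs_self _).trans (abs_le_bracket _))
    have h2 := hf.bound x
    have h3 : M ≤ (a + 1) * M := by nlinarith [hf.nonneg, Nat.cast_nonneg (α := ℝ) a]
    have h4 : (0 : ℝ) ≤ bracket ‖x‖ ^ β := Real.rpow_nonneg (bracket_pos _).le _
    calc ‖x i‖ * ‖f x‖ ≤ bracket ‖x‖ * ((a + 1) * M * bracket ‖x‖ ^ β) := by
          gcongr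
          · exact (bracket_pos _).le
          · exact h2.trans (by gcongr)
      _ = _ := by ring
  induction a generalizing β f with
  | zero => exact ⟨(by fun_prop : Continuous fun x : Space => x i).smul hf.continuous, hb⟩
  | succ a ih =>
    refine ⟨(by fun_prop : ContDiff ℝ 1 fun x : Space => x i).smul hf.1, hb, fun j => ?_⟩
    rw [sd_coord_smul (hf.1.differentiable (by norm_num)), add_sub_cancel_right]
    have h1 : Sym a β M (fun y => if j = i then f y else 0) := by
      by_cases h : j = i
      · simpa [h] using hf.pred
      · simpa [h] using Sym.zero a hf.nonneg
    have h2 : Sym a β ((a + 1) * M) (fun x => x i • sd j f x) := by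
      have := ih (hf.2.2 j) (fun x => ?_)
      · simpa using this
      · rw [norm_smul, sub_add_cancel]
        have h1 : ‖x i‖ ≤ bracket ‖x‖ := (PiLp.norm_apply_le x i).trans
          ((le_abs_self _).trans (abs_le_bracket _))
        have h2 := (hf.2.2 j).bound x
        have h3 : M ≤ (a + 1) * M := by nlinarith [hf.nonneg, Nat.cast_nonneg (α := ℝ) a]
        have h4 : (0 : ℝ) ≤ bracket ‖x‖ ^ (β - 1) := Real.rpow_nonneg (bracket_pos _).le _
        calc ‖x i‖ * ‖sd j f x‖ ≤ bracket ‖x‖ * ((a + 1) * M * bracket ‖x‖ ^ (β - 1)) := by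
              gcongr
              · exact (bracket_pos _).le
              · exact h2.trans (by gcongr)
          _ = _ := by
            rw [Real.rpow_sub_one (bracket_pos _).ne']
            field_simp [(bracket_pos ‖x‖).ne']
    refine (h1.add h2).mono (le_of_eq ?_)
    push_cast
    ring

/-- `χ` is a solution of the wave equation whose Cauchy data are of class `C^{a+1} × C^a` and
of order `β`. -/
def Good (a : ℕ) (β M : ℝ) (χ : Mink → ℂ) : Prop :=
  ∃ f g : Space → ℂ, Sym (a + 1) β M f ∧ Sym a (β - 1) M g ∧ χ = waveP f g

/-- The vector fields: translations, scaling, boosts and rotations. -/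
inductive Gen where
  | d (μ : Fin 4)
  | S
  | L (i : Fin 3)
  | R (i j : Fin 3)

/-- The decay gained by applying a vector field. -/
def Gen.wt : Gen → ℕ
  | .d _ => 1
  | _ => 0

/-- The action of the vector fields on functions. -/
def Gen.act : Gen → (Mink → ℂ) → Mink → ℂ
  | .d μ, F => pd μ F
  | .S, F => fun p => p.1 • pd 0 F p + ∑ i : Fin 3, p.2 i • pd i.succ F p
  | .L i, F => fun p => p.1 • pd i.succ F p + p.2 i • pd 0 F p
  | .R i j, F => fun p => p.2 i • pd j.succ F p - p.2 j • pd i.succ F p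

/-! ### Vector fields acting on solutions with data of a given order -/

lemma Sym.sd_sum_three {a : ℕ} {β M : ℝ} {f : Fin 3 → Space → ℂ} (h : ∀ i, Sym a β M (f i)) :
    Sym a β (3 * M) (fun x => ∑ i, f i x) := by
  simp only [Fin.sum_univ_three]
  exact (((h 0).add (h 1)).add (h 2)).mono (by linarith)

lemma Sym.lap {a : ℕ} {β M : ℝ} {f : Space → ℂ} (h : Sym (a + 2) β M f) :
    Sym a (β - 1 - 1) (3 * M) (lap f) :=
  Sym.sd_sum_three fun i => (h.2.2 i).2.2 i

lemma Good.mono {a : ℕ} {β M M' : ℝ} {χ : Mink → ℂ} (h : Good a β M χ) (hM : M ≤ M') :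
    Good a β M' χ := by
  obtain ⟨f, g, hf, hg, rfl⟩ := h
  exact ⟨f, g, hf.mono hM, hg.mono hM, rfl⟩

lemma Good.nonneg {a : ℕ} {β M : ℝ} {χ : Mink → ℂ} (h : Good a β M χ) : 0 ≤ M := by
  obtain ⟨f, g, hf, hg, rfl⟩ := h
  exact hf.nonneg

lemma Good.pred {a : ℕ} {β M : ℝ} {χ : Mink → ℂ} (h : Good (a + 1) β M χ) : Good a β M χ := by
  obtain ⟨f, g, hf, hg, rfl⟩ := h
  exact ⟨f, g, hf.pred, hg.pred, rfl⟩

lemma Sym.coord_smul_sd {a : ℕ} {β M : ℝ} {f : Space → ℂ} (hf : Sym (a + 1) β M f)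
    (i j : Fin 3) : Sym a β ((a + 1) * M) (fun x => x i • sd j f x) := by
  simpa using (hf.2.2 j).coord_smul i

/-- The transformed data are explicit, and a coordinate factor compensates every derivative except
for translations. The constant comes from sums over three indices, multiplication by a coordinate
and lower order terms; 3(a+3) covers all fields at once. -/
lemma Good.act {a : ℕ} {β M : ℝ} {χ : Mink → ℂ} (h : Good (a + 1) β M χ) (γ : Gen) :
    Good a (β - γ.wt) (3 * (a + 3) * M) (γ.act χ) := by
  obtain ⟨f, g, hf, hg, rfl⟩ := h
  have hM := hf.nonneg
  have ha : (0 : ℝ) ≤ a := Nat.cast_nonneg a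
  have haM : 0 ≤ a * M := mul_nonneg ha hM
  have cf : ContDiff ℝ 2 f := hf.contDiff.of_le (by norm_cast; omega)
  have cg : ContDiff ℝ 1 g := hg.1
  cases γ with
  | d μ =>
    simp only [Gen.wt, Gen.act, Nat.cast_one]
    refine Good.mono (M := 3 * M) ?_ (by nlinarith)
    cases μ using Fin.cases with
    | zero =>
      rw [pd_zero_waveP cf cg]
      exact ⟨_, _, hg.mono (by linarith), hf.lap, rfl⟩
    | succ i =>
      rw [pd_succ_waveP cf cg]
      exact ⟨_, _, (hf.2.2 i).mono (by linarith), (hg.2.2 i).mono (by linarith), rfl⟩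
  | S =>
    simp only [Gen.wt, Gen.act, Nat.cast_zero, sub_zero]
    refine ⟨_, _, ?_, ?_, funext fun p => waveP_scaling cf cg p⟩
    · exact (Sym.sd_sum_three fun i => hf.coord_smul_sd i i).mono (by push_cast; nlinarith)
    · refine ((Sym.sd_sum_three fun i => hg.coord_smul_sd i i).add hg.pred).mono (by nlinarith)
  | L i =>
    simp only [Gen.wt, Gen.act, Nat.cast_zero, sub_zero]
    refine ⟨_, _, ?_, ?_, funext fun p => waveP_boost cf cg i p⟩
    · have := hg.coord_smul i
      rw [sub_add_cancel] at this
      exact this.mono (by push_cast; nlinarith)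
    · have := hf.lap.coord_smul i
      rw [sub_add_cancel] at this
      exact (this.add (hf.2.2 i).pred).mono (by nlinarith)
  | R i j =>
    simp only [Gen.wt, Gen.act, Nat.cast_zero, sub_zero]
    refine ⟨_, _, ?_, ?_, funext fun p => waveP_rotation cf cg i j p⟩
    · simp only [sub_eq_add_neg]
      exact ((hf.coord_smul_sd i j).add (hf.coord_smul_sd j i).neg).mono (by push_cast; nlinarith)
    · simp only [sub_eq_add_neg]
      exact ((hg.coord_smul_sd i j).add (hg.coord_smul_sd j i).neg).mono (by nlinarith)

lemma Good.continuous {a : ℕ} {β M : ℝ} {χ : Mink → ℂ} (h : Good a β M χ) : Continuous χ := by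
  obtain ⟨f, g, hf, hg, rfl⟩ := h
  exact continuous_waveP (hf.contDiff.of_le (by norm_cast; omega)) hg.continuous

lemma Good.contDiff_one {a : ℕ} {β M : ℝ} {χ : Mink → ℂ} (h : Good (a + 1) β M χ) :
    ContDiff ℝ 1 χ := by
  obtain ⟨f, g, hf, hg, rfl⟩ := h
  exact contDiff_one_waveP (hf.contDiff.of_le (by norm_cast; omega))
    (hg.contDiff.of_le (by norm_cast; omega))

lemma mink_eq_sum (v : Mink) : v = v.1 • coordVec 0 + ∑ i : Fin 3, v.2 i • coordVec i.succ := by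
  refine Prod.ext ?_ ?_
  · simp [Fin.sum_univ_three]
  · conv_lhs => rw [space_eq_sum v.2]
    simp [Fin.sum_univ_three]

lemma fderiv_eq_sum_pd {E : Type} [NormedAddCommGroup E] [NormedSpace ℝ E] (F : Mink → E)
    (p v : Mink) : fderiv ℝ F p v = v.1 • pd 0 F p + ∑ i : Fin 3, v.2 i • pd i.succ F p := by
  conv_lhs => rw [mink_eq_sum v]
  rw [map_add, map_sum, map_smul]
  simp only [map_smul]
  rfl

lemma contDiff_succ_of_pd {E : Type} [NormedAddCommGroup E] [NormedSpace ℝ E] {n : ℕ}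
    {F : Mink → E} (hF : ContDiff ℝ 1 F)
    (h : ∀ μ, ContDiff ℝ n (pd μ F)) : ContDiff ℝ (n + 1 : ℕ) F := by
  have : ((n + 1 : ℕ) : WithTop ℕ∞) = (n : WithTop ℕ∞) + 1 := by norm_cast
  rw [this, contDiff_succ_iff_fderiv]
  refine ⟨hF.differentiable (by norm_num), by simp, ?_⟩
  have e : fderiv ℝ F = fun y => (ContinuousLinearMap.fst ℝ ℝ Space).smulRight (pd 0 F y) +
      ∑ i : Fin 3, ((EuclideanSpace.proj i : Space →L[ℝ] ℝ).comp
        (ContinuousLinearMap.snd ℝ ℝ Space)).smulRight (pd i.succ F y) := by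
    refine funext fun y => ContinuousLinearMap.ext fun v => ?_
    rw [fderiv_eq_sum_pd]
    simp
  rw [e]
  refine ContDiff.add ?_ (ContDiff.sum fun i _ => ?_)
  · exact (ContinuousLinearMap.smulRightL ℝ Mink E _).contDiff.comp (h 0)
  · exact (ContinuousLinearMap.smulRightL ℝ Mink E _).contDiff.comp (h i.succ)

/-- Induction on a: the first partial derivatives are themselves solutions of this kind with one
degree of regularity less. -/
lemma Good.contDiff {a : ℕ} {β M : ℝ} {χ : Mink → ℂ} (h : Good a β M χ) : ContDiff ℝ a χ := by
  induction a generalizing β M χ with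
  | zero => exact contDiff_zero.2 h.continuous
  | succ a ih => exact contDiff_succ_of_pd h.contDiff_one fun μ => ih (h.act (.d μ))

/-! ### Pointwise decay -/

lemma bracket_nonneg (a : ℝ) : 0 ≤ bracket a := (bracket_pos a).le

lemma bracket_sq (a : ℝ) : bracket a ^ 2 = 1 + a ^ 2 := by
  rw [bracket, Real.sq_sqrt (by positivity)]

lemma bracket_mono {a b : ℝ} (h : |a| ≤ |b|) : bracket a ≤ bracket b := by
  unfold bracket
  exact Real.sqrt_le_sqrt (by have := sq_le_sq.2 h; linarith)

lemma bracket_mul_le {a c : ℝ} (hc : 1 ≤ c) : bracket (c * a) ≤ c * bracket a := by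
  have h0 : 0 ≤ c * bracket a := by have := bracket_nonneg a; positivity
  refine abs_le_of_sq_le_sq' ?_ h0 |>.2
  rw [mul_pow, bracket_sq, bracket_sq]
  nlinarith [sq_nonneg a]

lemma rpow_le_of_comparable {a b c γ : ℝ} (ha : 0 < a) (hb : 0 < b) (hc : 1 ≤ c)
    (h1 : a ≤ c * b) (h2 : b ≤ c * a) : a ^ γ ≤ c ^ |γ| * b ^ γ := by
  have hc0 : 0 < c := by linarith
  rcases le_total 0 γ with h | h
  · rw [abs_of_nonneg h, ← Real.mul_rpow hc0.le hb.le]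
    exact Real.rpow_le_rpow ha.le h1 h
  · rw [abs_of_nonpos h]
    have h3 : b / c ≤ a := by rw [div_le_iff₀ hc0]; linarith
    have h4 : a ^ γ ≤ (b / c) ^ γ := Real.rpow_le_rpow_of_nonpos (by positivity) h3 h
    rw [Real.div_rpow hb.le hc0.le] at h4
    rw [Real.rpow_neg hc0.le]
    exact h4.trans (le_of_eq (by ring))

/-! ### Moments and means of zonal functions on the unit sphere -/

lemma hasFDerivAt_inner_pow (e y : Space) (n : ℕ) :
    HasFDerivAt (fun y : Space => inner ℝ e y ^ n)
      ((n * inner ℝ e y ^ (n - 1)) • (innerSL ℝ e)) y := by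
  have h := (innerSL ℝ e).hasFDerivAt (x := y)
  have := h.pow n
  convert! this using 1
  simp

lemma inner_eq_sum_coord (e z : Space) : inner ℝ e z = ∑ j : Fin 3, e j * z j := by
  rw [PiLp.inner_apply]
  simp [mul_comm]

/-- Take h(y) = ⟨e,y⟩^(n+1) in `smean_tangential` at t = 1, x = 0 and contract with e. For the
moments m_n this reads (n+1)(m_n - m_(n+2)) = 2 m_(n+2), the recursion that the moments of [-1,1]
satisfy. -/
lemma moment_recursion {e : Space} (he : ‖e‖ = 1) (n : ℕ) :
    ((n : ℝ) + 1) * ∫ z : Sph, inner ℝ e (z : Space) ^ n ∂sphMeas =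
      (n + 3) * ∫ z : Sph, inner ℝ e (z : Space) ^ (n + 2) ∂sphMeas := by
  have hh : ContDiff ℝ 1 (fun y : Space => inner ℝ e y ^ (n + 1)) :=
    (innerSL ℝ e).contDiff.pow (n + 1)
  have hsd : ∀ j, sd j (fun y : Space => inner ℝ e y ^ (n + 1)) =
      fun y => ((n : ℝ) + 1) * inner ℝ e y ^ n * e j := fun j => by
    ext y
    rw [sd, (hasFDerivAt_inner_pow e y (n + 1)).fderiv]
    have : inner ℝ e (bas j) = e j := by simp [inner_eq_sum_coord]
    simp [this]
  have hkey : ∀ j, ((n : ℝ) + 1) * e j * ∫ z : Sph, inner ℝ e (z : Space) ^ n ∂sphMeas =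
      (n + 3) * ∫ z : Sph, (z : Space) j * inner ℝ e (z : Space) ^ (n + 1) ∂sphMeas := fun j => by
    have h := smean_tangential hh j (1, 0)
    simp only [hsd, smean, one_smul, zero_add, smul_eq_mul, mul_one] at h
    have h1 : ∑ i : Fin 3, ∫ z : Sph, (z : Space) j * (z : Space) i *
        ((n + 1) * inner ℝ e (z : Space) ^ n * e i) ∂sphMeas =
        (n + 1) * ∫ z : Sph, (z : Space) j * inner ℝ e (z : Space) ^ (n + 1) ∂sphMeas := by
      rw [← integral_finsetSum _ fun i _ => integrable_of_compact (by fun_prop),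
        ← integral_const_mul]
      congr 1
      ext z
      rw [pow_succ, inner_eq_sum_coord e z]
      simp only [Fin.sum_univ_three]
      ring
    have h2 : ∫ z : Sph, 1 * ((n + 1) * inner ℝ e (z : Space) ^ n * e j) ∂sphMeas =
        (n + 1) * e j * ∫ z : Sph, inner ℝ e (z : Space) ^ n ∂sphMeas := by
      rw [← integral_const_mul]
      congr 1
      ext z
      ring
    simp only [one_mul] at h h2
    rw [h1, h2] at h
    linarith
  have hs : ∑ j, e j * e j = 1 := by
    have := EuclideanSpace.real_norm_sq_eq e
    rw [he] at this
    simp only [← sq]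
    linarith
  calc ((n : ℝ) + 1) * ∫ z : Sph, inner ℝ e (z : Space) ^ n ∂sphMeas
      = ∑ j, e j * (((n : ℝ) + 1) * e j * ∫ z : Sph, inner ℝ e (z : Space) ^ n ∂sphMeas) := by
        have : ∀ A : ℝ, ∑ j, e j * (((n : ℝ) + 1) * e j * A) = (n + 1) * A * ∑ j, e j * e j :=
          fun A => by rw [Finset.mul_sum]; exact Finset.sum_congr rfl fun _ _ => by ring
        rw [this, hs, mul_one]
    _ = (n + 3) * ∑ j, ∫ z : Sph, e j * ((z : Space) j * inner ℝ e (z : Space) ^ (n + 1))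
          ∂sphMeas := by
        rw [Finset.mul_sum]
        refine Finset.sum_congr rfl fun j _ => ?_
        rw [hkey, integral_const_mul]
        ring
    _ = _ := by
        rw [← integral_finsetSum _ fun i _ => integrable_of_compact (by fun_prop)]
        congr 2
        ext z
        rw [pow_succ _ (n + 1), inner_eq_sum_coord e z]
        simp only [Fin.sum_univ_three]
        ring

/-- `smean_tangential` for a constant function. It starts the recursion for odd n. -/
lemma first_moment (e : Space) : ∫ z : Sph, inner ℝ e (z : Space) ∂sphMeas = 0 := by
  have h := fun j => smean_tangential (h := fun _ : Space => (1 : ℝ)) contDiff_const j (1, 0)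
  have h0 : ∀ j, sd j (fun _ : Space => (1 : ℝ)) = fun _ => 0 := fun j => by ext y; simp [sd]
  simp only [h0, smean, smul_eq_mul, mul_one, mul_zero, integral_zero, Finset.sum_const_zero,
    sub_zero] at h
  simp only [inner_eq_sum_coord]
  rw [integral_finsetSum _ fun i _ => integrable_of_compact (by fun_prop)]
  refine Finset.sum_eq_zero fun j _ => ?_
  rw [integral_const_mul]
  have := h j
  have h1 : ∫ z : Sph, (z : Space) j ∂sphMeas = 0 := by linarith
  rw [h1, mul_zero]

lemma moment {e : Space} (he : ‖e‖ = 1) (n : ℕ) :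
    ∫ z : Sph, inner ℝ e (z : Space) ^ n ∂sphMeas = (1 / 2) * ∫ s in (-1 : ℝ)..1, s ^ n := by
  rw [integral_pow]
  induction n using Nat.twoStepInduction with
  | zero => norm_num
  | one => simp [first_moment]
  | more n ih _ =>
    have h := moment_recursion he n
    rw [ih] at h
    have h3 : ((n : ℝ) + 3) ≠ 0 := by positivity
    have h1 : ((n : ℝ) + 1) ≠ 0 := by positivity
    have : ∫ z : Sph, inner ℝ e (z : Space) ^ (n + 2) ∂sphMeas =
        ((n : ℝ) + 1) * (1 / 2 * ((1 ^ (n + 1) - (-1) ^ (n + 1)) / (↑n + 1))) / (n + 3) := by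
      rw [h]; field_simp
    rw [this]
    push_cast
    have h4 : ((n : ℝ) + 2 + 1) ≠ 0 := by positivity
    field_simp
    simp only [one_pow]
    ring

lemma abs_inner_sph_le {e : Space} (he : ‖e‖ = 1) (z : Sph) :
    inner ℝ e (z : Space) ∈ Set.Icc (-1 : ℝ) 1 := by
  have := abs_real_inner_le_norm e (z : Space)
  rw [he, norm_sph, mul_one] at this
  exact abs_le.1 this

/-- Archimedes' formula for zonal functions. -/
lemma integral_zonal {e : Space} (he : ‖e‖ = 1) {φ : ℝ → ℝ} (hφ : ContinuousOn φ (Set.Icc (-1) 1)) :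
    ∫ z : Sph, φ (inner ℝ e (z : Space)) ∂sphMeas = (1 / 2) * ∫ s in (-1 : ℝ)..1, φ s := by
  -- Polynomials are covered by the moments. Weierstrass approximation then gives all continuous φ.
  have hpoly : ∀ p : Polynomial ℝ, ∫ z : Sph, p.eval (inner ℝ e (z : Space)) ∂sphMeas =
      (1 / 2) * ∫ s in (-1 : ℝ)..1, p.eval s := by
    intro p
    simp only [Polynomial.eval_eq_sum_range]
    rw [integral_finsetSum _ fun i _ => integrable_of_compact (by fun_prop),
      intervalIntegral.integral_finsetSum fun i _ => (by fun_prop : Continuous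
        fun s : ℝ => p.coeff i * s ^ i).intervalIntegrable _ _, Finset.mul_sum]
    refine Finset.sum_congr rfl fun i _ => ?_
    rw [integral_const_mul, intervalIntegral.integral_const_mul, moment he]
    ring
  have hc : Continuous fun z : Sph => φ (inner ℝ e (z : Space)) := by
    rw [← continuousOn_univ]
    exact hφ.comp (by fun_prop) fun z _ => abs_inner_sph_le he z
  have hi : IntervalIntegrable φ volume (-1) 1 :=
    ContinuousOn.intervalIntegrable (by rwa [Set.uIcc_of_le (by norm_num)])
  refine eq_of_abs_sub_le_all fun ε hε => ?_
  -- Both sides are averages with total mass one, so a uniform error ε/2 costs at most ε/2 on each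
  -- side.
  obtain ⟨p, hp⟩ := exists_polynomial_near_of_continuousOn (-1) 1 φ hφ (ε / 2) (by linarith)
  have hpi : IntervalIntegrable (fun s => p.eval s) volume (-1) 1 :=
    p.continuous.intervalIntegrable _ _
  have h1 : |∫ z : Sph, (φ (inner ℝ e (z : Space)) - p.eval (inner ℝ e (z : Space))) ∂sphMeas| ≤
      ε / 2 := by
    have := norm_integral_le_of_norm_le_const (μ := sphMeas) (C := ε / 2)
      (f := fun z : Sph => φ (inner ℝ e (z : Space)) - p.eval (inner ℝ e (z : Space)))
      (Filter.Eventually.of_forall fun z => by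
        rw [Real.norm_eq_abs, abs_sub_comm]
        exact (hp _ (abs_inner_sph_le he z)).le)
    simpa using this
  have h2 : |∫ s in (-1 : ℝ)..1, (φ s - p.eval s)| ≤ ε / 2 * 2 := by
    have := intervalIntegral.norm_integral_le_of_norm_le_const (a := -1) (b := 1) (C := ε / 2)
      (f := fun s => φ s - p.eval s) (fun s hs => by
        rw [Set.uIoc_of_le (by norm_num)] at hs
        rw [Real.norm_eq_abs, abs_sub_comm]
        exact (hp s (Set.Ioc_subset_Icc_self hs)).le)
    rw [Real.norm_eq_abs] at this
    norm_num at this ⊢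
    linarith
  have hpc : Continuous fun z : Sph => p.eval (inner ℝ e (z : Space)) :=
    p.continuous.comp (by fun_prop)
  rw [integral_sub (integrable_of_compact hc) (integrable_of_compact hpc), hpoly] at h1
  rw [intervalIntegral.integral_sub hi hpi] at h2
  rw [abs_le] at h1 h2 ⊢
  constructor <;> linarith [h1.1, h1.2, h2.1, h2.2]

lemma integral_linear_rpow {c d κ : ℝ} (hd : 0 < d) (hc : d < c) (hκ : κ + 1 ≠ 0) :
    ∫ s in (-1 : ℝ)..1, (c + d * s) ^ κ =
      ((c + d) ^ (κ + 1) - (c - d) ^ (κ + 1)) / (d * (κ + 1)) := by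
  have hpos : ∀ s ∈ Set.uIcc (-1 : ℝ) 1, 0 < c + d * s := fun s hs => by
    rw [Set.uIcc_of_le (by norm_num)] at hs
    nlinarith [hs.1]
  have hder : ∀ s ∈ Set.uIcc (-1 : ℝ) 1,
      HasDerivAt (fun s => (c + d * s) ^ (κ + 1) / (d * (κ + 1))) ((c + d * s) ^ κ) s := by
    intro s hs
    have h1 : HasDerivAt (fun s => c + d * s) d s := by
      simpa using ((hasDerivAt_id s).const_mul d).const_add c
    have h2 := (h1.rpow_const (p := κ + 1) (Or.inl (hpos s hs).ne')).div_const (d * (κ + 1))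
    convert! h2 using 1
    rw [add_sub_cancel_right]
    field_simp
  rw [intervalIntegral.integral_eq_sub_of_hasDerivAt hder]
  · rw [← sub_div]
    congr 3 <;> ring
  · refine ContinuousOn.intervalIntegrable fun s hs => ?_
    exact ((by fun_prop : ContinuousAt (fun s => c + d * s) s).rpow_const
      (Or.inl (hpos s hs).ne')).continuousWithinAt

lemma continuous_bracket : Continuous bracket := by
  unfold bracket; fun_prop

lemma continuous_bracket_rpow (γ : ℝ) : Continuous fun y : Space => bracket ‖y‖ ^ γ :=
  (continuous_bracket.comp continuous_norm).rpow_const fun _ => Or.inl (bracket_pos _).ne'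

/-- With e = x/r one has ⟨x + tz⟩² = 1 + r² + t² + 2tr⟨e,z⟩, an affine function of the height.
Archimedes' formula leaves an elementary integral, whose endpoint values are 1 + (t ± r)². The
exponent γ = -2 would give a logarithm. -/
lemma integral_bracket_rpow {t : ℝ} (ht : 0 < t) {x : Space} (hx : 0 < ‖x‖) {γ : ℝ}
    (hγ : γ + 2 ≠ 0) :
    ∫ z : Sph, bracket ‖x + t • (z : Space)‖ ^ γ ∂sphMeas =
      (bracket (t + ‖x‖) ^ (γ + 2) - bracket (t - ‖x‖) ^ (γ + 2)) /
        (2 * (γ + 2) * (‖x‖ * t)) := by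
  set r := ‖x‖ with hr
  have he : ‖r⁻¹ • x‖ = 1 := by rw [norm_smul, ← hr, norm_inv, Real.norm_of_nonneg hx.le]; field_simp
  have hsq : ∀ z : Sph, bracket ‖x + t • (z : Space)‖ ^ γ =
      ((1 + r ^ 2 + t ^ 2) + (2 * t * r) * inner ℝ (r⁻¹ • x) (z : Space)) ^ (γ / 2) := by
    intro z
    have h1 : ((1 + r ^ 2 + t ^ 2) + (2 * t * r) * inner ℝ (r⁻¹ • x) (z : Space)) =
        bracket ‖x + t • (z : Space)‖ ^ 2 := by
      rw [bracket_sq, norm_add_sq_real, norm_smul, norm_sph, inner_smul_left, inner_smul_right,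
        ← hr, Real.norm_of_nonneg ht.le]
      simp
      field_simp
      ring
    rw [h1, ← Real.rpow_natCast, ← Real.rpow_mul (bracket_nonneg _)]
    congr 1
    push_cast
    ring
  simp only [hsq]
  have hd : 0 < 2 * t * r := by positivity
  have hdc : 2 * t * r < 1 + r ^ 2 + t ^ 2 := by nlinarith [sq_nonneg (t - r)]
  rw [integral_zonal (φ := fun s => ((1 + r ^ 2 + t ^ 2) + (2 * t * r) * s) ^ (γ / 2)) he,
    integral_linear_rpow hd hdc (by intro h; apply hγ; linarith)]
  · have h1 : ∀ w : ℝ, (bracket w ^ 2) ^ (γ / 2 + 1) = bracket w ^ (γ + 2) := fun w => by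
      rw [← Real.rpow_natCast, ← Real.rpow_mul (bracket_nonneg _)]
      congr 1
      push_cast
      ring
    rw [← h1, ← h1, bracket_sq, bracket_sq]
    have e1 : 1 + r ^ 2 + t ^ 2 + 2 * t * r = 1 + (t + r) ^ 2 := by ring
    have e2 : 1 + r ^ 2 + t ^ 2 - 2 * t * r = 1 + (t - r) ^ 2 := by ring
    rw [e1, e2]
    have h3 : γ / 2 + 1 ≠ 0 := by intro h; apply hγ; linarith
    field_simp
  · intro s hs
    have : 0 < (1 + r ^ 2 + t ^ 2) + (2 * t * r) * s := by nlinarith [hs.1]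
    exact ((by fun_prop : ContinuousAt (fun s => (1 + r ^ 2 + t ^ 2) + (2 * t * r) * s)
      s).rpow_const (Or.inl this.ne')).continuousWithinAt

/-! ### Pointwise bounds for solutions in the interior and exterior regions -/

lemma norm_smean_le {k : Sph → ℝ} (hk : Continuous k) (hk1 : ∀ z, |k z| ≤ 1) {f : Space → ℂ}
    (hf : Continuous f) {M γ : ℝ} (hb : ∀ x, ‖f x‖ ≤ M * bracket ‖x‖ ^ γ) (p : Mink) :
    ‖smean k f p‖ ≤ M * ∫ z : Sph, bracket ‖p.2 + p.1 • (z : Space)‖ ^ γ ∂sphMeas := by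
  rw [smean, ← integral_const_mul]
  have hc := continuous_bracket_rpow γ
  refine (norm_integral_le_integral_norm _).trans (integral_mono
    (integrable_of_compact (by fun_prop)) (integrable_of_compact ?_) fun z => ?_)
  · exact continuous_const.mul (hc.comp (by fun_prop))
  · simp only [norm_smul]
    calc ‖k z‖ * ‖f (p.2 + p.1 • (z : Space))‖ ≤ 1 * ‖f (p.2 + p.1 • (z : Space))‖ := by
          gcongr; exact hk1 z
      _ ≤ _ := by rw [one_mul]; exact hb _

lemma abs_sph_coord_le (z : Sph) (i : Fin 3) : |(z : Space) i| ≤ 1 := by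
  have := PiLp.norm_apply_le (z : Space) i
  rwa [norm_sph] at this

lemma norm_add_smul_sph_le {t : ℝ} (ht : 0 ≤ t) (x : Space) (z : Sph) :
    ‖x + t • (z : Space)‖ ≤ t + ‖x‖ := by
  refine (norm_add_le _ _).trans ?_
  rw [norm_smul, norm_sph, Real.norm_of_nonneg ht]
  linarith

/-- Kirchhoff's formula has five terms: the mean of f, three means of z_i ∂_i f and the mean of g.
Here ⟨v⟩ dominates the explicit factor t. It also dominates ⟨y⟩ on the sphere, which lowers the
order of the first term from β to β - 1. -/
lemma Good.norm_le {β M : ℝ} {χ : Mink → ℂ} (h : Good 0 β M χ) {t : ℝ} (ht : 0 ≤ t) (x : Space) :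
    ‖χ (t, x)‖ ≤ 5 * M * bracket (t + ‖x‖) *
      ∫ z : Sph, bracket ‖x + t • (z : Space)‖ ^ (β - 1) ∂sphMeas := by
  obtain ⟨f, g, hf, hg, rfl⟩ := h
  have hM := hf.nonneg
  set I := ∫ z : Sph, bracket ‖x + t • (z : Space)‖ ^ (β - 1) ∂sphMeas with hI
  have hI0 : 0 ≤ I := integral_nonneg fun z => Real.rpow_nonneg (bracket_nonneg _) _
  have htv : t ≤ bracket (t + ‖x‖) := by
    refine le_trans ?_ (abs_le_bracket _)
    refine le_trans ?_ (le_abs_self _)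
    linarith [norm_nonneg x]
  have hfi : ∀ i : Fin 3, ‖smean (fun z => (z : Space) i * 1) (sd i f) (t, x)‖ ≤ M * I := fun i =>
    norm_smean_le (by fun_prop) (fun z => by simpa using abs_sph_coord_le z i)
      (hf.2.2 i).continuous (hf.2.2 i).bound (t, x)
  have hgI : ‖smean (fun _ => 1) g (t, x)‖ ≤ M * I :=
    norm_smean_le continuous_const (fun z => by simp) hg.continuous hg.bound (t, x)
  have hfI : ‖smean (fun _ => 1) f (t, x)‖ ≤ M * (bracket (t + ‖x‖) * I) := by
    refine (norm_smean_le continuous_const (fun z => by simp) hf.continuous hf.bound (t, x)).trans ?_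
    refine mul_le_mul_of_nonneg_left ?_ hM
    rw [hI, ← integral_const_mul]
    have hc := continuous_bracket_rpow
    refine integral_mono (integrable_of_compact ((hc β).comp (by fun_prop)))
      (integrable_of_compact (continuous_const.mul ((hc _).comp (by fun_prop)))) fun z => ?_
    simp only
    rw [Real.rpow_sub_one (bracket_pos _).ne']
    have h1 : bracket ‖x + t • (z : Space)‖ ≤ bracket (t + ‖x‖) := by
      refine bracket_mono ?_
      rw [abs_of_nonneg (norm_nonneg _), abs_of_nonneg (by positivity)]
      exact norm_add_smul_sph_le ht x z
    have h2 := Real.rpow_nonneg (bracket_nonneg ‖x + t • (z : Space)‖) β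
    rw [← mul_div_assoc, le_div_iff₀ (bracket_pos _), mul_comm]
    exact mul_le_mul_of_nonneg_right h1 h2
  rw [waveP, pd_zero_waveT hf.1, waveT]
  simp only
  calc _ ≤ ‖smean (fun _ => 1) f (t, x)‖ + t * (∑ i : Fin 3,
        ‖smean (fun z => (z : Space) i * 1) (sd i f) (t, x)‖) + t * ‖smean (fun _ => 1) g (t, x)‖ := by
        refine norm_add_le_of_le (norm_add_le_of_le le_rfl ?_) ?_
        · rw [norm_smul, Real.norm_of_nonneg ht]
          exact mul_le_mul_of_nonneg_left (norm_sum_le _ _) ht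
        · rw [norm_smul, Real.norm_of_nonneg ht]
    _ ≤ M * (bracket (t + ‖x‖) * I) + bracket (t + ‖x‖) * (∑ i : Fin 3, M * I) +
        bracket (t + ‖x‖) * (M * I) := by
        have := bracket_nonneg (t + ‖x‖)
        gcongr
        exact hfi _
    _ = _ := by
        simp only [Fin.sum_univ_three]
        ring

lemma integral_sph_le_of_le {F : Sph → ℝ} (hF : Continuous F) {C : ℝ} (h : ∀ z, F z ≤ C) :
    ∫ z, F z ∂sphMeas ≤ C := by
  have := integral_mono (μ := sphMeas) (integrable_of_compact hF) (integrable_const C) h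
  simpa using this

lemma continuous_bracket_sph (t : ℝ) (x : Space) (γ : ℝ) :
    Continuous fun z : Sph => bracket ‖x + t • (z : Space)‖ ^ γ :=
  (continuous_bracket_rpow γ).comp (by fun_prop)

lemma integral_bracket_nonneg (t : ℝ) (x : Space) (γ : ℝ) :
    0 ≤ ∫ z : Sph, bracket ‖x + t • (z : Space)‖ ^ γ ∂sphMeas :=
  integral_nonneg fun _ => Real.rpow_nonneg (bracket_nonneg _) _

/-- For 3r < t the sphere of radius t about x lies in 2t/3 ≤ |y| ≤ 4t/3, so ⟨y⟩ and ⟨t⟩ agree up to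
the factor 2. The constant is 5 from `Good.norm_le`, 2 from ⟨v⟩ ≤ 2⟨t⟩ and 2^|β-1| from the
integrand. -/
lemma Good.interior (β : ℝ) : ∃ C, 0 ≤ C ∧ ∀ {M : ℝ} {χ : Mink → ℂ}, Good 0 β M χ →
    ∀ (t : ℝ) (x : Space), 3 * ‖x‖ < t → ‖χ (t, x)‖ ≤ C * M * bracket t ^ β := by
  refine ⟨10 * 2 ^ |β - 1|, by positivity, fun {M χ} h t x hx => ?_⟩
  have ht : 0 < t := by linarith [norm_nonneg x]
  have hM := h.nonneg
  have h1 : bracket (t + ‖x‖) ≤ 2 * bracket t := by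
    refine le_trans (bracket_mono ?_) (bracket_mul_le (by norm_num : (1 : ℝ) ≤ 2))
    rw [abs_of_nonneg (by positivity), abs_of_nonneg (by positivity)]
    linarith
  have h2 : ∫ z : Sph, bracket ‖x + t • (z : Space)‖ ^ (β - 1) ∂sphMeas ≤
      2 ^ |β - 1| * bracket t ^ (β - 1) := by
    refine integral_sph_le_of_le (continuous_bracket_sph t x _) fun z => ?_
    have h4 := norm_add_smul_sph_le ht.le x z
    have h5 : t - ‖x‖ ≤ ‖x + t • (z : Space)‖ := by
      have := norm_sub_norm_le (t • (z : Space)) (-x)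
      rw [norm_smul, norm_sph, Real.norm_of_nonneg ht.le, norm_neg, sub_neg_eq_add, add_comm _ x]
        at this
      linarith
    refine rpow_le_of_comparable (bracket_pos _) (bracket_pos _) (by norm_num) ?_ ?_
    · refine le_trans (bracket_mono ?_) (bracket_mul_le (by norm_num : (1 : ℝ) ≤ 2))
      rw [abs_of_nonneg (by positivity), abs_of_nonneg (by positivity)]
      linarith
    · refine le_trans (bracket_mono ?_) (bracket_mul_le (by norm_num : (1 : ℝ) ≤ 2))
      rw [abs_of_nonneg (by positivity), abs_of_nonneg (by positivity)]
      linarith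
  have h3 : bracket t ^ β = bracket t * bracket t ^ (β - 1) := by
    rw [Real.rpow_sub_one (bracket_pos _).ne']
    field_simp [(bracket_pos t).ne']
  have h0 : (0 : ℝ) ≤ bracket t ^ (β - 1) := Real.rpow_nonneg (bracket_nonneg _) _
  calc ‖χ (t, x)‖ ≤ _ := h.norm_le ht.le x
    _ ≤ 5 * M * (2 * bracket t) * (2 ^ |β - 1| * bracket t ^ (β - 1)) := by
        have := bracket_nonneg t
        have := bracket_nonneg (t + ‖x‖)
        have := integral_bracket_nonneg t x (β - 1)
        gcongr
    _ = _ := by rw [h3]; ring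

/-- All brackets that occur lie between 1 and 5. This covers the neighbourhood of the origin where
the exterior formula, with its factor 1/(rt), is useless. -/
lemma Good.bounded (β : ℝ) : ∃ C, 0 ≤ C ∧ ∀ {M : ℝ} {χ : Mink → ℂ}, Good 0 β M χ →
    ∀ (t : ℝ) (x : Space), 0 ≤ t → t + ‖x‖ ≤ 4 → ‖χ (t, x)‖ ≤ C * M := by
  refine ⟨5 * 5 * 5 ^ |β - 1|, by positivity, fun {M χ} h t x ht hx => ?_⟩
  have hM := h.nonneg
  have hb : ∀ s, 0 ≤ s → s ≤ 4 → bracket s ≤ 5 := fun s h0 h4 => by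
    rw [bracket, Real.sqrt_le_left (by norm_num)]
    nlinarith
  have h2 : ∫ z : Sph, bracket ‖x + t • (z : Space)‖ ^ (β - 1) ∂sphMeas ≤ 5 ^ |β - 1| := by
    refine integral_sph_le_of_le (continuous_bracket_sph t x _) fun z => ?_
    have h5 := hb _ (norm_nonneg _) ((norm_add_smul_sph_le ht x z).trans hx)
    have := rpow_le_of_comparable (a := bracket ‖x + t • (z : Space)‖) (b := 1) (c := 5)
      (γ := β - 1) (bracket_pos _) one_pos (by norm_num) (by linarith)
      (by linarith [one_le_bracket ‖x + t • (z : Space)‖])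
    simpa using this
  calc ‖χ (t, x)‖ ≤ _ := h.norm_le ht x
    _ ≤ 5 * M * 5 * (5 ^ |β - 1|) := by
        have := hb _ (by positivity) hx
        have := bracket_nonneg (t + ‖x‖)
        have := integral_bracket_nonneg t x (β - 1)
        gcongr
    _ = _ := by ring

/-- In this region t and r are comparable, and r > 1 absorbs the 1 in the bracket. -/
lemma bracket_sq_le_mul {t r : ℝ} (hr : 1 < r) (h1 : r / 3 < t) (h2 : t < 3 * r) :
    bracket (t + r) ^ 2 ≤ 32 * (r * t) := by
  rw [bracket_sq]
  nlinarith

/-- The decay rate of a solution with data of order `β` in the exterior region. -/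
def extRate (β u v : ℝ) : ℝ :=
  if 1 + β < 0 then bracket u ^ (1 + β) / bracket v else bracket v ^ β

/-- Of the two powers in `integral_bracket_rpow` one has the favourable sign and is dropped:
⟨u⟩^(1+β) survives for 1 + β < 0 and ⟨v⟩^(1+β) for 1 + β > 0. The factor 1/(rt) is of size ⟨v⟩⁻²,
and one power of ⟨v⟩ is returned by `Good.norm_le`. -/
lemma Good.exterior {β : ℝ} (hβ : 1 + β ≠ 0) : ∃ C, 0 ≤ C ∧ ∀ {M : ℝ} {χ : Mink → ℂ},
    Good 0 β M χ → ∀ (t : ℝ) (x : Space), 1 < ‖x‖ → ‖x‖ / 3 < t → t < 3 * ‖x‖ →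
      ‖χ (t, x)‖ ≤ C * M * extRate β (t - ‖x‖) (t + ‖x‖) := by
  refine ⟨80 / |1 + β|, by positivity, fun {M χ} h t x hx h1 h2 => ?_⟩
  have ht : 0 < t := by linarith
  have hM := h.nonneg
  have hβ' : β - 1 + 2 ≠ 0 := by intro h; apply hβ; linarith
  have hv := bracket_pos (t + ‖x‖)
  have hu := bracket_pos (t - ‖x‖)
  have hrt : 0 < ‖x‖ * t := by positivity
  have hsq := bracket_sq_le_mul hx h1 h2
  have hγ : β - 1 + 2 = 1 + β := by ring
  have hU : 0 ≤ bracket (t - ‖x‖) ^ (1 + β) := Real.rpow_nonneg hu.le _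
  have hV : 0 ≤ bracket (t + ‖x‖) ^ (1 + β) := Real.rpow_nonneg hv.le _
  -- A stands for the surviving power. The constant 80 is 5 from `Good.norm_le` times 16 = 32/2 from
  -- `bracket_sq_le_mul`.
  have key : ∀ A : ℝ, 0 ≤ A → (∫ z : Sph, bracket ‖x + t • (z : Space)‖ ^ (β - 1) ∂sphMeas ≤
      A / (2 * |1 + β| * (‖x‖ * t))) →
      ‖χ (t, x)‖ ≤ 80 / |1 + β| * M * (A / bracket (t + ‖x‖)) := by
    intro A hA hint
    have hab : 0 < |1 + β| := abs_pos.2 hβ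
    have h3 : A / (2 * |1 + β| * (‖x‖ * t)) ≤ A * 16 / (|1 + β| * bracket (t + ‖x‖) ^ 2) := by
      rw [div_le_div_iff₀ (by positivity) (by positivity)]
      have : 0 ≤ A * |1 + β| := by positivity
      nlinarith [mul_le_mul_of_nonneg_left hsq this]
    calc ‖χ (t, x)‖ ≤ _ := h.norm_le ht.le x
      _ ≤ 5 * M * bracket (t + ‖x‖) * (A * 16 / (|1 + β| * bracket (t + ‖x‖) ^ 2)) := by
          gcongr
          exact hint.trans h3
      _ = _ := by field_simp; ring
  rw [integral_bracket_rpow ht (by linarith) hβ', hγ] at key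
  unfold extRate
  split_ifs with hneg
  · refine key _ hU ?_
    rw [abs_of_neg hneg, ← neg_div_neg_eq]
    have : -(2 * (1 + β) * (‖x‖ * t)) = 2 * -(1 + β) * (‖x‖ * t) := by ring
    rw [this]
    have : 0 < -(1 + β) := by linarith
    gcongr
    linarith
  · have hpos : 0 < 1 + β := lt_of_le_of_ne (not_lt.1 hneg) (Ne.symm hβ)
    have := key _ hV (by
      rw [abs_of_pos hpos]
      gcongr
      linarith)
    refine this.trans (le_of_eq ?_)
    rw [add_comm 1 β, Real.rpow_add_one hv.ne']
    field_simp

/-! ### Uniqueness for the Cauchy problem -/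

section

variable {E : Type} [NormedAddCommGroup E] [NormedSpace ℝ E]
variable {Z : Type} [TopologicalSpace Z] [CompactSpace Z] [MeasurableSpace Z]
  [OpensMeasurableSpace Z] [SecondCountableTopology Z]

/-- The weighted superposition `∫ k(z) η(p + τ(z)) dν(z)` of translates of `η`. -/
def superpos (ν : Measure Z) (k : Z → ℝ) (τ : Z → Mink) (η : Mink → E) : Mink → E :=
  fun p => ∫ z, k z • η (p + τ z) ∂ν

variable {ν : Measure Z} [IsFiniteMeasure ν] {k : Z → ℝ} {τ : Z → Mink}

lemma hasFDerivAt_superpos (hk : Continuous k) (hτ : Continuous τ) {η : Mink → E}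
    (hη : ContDiff ℝ 1 η) (p : Mink) :
    HasFDerivAt (superpos ν k τ η) (superpos ν k τ (fderiv ℝ η) p) p := by
  have h1 : Continuous (fderiv ℝ η) := hη.continuous_fderiv (by norm_num)
  have h2 := hη.continuous
  refine hasFDerivAt_integral_of_compact (F := fun p z => k z • η (p + τ z))
    (F' := fun p z => k z • fderiv ℝ η (p + τ z)) ?_ ?_ (fun q z => ?_) p
  · exact (hk.comp continuous_snd).smul (h2.comp (by fun_prop))
  · exact (hk.comp continuous_snd).smul (h1.comp (by fun_prop))
  · have := ((hη.differentiable (by norm_num)) (q + τ z)).hasFDerivAt.comp q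
      ((hasFDerivAt_id q).add_const (τ z))
    exact this.const_smul (k z)

/-- Differentiation passes to η, so the induction runs over all target spaces: the derivative is a
superposition of functions with values in the linear maps. -/
lemma contDiff_superpos (hk : Continuous k) (hτ : Continuous τ) (n : ℕ) {η : Mink → E}
    (hη : ContDiff ℝ n η) : ContDiff ℝ n (superpos ν k τ η) := by
  induction n generalizing E η with
  | zero =>
    refine contDiff_zero.2 (continuous_integral_of_compact ?_)
    have := hη.continuous
    exact (hk.comp continuous_snd).smul (this.comp (by fun_prop))
  | succ n ih =>
    have e : ((n + 1 : ℕ) : WithTop ℕ∞) = (n : WithTop ℕ∞) + 1 := by norm_cast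
    have h1 : ContDiff ℝ 1 η := hη.of_le (by norm_cast; omega)
    rw [e] at hη ⊢
    rw [contDiff_succ_iff_fderiv]
    refine ⟨fun p => (hasFDerivAt_superpos hk hτ h1 p).differentiableAt, by simp, ?_⟩
    rw [show fderiv ℝ (superpos ν k τ η) = superpos ν k τ (fderiv ℝ η) from
      funext fun p => (hasFDerivAt_superpos hk hτ h1 p).fderiv]
    exact ih (hη.fderiv_right le_rfl)

lemma pd_superpos (hk : Continuous k) (hτ : Continuous τ) {η : Mink → E}
    (hη : ContDiff ℝ 1 η) (μ : Fin 4) :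
    pd μ (superpos ν k τ η) = superpos ν k τ (pd μ η) := by
  ext p
  rw [pd, (hasFDerivAt_superpos hk hτ hη p).fderiv, superpos, ContinuousLinearMap.integral_apply]
  · rfl
  · refine integrable_of_compact ?_
    have h1 : Continuous (fderiv ℝ η) := hη.continuous_fderiv (by norm_num)
    exact hk.smul (h1.comp (by fun_prop))

lemma hasCompactSupport_superpos (hτ : Continuous τ) {η : Mink → E}
    (hη : HasCompactSupport η) : HasCompactSupport (superpos ν k τ η) := by
  have hK : IsCompact ((fun q : Mink × Z => q.1 - τ q.2) '' (tsupport η ×ˢ Set.univ)) :=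
    (hη.isCompact.prod isCompact_univ).image (by fun_prop)
  refine HasCompactSupport.intro hK fun p hp => ?_
  rw [superpos]
  refine integral_eq_zero_of_ae (Filter.Eventually.of_forall fun z => ?_)
  have : η (p + τ z) = 0 := by
    by_contra h
    exact hp ⟨(p + τ z, z), ⟨subset_tsupport _ h, trivial⟩, by simp⟩
  simp [this]

end

/-- The parameter space of the truncated light cones. -/
abbrev ConeParam (R : ℝ) : Type := Set.Icc (0 : ℝ) R × Sph

/-- The measure `ds dσ` on the parameters of the cone. -/
def coneMeas (R : ℝ) : Measure (ConeParam R) := ((volume : Measure ℝ).comap ((↑) : Set.Icc (0 : ℝ) R → ℝ)).prod sphMeas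

instance (R : ℝ) : IsFiniteMeasure ((volume : Measure ℝ).comap ((↑) : Set.Icc (0 : ℝ) R → ℝ)) :=
  ⟨by rw [(MeasurableEmbedding.subtype_coe measurableSet_Icc).comap_apply,
      Set.image_univ, Subtype.range_coe]
      exact isCompact_Icc.measure_lt_top⟩

instance (R : ℝ) : IsFiniteMeasure (coneMeas R) := by
  unfold coneMeas; infer_instance

/-- The null vector `s (1, z)`. -/
def coneVec {R : ℝ} (q : ConeParam R) : Mink := ((q.1 : ℝ), (q.1 : ℝ) • (q.2 : Space))

lemma continuous_coneVec {R : ℝ} : Continuous (coneVec (R := R)) := by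
  unfold coneVec; fun_prop

/-- The advanced potential of `η`. -/
def advPot {E : Type} [NormedAddCommGroup E] [NormedSpace ℝ E] (R : ℝ) (η : Mink → E) : Mink → E :=
  superpos (coneMeas R) (fun q => (q.1 : ℝ)) coneVec η

/-! ### Means and fluxes along light cones -/

lemma integral_coneParam {E : Type} [NormedAddCommGroup E] [NormedSpace ℝ E] {R : ℝ} (hR : 0 ≤ R)
    {F : ℝ → Sph → E} (hF : Continuous fun q : ℝ × Sph => F q.1 q.2) :
    ∫ q : ConeParam R, F q.1 q.2 ∂(coneMeas R) =
      ∫ s in (0 : ℝ)..R, ∫ z, F s z ∂sphMeas := by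
  rw [coneMeas, integral_prod]
  · rw [intervalIntegral.integral_of_le hR, ← integral_Icc_eq_integral_Ioc]
    exact integral_subtype_comap measurableSet_Icc (fun s : ℝ => ∫ z, F s z ∂sphMeas)
  · refine integrable_of_compact ?_
    exact hF.comp (by fun_prop : Continuous fun q : ConeParam R => ((q.1 : ℝ), q.2))

/-- Means along the light cone of `p`. -/
def cmean (p : Mink) (k : Sph → ℝ) (F : Mink → ℝ) (s : ℝ) : ℝ :=
  ∫ z : Sph, k z * F (p.1 + s, p.2 + s • (z : Space)) ∂sphMeas

lemma continuous_pd {E : Type} [NormedAddCommGroup E] [NormedSpace ℝ E] {F : Mink → E}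
    (hF : ContDiff ℝ 1 F) (μ : Fin 4) : Continuous (pd μ F) :=
  (hF.continuous_fderiv (by norm_num)).clm_apply continuous_const

lemma contDiff_pd {E : Type} [NormedAddCommGroup E] [NormedSpace ℝ E] {n : WithTop ℕ∞}
    {F : Mink → E} (hF : ContDiff ℝ (n + 1) F) (μ : Fin 4) : ContDiff ℝ n (pd μ F) :=
  (hF.fderiv_right le_rfl).clm_apply contDiff_const

lemma hasDerivAt_cmean (p : Mink) {k : Sph → ℝ} (hk : Continuous k) {F : Mink → ℝ}
    (hF : ContDiff ℝ 1 F) (s : ℝ) :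
    HasDerivAt (cmean p k F) (cmean p k (pd 0 F) s +
      ∑ i : Fin 3, cmean p (fun z => (z : Space) i * k z) (pd i.succ F) s) s := by
  have hc := hF.continuous
  have hp := continuous_pd hF
  have hline : ∀ (z : Sph) (s : ℝ), HasDerivAt (fun s : ℝ => ((p.1 + s, p.2 + s • (z : Space)) : Mink))
      (1, (z : Space)) s := fun z s => by
    have h1 : HasDerivAt (fun s : ℝ => p.1 + s) 1 s := (hasDerivAt_id s).const_add _
    have h2 : HasDerivAt (fun s : ℝ => p.2 + s • (z : Space)) (z : Space) s := by
      simpa using ((hasDerivAt_id s).smul_const (z : Space)).const_add p.2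
    exact h1.prodMk h2
  have hd := hasFDerivAt_integral_of_compact (ν := sphMeas) (X := ℝ) (Z := Sph)
    (F := fun s z => k z * F (p.1 + s, p.2 + s • (z : Space)))
    (F' := fun s z => ContinuousLinearMap.toSpanSingleton ℝ
      (k z * (pd 0 F (p.1 + s, p.2 + s • (z : Space)) +
        ∑ i : Fin 3, (z : Space) i * pd i.succ F (p.1 + s, p.2 + s • (z : Space)))))
    (by
      have := hk
      exact (hk.comp continuous_snd).mul (hc.comp (by fun_prop))) (by
      refine (ContinuousLinearMap.toSpanSingletonCLE (𝕜 := ℝ) (E := ℝ)).continuous.comp ?_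
      refine (hk.comp continuous_snd).mul (((hp 0).comp (by fun_prop)).add
        (continuous_finsetSum _ fun i _ => Continuous.mul (by fun_prop)
          ((hp i.succ).comp (by fun_prop))))) (fun s z => by
      have h1 := ((hF.differentiable (by norm_num)) _).hasFDerivAt.comp_hasDerivAt s (hline z s)
      rw [fderiv_eq_sum_pd] at h1
      simp only [smul_eq_mul, one_mul] at h1
      exact (h1.const_mul (k z)).hasFDerivAt) s
  have hd' := hd.hasDerivAt
  rw [ContinuousLinearMap.integral_apply] at hd'
  · convert! hd' using 1
    simp only [cmean, ContinuousLinearMap.toSpanSingleton_apply, one_smul]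
    have hi : ∀ (k : Sph → ℝ) (μ : Fin 4), Continuous k → Integrable
        (fun z : Sph => k z * pd μ F (p.1 + s, p.2 + s • (z : Space))) sphMeas := fun k μ hk =>
      integrable_of_compact (hk.mul ((hp μ).comp (by fun_prop)))
    rw [← integral_finsetSum _ fun i _ => hi _ _ (by fun_prop), ← integral_add (hi _ _ hk)
      (integrable_finsetSum _ fun i _ => hi _ _ (by fun_prop))]
    congr 1
    ext z
    rw [mul_add, Finset.mul_sum]
    congr 1
    exact Finset.sum_congr rfl fun i _ => by ring
  · refine integrable_of_compact ?_
    refine (ContinuousLinearMap.toSpanSingletonCLE (𝕜 := ℝ) (E := ℝ)).continuous.comp ?_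
    refine hk.mul (((hp 0).comp (by fun_prop)).add
        (continuous_finsetSum _ fun i _ => Continuous.mul (by fun_prop)
          ((hp i.succ).comp (by fun_prop))))

lemma cmean_tangential (p : Mink) {F : Mink → ℝ} (hF : ContDiff ℝ 1 F) (j : Fin 3) (s : ℝ) :
    s * (cmean p (fun _ => 1) (pd j.succ F) s -
      ∑ i : Fin 3, cmean p (fun z => (z : Space) j * (z : Space) i) (pd i.succ F) s) =
      2 * cmean p (fun z => (z : Space) j) F s := by
  have hh : ContDiff ℝ 1 (fun y : Space => F (p.1 + s, y)) := hF.comp (by fun_prop)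
  have hs : ∀ i, sd i (fun y : Space => F (p.1 + s, y)) = fun y => pd i.succ F (p.1 + s, y) := by
    intro i
    ext y
    have h1 : HasFDerivAt (fun y : Space => ((p.1 + s, y) : Mink))
        (ContinuousLinearMap.inr ℝ ℝ Space) y := hasFDerivAt_prodMk_right _ _
    have h2 := ((hF.differentiable (by norm_num)) _).hasFDerivAt.comp y h1
    change fderiv ℝ (F ∘ fun y => (p.1 + s, y)) y (bas i) = _
    rw [h2.fderiv]
    simp [pd]
  have := smean_tangential hh j (s, p.2)
  simp only [hs, smean, mul_one, smul_eq_mul] at this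
  simpa only [cmean] using this

/-- Along the future light cone s□η is an exact derivative after averaging over directions. The
mixed derivatives ∂_t∂_i cancel, and `cmean_tangential` for each ∂_j η turns the remaining first and
second moments into the Laplacian. -/
lemma hasDerivAt_cone_flux (p : Mink) {η : Mink → ℝ} (hη : ContDiff ℝ 2 η) (s : ℝ) :
    HasDerivAt (fun s => s * cmean p (fun _ => 1) (pd 0 η) s - cmean p (fun _ => 1) η s -
      s * ∑ i : Fin 3, cmean p (fun z => (z : Space) i) (pd i.succ η) s)
      (s * cmean p (fun _ => 1) (box η) s) s := by
  have h1 : ContDiff ℝ 1 η := hη.of_le (by norm_num)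
  have hp : ∀ μ, ContDiff ℝ 1 (pd μ η) := fun μ => contDiff_pd (n := 1) hη μ
  have hpp : ∀ μ μ', Continuous (pd μ (pd μ' η)) := fun μ μ' => continuous_pd (hp μ') μ
  have hcomm : ∀ i : Fin 3, pd i.succ (pd 0 η) = pd 0 (pd i.succ η) := by
    intro i
    have hd : Differentiable ℝ (fderiv ℝ η) :=
      (hη.fderiv_right (m := 1) (by norm_num)).differentiable (by norm_num)
    have h : ∀ (i j : Fin 4) (y : Mink), pd i (pd j η) y =
        fderiv ℝ (fderiv ℝ η) y (coordVec i) (coordVec j) := fun i j y => by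
      change fderiv ℝ (fun y => fderiv ℝ η y (coordVec j)) y (coordVec i) = _
      rw [fderiv_clm_apply (hd y) (differentiableAt_const _)]
      simp
    ext y
    rw [h, h]
    exact ((hη.contDiffAt (x := y)).isSymmSndFDerivAt (by simp)) _ _
  have d1 := (hasDerivAt_id s).mul (hasDerivAt_cmean p (k := fun _ => 1) continuous_const (hp 0) s)
  have d2 := hasDerivAt_cmean p (k := fun _ => 1) continuous_const h1 s
  have d3 := (hasDerivAt_id s).mul (HasDerivAt.fun_sum (u := Finset.univ) fun i (_ : i ∈ Finset.univ) =>
    hasDerivAt_cmean p (k := fun z => (z : Space) i) (by fun_prop) (hp i.succ) s)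
  have d := (d1.sub d2).sub d3
  convert! d using 1
  have ht := fun j => cmean_tangential p (hp (Fin.succ j)) j s
  have hbox : cmean p (fun _ => 1) (box η) s = cmean p (fun _ => 1) (pd 0 (pd 0 η)) s -
      ∑ i : Fin 3, cmean p (fun _ => 1) (pd i.succ (pd i.succ η)) s := by
    simp only [cmean, box]
    have hi : ∀ μ μ', Integrable
        (fun z : Sph => 1 * pd μ (pd μ' η) (p.1 + s, p.2 + s • (z : Space))) sphMeas :=
      fun μ μ' => integrable_of_compact (continuous_const.mul ((hpp μ μ').comp (by fun_prop)))
    rw [← integral_finsetSum _ fun i _ => hi _ _, ← integral_sub (hi _ _)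
      (integrable_finsetSum _ fun i _ => hi _ _)]
    simp only [one_mul]
  rw [hbox]
  simp only [id_eq, one_mul, mul_one, Finset.sum_add_distrib, hcomm, Fin.sum_univ_three] at ht ⊢
  have e := fun (i j : Fin 3) => (by
    simp only [cmean, mul_comm] : cmean p (fun z => (z : Space) i * (z : Space) j)
      (pd i.succ (pd j.succ η)) s = cmean p (fun z => (z : Space) j * (z : Space) i)
      (pd i.succ (pd j.succ η)) s)
  have t0 := ht 0
  have t1 := ht 1
  have t2 := ht 2
  rw [e 0 1, e 0 2, e 1 0, e 1 2, e 2 0, e 2 1]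
  linear_combination (exp := 1) -t0 - t1 - t2

lemma pd_eq_zero_of_notMem {E : Type} [NormedAddCommGroup E] [NormedSpace ℝ E] {η : Mink → E}
    {p : Mink} (hp : p ∉ tsupport η) (μ : Fin 4) : pd μ η p = 0 := by
  rw [pd, image_eq_zero_of_notMem_tsupport fun h => hp (tsupport_fderiv_subset ℝ h)]
  rfl

/-- The wave operator commutes with translations, so it acts on η under the integral and the flux
identity can be integrated over 0 ≤ s ≤ R. At s = R the cone has left the support of η because p.1 +
R ≥ R. At s = 0 the flux is -η(p). -/
lemma box_advPot {η : Mink → ℝ} (hη : ContDiff ℝ ∞ η) {R : ℝ} (hR : 0 ≤ R)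
    (hs : ∀ p ∈ tsupport η, p.1 < R) (p : Mink) (hp : 0 ≤ p.1) :
    box (advPot R η) p = η p := by
  have hc : ∀ μ, ContDiff ℝ ∞ (pd μ η) := fun μ => contDiff_pd (n := ∞) (by simpa using hη) μ
  have hk : Continuous fun q : ConeParam R => (q.1 : ℝ) := by fun_prop
  have hτ := continuous_coneVec (R := R)
  have h1 : ContDiff ℝ 1 η := hη.of_le (by simp)
  have hc1 : ∀ μ, ContDiff ℝ 1 (pd μ η) := fun μ => (hc μ).of_le (by simp)
  have hpp : ∀ μ μ', Continuous (pd μ (pd μ' η)) := fun μ μ' => continuous_pd (hc1 μ') μ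
  have hbc : Continuous (box η) := by
    unfold box
    exact (hpp 0 0).sub (continuous_finsetSum _ fun i _ => hpp _ _)
  have e1 : box (advPot R η) p = advPot R (box η) p := by
    simp only [box, advPot, pd_superpos hk hτ h1, pd_superpos hk hτ (hc1 _)]
    simp only [superpos]
    have hi : ∀ μ μ', Integrable (fun q : ConeParam R => (q.1 : ℝ) • pd μ (pd μ' η)
        (p + coneVec q)) (coneMeas R) := fun μ μ' =>
      integrable_of_compact (hk.smul ((hpp μ μ').comp (by fun_prop)))
    rw [← integral_finsetSum _ fun i _ => hi _ _, ← integral_sub (hi _ _)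
      (integrable_finsetSum _ fun i _ => hi _ _)]
    simp only [← Finset.smul_sum, ← smul_sub]
    rfl
  have e2 : advPot R (box η) p = ∫ s in (0 : ℝ)..R, s * cmean p (fun _ => 1) (box η) s := by
    have := integral_coneParam hR (F := fun s z => s • box η (p.1 + s, p.2 + s • (z : Space)))
      (by exact continuous_fst.smul (hbc.comp (by fun_prop)))
    rw [advPot, superpos]
    refine Eq.trans this ?_
    congr 1
    ext s
    simp only [smul_eq_mul, cmean, one_mul]
    rw [integral_const_mul]
  have hcm : ∀ (k : Sph → ℝ) (F : Mink → ℝ), (∀ p ∉ tsupport η, F p = 0) →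
      cmean p k F R = 0 := fun k F hF => by
    rw [cmean]
    refine integral_eq_zero_of_ae (Filter.Eventually.of_forall fun z => ?_)
    have : F (p.1 + R, p.2 + R • (z : Space)) = 0 := hF _ fun h => by
      have := hs _ h
      simp only at this
      linarith
    simp [this]
  have hcont : Continuous fun s => s * cmean p (fun _ => 1) (box η) s := by
    refine continuous_id.mul ?_
    refine continuous_integral_of_compact (F := fun s (z : Sph) =>
      1 * box η (p.1 + s, p.2 + s • (z : Space))) ?_
    exact continuous_const.mul (hbc.comp (by fun_prop))
  rw [e1, e2, intervalIntegral.integral_eq_sub_of_hasDerivAt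
    (fun s _ => hasDerivAt_cone_flux p (hη.of_le (WithTop.coe_le_coe.2 le_top)) s)
    (hcont.intervalIntegrable _ _)]
  rw [hcm _ _ (fun q hq => pd_eq_zero_of_notMem hq _),
    hcm _ _ (fun q hq => image_eq_zero_of_notMem_tsupport hq)]
  have : ∀ i : Fin 3, cmean p (fun z => (z : Space) i) (pd i.succ η) R = 0 := fun i =>
    hcm _ _ (fun q hq => pd_eq_zero_of_notMem hq _)
  simp only [this]
  simp [cmean]

/-- Duality between the advanced potential and spherical means. -/
lemma integral_advPot_smul {η : Mink → ℝ} (hη : Continuous η) (hc : HasCompactSupport η) {R : ℝ}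
    (hR : 0 ≤ R) (hs : ∀ p ∈ tsupport η, p.1 < R) {g : Space → ℂ} (hg : Continuous g) :
    ∫ x : Space, advPot R η (0, x) • g x = ∫ p in {p : Mink | 0 ≤ p.1}, η p • waveT g p := by
  have hKx : IsCompact ((fun q : Mink × ConeParam R => q.1.2 - (coneVec q.2).2) ''
      (tsupport η ×ˢ Set.univ)) :=
    (hc.isCompact.prod isCompact_univ).image (by
      have := continuous_coneVec (R := R)
      fun_prop)
  have hKx' : IsCompact (Prod.snd '' tsupport η) := hc.isCompact.image continuous_snd
  have s1 : ∀ x : Space, advPot R η (0, x) • g x =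
      ∫ q : ConeParam R, ((q.1 : ℝ) * η (q.1, x + (q.1 : ℝ) • (q.2 : Space))) • g x
        ∂(coneMeas R) := fun x => by
    rw [advPot, superpos, ← integral_smul_const]
    simp [coneVec]
  simp only [s1]
  rw [integral_integral_swap_of_hasCompactSupport (f := fun x (q : ConeParam R) =>
    ((q.1 : ℝ) * η (q.1, x + (q.1 : ℝ) • (q.2 : Space))) • g x)]
  rotate_left
  · refine Continuous.smul (Continuous.mul (by fun_prop) (hη.comp (by fun_prop)))
      (hg.comp (by fun_prop))
  · refine HasCompactSupport.intro (hKx.prod (isCompact_univ (X := ConeParam R))) fun q hq => ?_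
    have : η (q.2.1, q.1 + (q.2.1 : ℝ) • (q.2.2 : Space)) = 0 := by
      by_contra h
      refine hq ⟨⟨((q.2.1, q.1 + (q.2.1 : ℝ) • (q.2.2 : Space)), q.2),
        ⟨subset_tsupport _ h, trivial⟩, by simp [coneVec]⟩, trivial⟩
    simp [Function.uncurry, this]
  -- For a fixed cone parameter, translation by s z moves the shift from η to g.
  have s2 : ∀ q : ConeParam R,
      ∫ x : Space, ((q.1 : ℝ) * η (q.1, x + (q.1 : ℝ) • (q.2 : Space))) • g x =
      ∫ x : Space, ((q.1 : ℝ) * η (q.1, x)) • g (x - (q.1 : ℝ) • (q.2 : Space)) := fun q => by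
    rw [← integral_add_right_eq_self (fun x : Space => ((q.1 : ℝ) * η (q.1, x)) •
      g (x - (q.1 : ℝ) • (q.2 : Space))) ((q.1 : ℝ) • (q.2 : Space))]
    simp
  simp only [s2]
  rw [← integral_integral_swap_of_hasCompactSupport (f := fun x (q : ConeParam R) =>
    ((q.1 : ℝ) * η (q.1, x)) • g (x - (q.1 : ℝ) • (q.2 : Space)))]
  rotate_left
  · refine Continuous.smul (Continuous.mul (by fun_prop) (hη.comp (by fun_prop)))
      (hg.comp (by fun_prop))
  · refine HasCompactSupport.intro (hKx'.prod (isCompact_univ (X := ConeParam R))) fun q hq => ?_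
    have : η (q.2.1, q.1) = 0 := by
      by_contra h
      exact hq ⟨⟨(q.2.1, q.1), subset_tsupport _ h, rfl⟩, trivial⟩
    simp [Function.uncurry, this]
  have s3 : ∀ x : Space, ∫ q : ConeParam R, ((q.1 : ℝ) * η (q.1, x)) •
      g (x - (q.1 : ℝ) • (q.2 : Space)) ∂(coneMeas R) =
      ∫ t in Set.Ici (0 : ℝ), η (t, x) • waveT g (t, x) := fun x => by
    have := integral_coneParam hR (F := fun s (z : Sph) => (s * η (s, x)) •
      g (x - s • (z : Space))) (by
        exact Continuous.smul (Continuous.mul (by fun_prop) (hη.comp (by fun_prop)))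
          (hg.comp (by fun_prop)))
    refine this.trans ?_
    rw [intervalIntegral.integral_of_le hR, ← integral_Icc_eq_integral_Ioc]
    -- Since η vanishes for t ≥ R, the integral over [0, R] is the one over all t ≥ 0.
    rw [setIntegral_eq_of_subset_of_forall_sdiff_eq_zero measurableSet_Ici Set.Icc_subset_Ici_self]
    · refine setIntegral_congr_fun measurableSet_Icc fun s hs => ?_
      rw [integral_smul, waveT, smean, smul_smul, mul_comm]
      congr 1
      -- The advanced cone produces g(x - s z). Invariance under the antipodal map gives the mean of
      -- g(x + s z).
      have h := integral_sphRot (LinearIsometryEquiv.neg ℝ)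
        (H := fun y : Space => g (x + s • y)) (by fun_prop)
      simp only [one_smul]
      rw [← h]
      simp [sub_eq_add_neg]
    · intro t ht
      have : η (t, x) = 0 := by
        by_contra h
        have h1 := hs _ (subset_tsupport _ h)
        simp only at h1
        exact ht.2 ⟨ht.1, h1.le⟩
      simp [this]
  simp only [s3]
  have hset : {p : Mink | 0 ≤ p.1} = Set.Ici (0 : ℝ) ×ˢ Set.univ := by
    ext p; simp
  rw [hset, Measure.volume_eq_prod, ← Measure.prod_restrict, Measure.restrict_univ,
    integral_prod_symm]
  have hcont : Continuous fun p => η p • waveT g p := hη.smul (continuous_waveT hg)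
  have hcs : HasCompactSupport fun p => η p • waveT g p := hc.smul_right
  have hint := (hcont.integrable_of_hasCompactSupport (μ := volume) hcs).integrableOn
    (s := Set.Ici (0 : ℝ) ×ˢ Set.univ)
  rw [IntegrableOn, Measure.volume_eq_prod, ← Measure.prod_restrict, Measure.restrict_univ] at hint
  exact hint

lemma integral_pd_zero_halfspace {F : Mink → ℂ} (hF : ContDiff ℝ 1 F) (hc : HasCompactSupport F)
    (h0 : ∀ x, F (0, x) = 0) : ∫ p in {p : Mink | 0 ≤ p.1}, pd 0 F p = 0 := by
  have hset : {p : Mink | 0 ≤ p.1} = Set.Ici (0 : ℝ) ×ˢ Set.univ := by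
    ext p; simp
  have hcs : HasCompactSupport (pd 0 F) :=
    HasCompactSupport.intro hc.isCompact fun p hp => pd_eq_zero_of_notMem hp _
  rw [hset, Measure.volume_eq_prod, ← Measure.prod_restrict, Measure.restrict_univ,
    integral_prod_symm]
  · refine integral_eq_zero_of_ae (Filter.Eventually.of_forall fun x => ?_)
    have hx : ∀ t, HasDerivAt (fun t => F (t, x)) (pd 0 F (t, x)) t := fun t => by
      have h1 : HasDerivAt (fun t : ℝ => ((t, x) : Mink)) (1, 0) t :=
        (hasDerivAt_id t).prodMk (hasDerivAt_const t x)
      exact ((hF.differentiable (by norm_num)) _).hasFDerivAt.comp_hasDerivAt t h1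
    have hcx : HasCompactSupport (fun t => F (t, x)) := by
      refine HasCompactSupport.intro (hc.isCompact.image continuous_fst) fun t ht => ?_
      by_contra h
      exact ht ⟨(t, x), subset_tsupport _ h, rfl⟩
    have := hcx.integral_Ioi_deriv_eq (hF.comp (by fun_prop : ContDiff ℝ 1 fun t : ℝ => (t, x))) 0
    rw [show deriv (F ∘ fun t => (t, x)) = fun t => pd 0 F (t, x) from
      funext fun t => (hx t).deriv, Function.comp_apply, h0, neg_zero] at this
    simpa [integral_Ici_eq_integral_Ioi] using this
  · have hint := ((continuous_pd hF 0).integrable_of_hasCompactSupport (μ := volume) hcs).integrableOn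
      (s := Set.Ici (0 : ℝ) ×ˢ Set.univ)
    rw [IntegrableOn, Measure.volume_eq_prod, ← Measure.prod_restrict, Measure.restrict_univ] at hint
    exact hint

/-- Testing the weak equation with the advanced potential of η gives ∫ηχ = ∫(η T g - ∂_tη T f) over
t ≥ 0, by the duality `integral_advPot_smul`. Integration by parts in t turns the right side into
∫η(T g + ∂_t T f). Hence both functions agree almost everywhere, and by continuity everywhere, for t
> 0. No uniqueness theorem beyond this duality is needed. -/
lemma IsCauchySolution.eq_waveP {χ : Mink → ℂ} {f g f' g' : Space → ℂ}
    (h : IsCauchySolution χ f g) (hf : f =ᵐ[volume] f') (hg : g =ᵐ[volume] g')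
    (cf : ContDiff ℝ 1 f') (cg : Continuous g') : ∀ p : Mink, 0 < p.1 → χ p = waveP f' g' p := by
  have hU : IsOpen {p : Mink | 0 < p.1} := isOpen_lt continuous_const continuous_fst
  have cχ : ContinuousOn χ {p : Mink | 0 < p.1} := h.continuousOn.mono fun p (hp : 0 < p.1) => hp.le
  have cP := continuous_waveP cf cg
  have hmeas : MeasurableSet {p : Mink | 0 ≤ p.1} :=
    (isClosed_le continuous_const continuous_fst).measurableSet
  have key : ∀ η : Mink → ℝ, ContDiff ℝ ∞ η → HasCompactSupport η →
      ∫ p in {p : Mink | 0 ≤ p.1}, η p • χ p = ∫ p in {p : Mink | 0 ≤ p.1}, η p • waveP f' g' p := by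
    intro η hη hc
    obtain ⟨R, hR0, hR⟩ : ∃ R : ℝ, 0 ≤ R ∧ ∀ p ∈ tsupport η, p.1 < R := by
      obtain ⟨C, hC⟩ := (hc.isCompact.image continuous_fst).isBounded.exists_norm_le
      refine ⟨max 0 (C + 1), le_max_left _ _, fun p hp => ?_⟩
      have := hC _ ⟨p, hp, rfl⟩
      exact lt_of_le_of_lt ((le_abs_self _).trans this) (lt_max_of_lt_right (by linarith))
    have h1 : ContDiff ℝ 1 η := hη.of_le (by simp)
    have hk : Continuous fun q : ConeParam R => (q.1 : ℝ) := by fun_prop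
    have hsm : ContDiff ℝ ∞ (advPot R η) := by
      rw [contDiff_infty]
      exact fun n => contDiff_superpos hk continuous_coneVec n (hη.of_le (by exact_mod_cast le_top))
    have hw := h.weak (advPot R η) hsm (hasCompactSupport_superpos continuous_coneVec hc)
    have e1 : ∫ p in {p : Mink | 0 ≤ p.1}, box (advPot R η) p • χ p =
        ∫ p in {p : Mink | 0 ≤ p.1}, η p • χ p :=
      setIntegral_congr_fun hmeas fun p hp => by
        rw [box_advPot hη hR0 hR p hp]
    have hpd : pd 0 (advPot R η) = advPot R (pd 0 η) := pd_superpos hk continuous_coneVec h1 0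
    have hpc : HasCompactSupport (pd 0 η) :=
      HasCompactSupport.intro hc.isCompact fun p hp => pd_eq_zero_of_notMem hp _
    have hpR : ∀ p ∈ tsupport (pd 0 η), p.1 < R := fun p hp => by
      refine hR p (closure_minimal ?_ (isClosed_tsupport η) hp)
      intro q hq
      by_contra hq'
      exact hq (pd_eq_zero_of_notMem hq' 0)
    have e2 : ∫ x : Space, (advPot R η (0, x) • g x - pd 0 (advPot R η) (0, x) • f x) =
        ∫ x : Space, (advPot R η (0, x) • g' x - advPot R (pd 0 η) (0, x) • f' x) := by
      refine integral_congr_ae ?_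
      filter_upwards [hf, hg] with x hx hx'
      rw [hx, hx', hpd]
    have cA : ∀ η : Mink → ℝ, Continuous η → Continuous (advPot R η) := fun η hη =>
      (contDiff_superpos hk continuous_coneVec 0 (contDiff_zero.2 hη)).continuous
    have hAc : ∀ η : Mink → ℝ, HasCompactSupport η →
        HasCompactSupport fun x : Space => advPot R η (0, x) := fun η hη => by
      have := hasCompactSupport_superpos (ν := coneMeas R)
        (k := fun q : ConeParam R => (q.1 : ℝ)) continuous_coneVec hη
      refine HasCompactSupport.intro (this.isCompact.image continuous_snd) fun x hx => ?_
      by_contra hne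
      exact hx ⟨(0, x), subset_tsupport _ hne, rfl⟩
    have hin : ∀ (η : Mink → ℝ) (g : Space → ℂ), Continuous η → HasCompactSupport η → Continuous g →
        Integrable fun x : Space => advPot R η (0, x) • g x := fun η g hη hc hg =>
      (((cA η hη).comp (by fun_prop)).smul hg).integrable_of_hasCompactSupport
        ((hAc η hc).smul_right)
    have hin' : ∀ (η : Mink → ℝ) (F : Mink → ℂ), Continuous η → HasCompactSupport η → Continuous F →
        IntegrableOn (fun p => η p • F p) {p : Mink | 0 ≤ p.1} := fun η F hη hc hF =>
      ((hη.smul hF).integrable_of_hasCompactSupport hc.smul_right).integrableOn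
    rw [← e1, hw, e2, integral_sub (hin _ _ hη.continuous hc cg)
      (hin _ _ (continuous_pd h1 0) hpc cf.continuous),
      integral_advPot_smul hη.continuous hc hR0 hR cg,
      integral_advPot_smul (continuous_pd h1 0) hpc hR0 hpR cf.continuous]
    -- The integration by parts in t has no boundary term, because T f vanishes at t = 0.
    have e3 := integral_pd_zero_halfspace (F := fun p => η p • waveT f' p)
      (h1.smul (contDiff_one_waveT cf)) hc.smul_right (fun x => by simp [waveT])
    have e4 : pd 0 (fun p => η p • waveT f' p) =
        fun p => η p • pd 0 (waveT f') p + pd 0 η p • waveT f' p := by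
      ext p
      have d1 := ((h1.differentiable (by norm_num)) p).hasFDerivAt
      have d2 := ((contDiff_one_waveT cf).differentiable (by norm_num) p).hasFDerivAt
      rw [pd, (d1.fun_smul d2).fderiv]
      simp [pd]
    rw [e4, integral_add (hin' _ _ hη.continuous hc (continuous_pd_zero_waveT cf))
      (hin' _ _ (continuous_pd h1 0) hpc (continuous_waveT cf.continuous))] at e3
    have e5 : ∫ p in {p : Mink | 0 ≤ p.1}, η p • waveP f' g' p =
        (∫ p in {p : Mink | 0 ≤ p.1}, η p • pd 0 (waveT f') p) +
        ∫ p in {p : Mink | 0 ≤ p.1}, η p • waveT g' p := by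
      rw [← integral_add (hin' _ _ hη.continuous hc (continuous_pd_zero_waveT cf))
        (hin' _ _ hη.continuous hc (continuous_waveT cg))]
      simp only [waveP, smul_add]
    rw [e5]
    linear_combination -e3
  -- Only test functions supported in t > 0 are used from here on, so the values of χ for t ≤ 0 play
  -- no role.
  have hae : ∀ᵐ p : Mink, p ∈ {p : Mink | 0 < p.1} → (χ p - waveP f' g' p) = 0 := by
    refine hU.ae_eq_zero_of_integral_contDiff_smul_eq_zero
      ((cχ.sub cP.continuousOn).locallyIntegrableOn hU.measurableSet) fun η hη hc hsup => ?_
    have hz : ∀ p ∉ {p : Mink | 0 ≤ p.1}, η p • (χ p - waveP f' g' p) = 0 := fun p hp => by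
      have : η p = 0 := image_eq_zero_of_notMem_tsupport fun h => hp (show 0 ≤ p.1 from le_of_lt (hsup h))
      simp [this]
    have hcontχ : Continuous fun p => η p • χ p := by
      rw [continuous_iff_continuousAt]
      intro p
      by_cases hp : p ∈ tsupport η
      · exact hη.continuous.continuousAt.smul (cχ.continuousAt (hU.mem_nhds (hsup hp)))
      · have : (fun p => η p • χ p) =ᶠ[nhds p] fun _ => 0 := by
          filter_upwards [(isClosed_tsupport η).isOpen_compl.mem_nhds hp] with q hq
          simp [image_eq_zero_of_notMem_tsupport hq]
        exact continuousAt_const.congr this.symm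
    rw [← setIntegral_eq_integral_of_forall_compl_eq_zero hz]
    simp only [smul_sub]
    rw [integral_sub, key η hη hc, sub_self]
    · exact (hcontχ.integrable_of_hasCompactSupport hc.smul_right).integrableOn
    · exact ((hη.continuous.smul cP).integrable_of_hasCompactSupport hc.smul_right).integrableOn
  have heq : χ =ᵐ[volume.restrict {p : Mink | 0 < p.1}] waveP f' g' := by
    rw [Filter.EventuallyEq, ae_restrict_iff' hU.measurableSet]
    filter_upwards [hae] with p hp hpU
    exact sub_eq_zero.1 (hp hpU)
  exact fun p hp => Measure.eqOn_open_of_ae_eq heq hU cχ cP.continuousOn hp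

/-! ### A representation formula for functions of class `C²` -/

/-- Polar coordinates with the radial integral inside, so that for each direction it can be
evaluated by the fundamental theorem of calculus. -/
lemma integral_polar {F : Space → ℂ} (hF : Integrable F) :
    ∫ x, F x = ∫ z : Sph, (∫ ρ in Set.Ioi (0 : ℝ), ρ ^ 2 • F (ρ • (z : Space)))
      ∂(volume : Measure Space).toSphere := by
  have hd : Module.finrank ℝ Space - 1 = 2 := by simp
  have mp := (volume : Measure Space).measurePreserving_homeomorphUnitSphereProd
  rw [hd] at mp
  have hemb := (homeomorphUnitSphereProd Space).measurableEmbedding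
  set G : Sph × Set.Ioi (0 : ℝ) → ℂ := fun p => F ((p.2 : ℝ) • (p.1 : Space)) with hG
  have hcomp : ∀ x : ({0}ᶜ : Set Space), G (homeomorphUnitSphereProd Space x) = F x := by
    intro x
    have hx : ‖(x : Space)‖ ≠ 0 := norm_ne_zero_iff.2 x.2
    simp [hG, smul_smul, mul_inv_cancel₀ hx]
  have h0 : MeasurableSet ({0}ᶜ : Set Space) := (measurableSet_singleton _).compl
  have hint : Integrable G ((volume : Measure Space).toSphere.prod (Measure.volumeIoiPow 2)) := by
    rw [← mp.integrable_comp_emb hemb]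
    have : (G ∘ homeomorphUnitSphereProd Space) = F ∘ ((↑) : ({0}ᶜ : Set Space) → Space) := by
      funext x
      exact hcomp x
    rw [this, ← integrableOn_iff_comap_subtypeVal h0]
    exact hF.integrableOn
  calc ∫ x, F x = ∫ x : ({0}ᶜ : Set Space), F x ∂((volume : Measure Space).comap (↑)) := by
        rw [integral_subtype_comap h0 F, restrict_compl_singleton]
    _ = ∫ x : ({0}ᶜ : Set Space), G (homeomorphUnitSphereProd Space x)
          ∂((volume : Measure Space).comap (↑)) := by simp only [hcomp]
    _ = ∫ p, G p ∂((volume : Measure Space).toSphere.prod (Measure.volumeIoiPow 2)) :=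
        mp.integral_comp hemb G
    _ = _ := by
        rw [integral_prod _ hint]
        congr 1
        funext z
        simp only [Measure.volumeIoiPow, ENNReal.ofReal]
        rw [integral_withDensity_eq_integral_smul,
          integral_subtype_comap measurableSet_Ioi
            fun a : ℝ => Real.toNNReal (a ^ 2) • F (a • (z : Space)),
          setIntegral_congr_fun measurableSet_Ioi fun x hx ↦ ?_]
        · rw [NNReal.smul_def, Real.coe_toNNReal _ (pow_nonneg hx.out.le _)]
        · exact (measurable_subtype_coe.pow_const _).real_toNNReal

/-- A smooth cutoff, `1` for `s ≤ 1/2` and `0` for `1 ≤ s`. -/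
def cutoff (s : ℝ) : ℝ := Real.smoothTransition (2 - 2 * s)

lemma contDiff_cutoff : ContDiff ℝ ∞ cutoff := by
  unfold cutoff
  exact Real.smoothTransition.contDiff.comp (by fun_prop)

lemma cutoff_of_one_le {s : ℝ} (hs : 1 ≤ s) : cutoff s = 0 :=
  Real.smoothTransition.zero_of_nonpos (by linarith)

lemma cutoff_zero : cutoff 0 = 1 := Real.smoothTransition.one_of_one_le (by norm_num)

lemma contDiff_deriv_cutoff : ContDiff ℝ ∞ (deriv cutoff) :=
  (contDiff_infty_iff_deriv.1 contDiff_cutoff).2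

lemma deriv_cutoff_of_one_lt {s : ℝ} (hs : 1 < s) : deriv cutoff s = 0 := by
  have : cutoff =ᶠ[nhds s] fun _ => 0 := by
    filter_upwards [lt_mem_nhds hs] with a ha using cutoff_of_one_le ha.le
  rw [this.deriv_eq]
  simp

lemma deriv_deriv_cutoff_of_one_lt {s : ℝ} (hs : 1 < s) : deriv (deriv cutoff) s = 0 := by
  have : deriv cutoff =ᶠ[nhds s] fun _ => 0 := by
    filter_upwards [lt_mem_nhds hs] with a ha using deriv_cutoff_of_one_lt ha
  rw [this.deriv_eq]
  simp

lemma exists_cutoff_bound : ∃ A : ℝ, 1 ≤ A ∧ ∀ s, 0 ≤ s →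
    |cutoff s| ≤ A ∧ |deriv cutoff s| ≤ A ∧ |deriv (deriv cutoff) s| ≤ A := by
  have key : ∀ f : ℝ → ℝ, Continuous f → (∀ s, 1 < s → f s = 0) →
      ∃ A, ∀ s, 0 ≤ s → |f s| ≤ A := by
    intro f hf h0
    obtain ⟨A, hA⟩ := (isCompact_Icc (a := (0 : ℝ)) (b := 1)).exists_bound_of_continuousOn
      hf.continuousOn
    refine ⟨A, fun s hs => ?_⟩
    rcases le_or_gt s 1 with h | h
    · exact hA s ⟨hs, h⟩
    · rw [h0 s h, abs_zero]
      exact (norm_nonneg _).trans (hA 0 ⟨le_rfl, zero_le_one⟩)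
  obtain ⟨a, ha⟩ := key _ contDiff_cutoff.continuous fun s hs => cutoff_of_one_le hs.le
  obtain ⟨b, hb⟩ := key _ contDiff_deriv_cutoff.continuous fun s hs => deriv_cutoff_of_one_lt hs
  obtain ⟨c, hc⟩ := key _ (contDiff_infty_iff_deriv.1 contDiff_deriv_cutoff).2.continuous
    fun s hs => deriv_deriv_cutoff_of_one_lt hs
  refine ⟨max 1 (max a (max b c)), le_max_left _ _, fun s hs => ⟨(ha s hs).trans ?_,
    (hb s hs).trans ?_, (hc s hs).trans ?_⟩⟩ <;> simp

/-- A measurable kernel on the ball of radius `R` with a singularity of order one. -/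
structure Kern (A R : ℝ) (k : Space → ℝ) : Prop where
  meas : Measurable k
  bound : ∀ y, |k y| ≤ A * (Set.Iic R).indicator (fun s => s⁻¹) ‖y‖

/-! ### Kernels with a singularity of order one -/

lemma Kern.eq_zero {A R : ℝ} {k : Space → ℝ} (h : Kern A R k) {y : Space} (hy : R < ‖y‖) :
    k y = 0 := by
  have := h.bound y
  rw [Set.indicator_of_notMem (by simpa using hy), mul_zero] at this
  exact abs_nonpos_iff.1 this

/-- The radial weight s² of the volume in dimension three compensates s^(-p) for p ≤ 2. -/
lemma integrable_indicator_inv_pow (R : ℝ) {p : ℕ} (hp0 : 1 ≤ p) (hp : p ≤ 2) :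
    Integrable (fun y : Space => ((Set.Iic R).indicator (fun s => s⁻¹) ‖y‖ : ℝ) ^ p) := by
  rw [integrable_fun_norm_addHaar volume
    (f := fun s : ℝ => ((Set.Iic R).indicator (fun s => s⁻¹) s) ^ p)]
  have : IntegrableOn (fun s : ℝ => s ^ (2 - p)) (Set.Ioc 0 R) :=
    ((continuous_pow (2 - p)).continuousOn.integrableOn_Icc).mono_set Set.Ioc_subset_Icc_self
  rw [← integrable_indicator_iff measurableSet_Ioc] at this
  rw [← integrable_indicator_iff measurableSet_Ioi]
  refine this.congr (Filter.Eventually.of_forall fun s => ?_)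
  have hp' : p ≠ 0 := by omega
  by_cases h0 : 0 < s <;> by_cases hR : s ≤ R
  · have hd : Module.finrank ℝ Space - 1 = 2 := by simp
    simp only [hd, Set.indicator, Set.mem_Ioc, h0, hR, Set.mem_Ioi, Set.mem_Iic]
    simp only [and_self, if_true, smul_eq_mul, inv_pow]
    rw [pow_sub₀ _ h0.ne' hp]
  · simp [Set.indicator, h0, hR, hp']
  · simp [Set.indicator, h0]
  · simp [Set.indicator, h0]

lemma Kern.integrable {A R : ℝ} {k : Space → ℝ} (h : Kern A R k) : Integrable k := by
  have := integrable_indicator_inv_pow R (p := 1) le_rfl (by norm_num)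
  simp only [pow_one] at this
  exact (this.const_mul A).mono' h.meas.aestronglyMeasurable (Filter.Eventually.of_forall h.bound)

lemma Kern.integrable_sq {A R : ℝ} {k : Space → ℝ} (h : Kern A R k) :
    Integrable (fun y => k y ^ 2) := by
  have := integrable_indicator_inv_pow R (p := 2) (by norm_num) le_rfl
  refine (this.const_mul (A ^ 2)).mono' (h.meas.pow_const 2).aestronglyMeasurable
    (Filter.Eventually.of_forall fun y => ?_)
  rw [Real.norm_eq_abs, abs_pow, ← mul_pow]
  exact pow_le_pow_left₀ (abs_nonneg _) (h.bound y) 2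

lemma Kern.integral_sq_le {A R : ℝ} {k : Space → ℝ} (hR : 0 < R) (h : Kern A R k) :
    ∫ y, k y ^ 2 ≤ A ^ 2 * (3 * volume.real (Metric.ball (0 : Space) 1) * R) := by
  have hi := integrable_indicator_inv_pow R (p := 2) (by norm_num) le_rfl
  have h1 : ∫ y, k y ^ 2 ≤ ∫ y : Space, A ^ 2 * ((Set.Iic R).indicator (fun s => s⁻¹) ‖y‖) ^ 2 := by
    refine integral_mono h.integrable_sq (hi.const_mul _) fun y => ?_
    simp only
    rw [← sq_abs, ← mul_pow]
    exact pow_le_pow_left₀ (abs_nonneg _) (h.bound y) 2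
  refine h1.trans (le_of_eq ?_)
  rw [integral_const_mul, integral_fun_norm_addHaar volume
    (fun s : ℝ => ((Set.Iic R).indicator (fun s => s⁻¹) s) ^ 2)]
  have hd : Module.finrank ℝ Space = 3 := by simp
  have : ∫ y in Set.Ioi (0 : ℝ), y ^ (Module.finrank ℝ Space - 1) •
      ((Set.Iic R).indicator (fun s => s⁻¹) y) ^ 2 = R := by
    have : ∀ y ∈ Set.Ioi (0 : ℝ), y ^ (Module.finrank ℝ Space - 1) •
        ((Set.Iic R).indicator (fun s => s⁻¹) y) ^ 2 = (Set.Ioc 0 R).indicator (fun _ => (1 : ℝ)) y := by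
      intro y hy
      have hy' : 0 < y := hy
      by_cases hyR : y ≤ R
      · simp [Set.indicator, hy', hyR, hy'.ne']
      · simp [Set.indicator, hyR]
    rw [setIntegral_congr_fun measurableSet_Ioi this, setIntegral_indicator measurableSet_Ioc,
      Set.inter_eq_self_of_subset_right Set.Ioc_subset_Ioi_self]
    simp [hR.le]
  rw [this, hd]
  simp only [nsmul_eq_mul, smul_eq_mul]
  push_cast
  ring

/-- The kernels of the representation formula. -/
def kerZero (R : ℝ) (y : Space) : ℝ := (R ^ 2)⁻¹ * deriv (deriv cutoff) (‖y‖ / R) * ‖y‖⁻¹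

/-- The kernels of the representation formula for the first derivatives. -/
def kerOne (R : ℝ) (i : Fin 3) (y : Space) : ℝ :=
  2 * R⁻¹ * deriv cutoff (‖y‖ / R) * (y i * ‖y‖⁻¹) * ‖y‖⁻¹

/-- The kernels of the representation formula for the second derivatives. -/
def kerTwo (R : ℝ) (i j : Fin 3) (y : Space) : ℝ :=
  cutoff (‖y‖ / R) * (y i * ‖y‖⁻¹) * (y j * ‖y‖⁻¹) * ‖y‖⁻¹

lemma measurable_deriv_cutoff : Measurable (deriv cutoff) :=
  contDiff_deriv_cutoff.continuous.measurable

lemma measurable_deriv_deriv_cutoff : Measurable (deriv (deriv cutoff)) :=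
  measurable_deriv _

lemma abs_coord_mul_inv_norm_le (y : Space) (i : Fin 3) : |y i * ‖y‖⁻¹| ≤ 1 := by
  rw [abs_mul, abs_inv, abs_norm]
  rcases eq_or_ne ‖y‖ 0 with h | h
  · simp [h]
  · rw [← div_eq_mul_inv, div_le_one (by positivity)]
    exact PiLp.norm_apply_le y i

lemma kern_of_le {A R : ℝ} {h : ℝ → ℝ} {q : Space → ℝ} (hR : 0 < R) (hh : Measurable h)
    (hq : Measurable q) (hA : ∀ s, 0 ≤ s → |h s| ≤ A) (h0 : ∀ s, 1 < s → h s = 0)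
    (hq1 : ∀ y, |q y| ≤ 1) (b : ℝ) :
    Kern (|b| * A) R (fun y => b * h (‖y‖ / R) * q y * ‖y‖⁻¹) := by
  refine ⟨by fun_prop, fun y => ?_⟩
  by_cases hy : ‖y‖ ≤ R
  · rw [Set.indicator_of_mem (by simpa using hy), abs_mul, abs_mul, abs_mul, abs_inv, abs_norm]
    have hA' := hA (‖y‖ / R) (by positivity)
    refine mul_le_mul_of_nonneg_right ?_ (by positivity)
    calc |b| * |h (‖y‖ / R)| * |q y| ≤ |b| * A * 1 :=
          mul_le_mul (mul_le_mul_of_nonneg_left hA' (abs_nonneg _)) (hq1 y) (abs_nonneg _)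
            (mul_nonneg (abs_nonneg _) ((abs_nonneg _).trans hA'))
      _ = _ := mul_one _
  · have : h (‖y‖ / R) = 0 := h0 _ (by rw [lt_div_iff₀ hR]; linarith)
    rw [this, Set.indicator_of_notMem (by simpa using hy)]
    simp

/-- Each derivative of the cutoff at scale R costs R⁻¹. The dependence on R must be explicit, since
R is later chosen proportional to ⟨x⟩. The factor 2 accounts for the mixed term of the product rule.
-/
lemma exists_kern_bound : ∃ A : ℝ, 0 ≤ A ∧ ∀ R : ℝ, 0 < R →
    Kern (A * (R ^ 2)⁻¹) R (kerZero R) ∧ (∀ i, Kern (A * R⁻¹) R (kerOne R i)) ∧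
      ∀ i j, Kern A R (kerTwo R i j) := by
  obtain ⟨A, hA, hb⟩ := exists_cutoff_bound
  have hc := contDiff_cutoff.continuous.measurable
  have mono : ∀ {a b R k}, Kern a R k → a ≤ b → Kern b R k := fun h hab => ⟨h.meas, fun y =>
    (h.bound y).trans (mul_le_mul_of_nonneg_right hab
      (by
        unfold Set.indicator; split_ifs <;> simp))⟩
  refine ⟨2 * A, by positivity, fun R hR => ⟨?_, fun i => ?_, fun i j => ?_⟩⟩
  · have := kern_of_le (q := fun _ => 1) hR measurable_deriv_deriv_cutoff measurable_const
      (fun s hs => (hb s hs).2.2) (fun s => deriv_deriv_cutoff_of_one_lt) (by simp) (R ^ 2)⁻¹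
    simp only [mul_one] at this
    refine mono this ?_
    rw [abs_of_pos (by positivity)]
    nlinarith [show 0 < (R ^ 2)⁻¹ by positivity]
  · have := kern_of_le (q := fun y => y i * ‖y‖⁻¹) hR measurable_deriv_cutoff (by fun_prop)
      (fun s hs => (hb s hs).2.1) (fun s => deriv_cutoff_of_one_lt)
      (fun y => abs_coord_mul_inv_norm_le y i) (2 * R⁻¹)
    refine mono this (le_of_eq ?_)
    rw [abs_of_pos (by positivity)]
    ring
  · have := kern_of_le (q := fun y => y i * ‖y‖⁻¹ * (y j * ‖y‖⁻¹)) hR hc (by fun_prop)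
      (fun s hs => (hb s hs).1) (fun s hs => cutoff_of_one_le hs.le)
      (fun y => by
        rw [abs_mul]
        exact mul_le_one₀ (abs_coord_mul_inv_norm_le y i) (abs_nonneg _)
          (abs_coord_mul_inv_norm_le y j)) 1
    simp only [one_mul, ← mul_assoc] at this
    unfold kerTwo
    simp only [← mul_assoc]
    refine mono this (by simp; linarith)

lemma Kern.integrable_smul {A R : ℝ} {k : Space → ℝ} (h : Kern A R k) {H : Space → ℂ}
    (hH : Continuous H) : Integrable (fun y => k y • H y) := by
  obtain ⟨C, hC⟩ := (isCompact_closedBall (0 : Space) R).exists_bound_of_continuousOn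
    hH.continuousOn
  refine (h.integrable.norm.mul_const C).mono'
    (h.meas.aestronglyMeasurable.smul hH.aestronglyMeasurable)
    (Filter.Eventually.of_forall fun y => ?_)
  rw [norm_smul]
  by_cases hy : ‖y‖ ≤ R
  · exact mul_le_mul_of_nonneg_left (hC y (by simpa using hy)) (norm_nonneg _)
  · simp [h.eq_zero (not_le.1 hy)]

/-- Let φ(ρ) be the cutoff at ρ/R times H(ρz). Since φ vanishes for ρ > R, two integrations by parts
give ∫ ρ φ''(ρ) dρ = φ(0) = H(0). The kernels are the coefficients of φ'' divided by ρ, and the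
volume factor ρ² restores ρφ''. -/
lemma integral_radial_eq {H : Space → ℂ} (hH : ContDiff ℝ 2 H) {R : ℝ} (hR : 0 < R) (z : Sph) :
    ∫ ρ in Set.Ioi (0 : ℝ), ρ ^ 2 • (kerZero R (ρ • (z : Space)) • H (ρ • (z : Space)) +
      ∑ i, kerOne R i (ρ • (z : Space)) • sd i H (ρ • (z : Space)) +
      ∑ i, ∑ j, kerTwo R i j (ρ • (z : Space)) • sd j (sd i H) (ρ • (z : Space))) = H 0 := by
  have hline : ∀ (F : Space → ℂ), ContDiff ℝ 1 F → ∀ ρ : ℝ,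
      HasDerivAt (fun ρ : ℝ => F (ρ • (z : Space)))
        (∑ i, (z : Space) i • sd i F (ρ • (z : Space))) ρ := by
    intro F hF ρ
    have h1 : HasDerivAt (fun ρ : ℝ => ρ • (z : Space)) ((1 : ℝ) • (z : Space)) ρ :=
      (hasDerivAt_id ρ).smul_const _
    have h2 := ((hF.differentiable one_ne_zero) (ρ • (z : Space))).hasFDerivAt.comp_hasDerivAt ρ h1
    rw [one_smul, fderiv_eq_sum_sd] at h2
    exact h2
  have hsd : ∀ i, ContDiff ℝ 1 (sd i H) := fun i => contDiff_sd (n := 1) hH i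
  have cd : Continuous (deriv cutoff) := contDiff_deriv_cutoff.continuous
  have cdd : Continuous (deriv (deriv cutoff)) :=
    (contDiff_infty_iff_deriv.1 contDiff_deriv_cutoff).2.continuous
  have csdd : ∀ i j, Continuous (sd j (sd i H)) := fun i j => continuous_sd (hsd i) j
  have hdiv : ∀ ρ : ℝ, HasDerivAt (fun ρ : ℝ => ρ / R) R⁻¹ ρ := fun ρ => by
    simpa using (hasDerivAt_id ρ).div_const R
  have hz0 : ∀ ρ : ℝ, HasDerivAt (fun ρ => cutoff (ρ / R)) (deriv cutoff (ρ / R) * R⁻¹) ρ :=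
    fun ρ => HasDerivAt.comp (h₂ := cutoff) ρ ((contDiff_cutoff.differentiable (by simp)) _).hasDerivAt (hdiv ρ)
  have hz1 : ∀ ρ : ℝ, HasDerivAt (fun ρ => deriv cutoff (ρ / R))
      (deriv (deriv cutoff) (ρ / R) * R⁻¹) ρ :=
    fun ρ => HasDerivAt.comp (h₂ := deriv cutoff) ρ ((contDiff_deriv_cutoff.differentiable (by simp)) _).hasDerivAt (hdiv ρ)
  set h1 : ℝ → ℂ := fun ρ => ∑ i, (z : Space) i • sd i H (ρ • (z : Space)) with hh1
  set h2 : ℝ → ℂ := fun ρ => ∑ i, (z : Space) i • ∑ j, (z : Space) j • sd j (sd i H) (ρ • (z : Space))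
    with hh2
  have d1 : ∀ ρ, HasDerivAt h1 (h2 ρ) ρ := fun ρ =>
    HasDerivAt.fun_sum fun i _ => (hline _ (hsd i) ρ).fun_const_smul _
  have d0 : ∀ ρ, HasDerivAt (fun ρ : ℝ => H (ρ • (z : Space))) (h1 ρ) ρ :=
    hline H (hH.of_le (by norm_num))
  set W2 : ℝ → ℂ := fun ρ => (deriv (deriv cutoff) (ρ / R) * R⁻¹ * R⁻¹) • H (ρ • (z : Space)) +
    (2 * (deriv cutoff (ρ / R) * R⁻¹)) • h1 ρ + cutoff (ρ / R) • h2 ρ with hW2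
  -- `W2` is φ'' and `Φ` is ρφ' - φ, a primitive of ρφ''.
  set Φ : ℝ → ℂ := fun ρ => ρ • ((deriv cutoff (ρ / R) * R⁻¹) • H (ρ • (z : Space)) +
    cutoff (ρ / R) • h1 ρ) - cutoff (ρ / R) • H (ρ • (z : Space)) with hΦ
  have dΦ : ∀ ρ, HasDerivAt Φ (ρ • W2 ρ) ρ := by
    intro ρ
    have := ((hasDerivAt_id ρ).fun_smul ((((hz1 ρ).mul_const R⁻¹).fun_smul (d0 ρ)).fun_add
      ((hz0 ρ).fun_smul (d1 ρ)))).fun_sub ((hz0 ρ).fun_smul (d0 ρ))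
    refine this.congr_deriv ?_
    simp only [hW2, id, Complex.real_smul]
    push_cast
    ring
  have hcont : Continuous fun ρ => ρ • W2 ρ := by
    have c0 := hH.continuous
    have c1 : ∀ i, Continuous (sd i H) := fun i => (hsd i).continuous
    have c2 := contDiff_cutoff.continuous
    simp only [hW2, hh1, hh2]
    fun_prop
  have hzero : ∀ ρ, R < ρ → W2 ρ = 0 ∧ Φ ρ = 0 := by
    intro ρ hρ
    have : 1 < ρ / R := (one_lt_div hR).2 hρ
    simp [hW2, hΦ, deriv_deriv_cutoff_of_one_lt this, deriv_cutoff_of_one_lt this,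
      cutoff_of_one_le this.le]
  have hint : IntegrableOn (fun ρ => ρ • W2 ρ) (Set.Ioi 0) := by
    refine (hcont.continuousOn.integrableOn_Icc (a := 0) (b := R)).of_forall_sdiff_eq_zero
      measurableSet_Ioi fun ρ hρ => ?_
    have : R < ρ := by
      by_contra hcon
      exact hρ.2 ⟨(Set.mem_Ioi.1 hρ.1).le, not_lt.1 hcon⟩
    rw [(hzero ρ this).1, smul_zero]
  have hlim : Filter.Tendsto Φ Filter.atTop (nhds 0) :=
    tendsto_const_nhds.congr' (by
      filter_upwards [Filter.eventually_gt_atTop R] with ρ hρ using (hzero ρ hρ).2.symm)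
  have key := integral_Ioi_of_hasDerivAt_of_tendsto (dΦ 0).continuousAt.continuousWithinAt
    (fun ρ _ => dΦ ρ) hint hlim
  have hΦ0 : 0 - Φ 0 = H 0 := by simp [hΦ, cutoff_zero]
  rw [← hΦ0, ← key]
  refine setIntegral_congr_fun measurableSet_Ioi fun ρ hρ => ?_
  have hρ : 0 < ρ := hρ
  have hn : ‖ρ • (z : Space)‖ = ρ := by rw [norm_smul, norm_sph, mul_one, Real.norm_eq_abs,
    abs_of_pos hρ]
  have hρc : (ρ : ℂ) ≠ 0 := by exact_mod_cast hρ.ne'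
  have hRc : (R : ℂ) ≠ 0 := by exact_mod_cast hR.ne'
  have e1 : ∀ i, (ρ • (z : Space)) i * ρ⁻¹ = (z : Space) i := fun i => by
    simp only [PiLp.smul_apply, smul_eq_mul]
    field_simp
  simp only [kerZero, kerOne, kerTwo, hn, hW2, hh1, hh2, e1]
  simp only [Complex.real_smul, Finset.mul_sum, mul_add, Finset.smul_sum]
  push_cast
  congr 1
  · congr 1
    · field_simp
    · refine Finset.sum_congr rfl fun i _ => ?_
      field_simp
  · refine Finset.sum_congr rfl fun i _ => Finset.sum_congr rfl fun j _ => ?_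
    field_simp

/-- Representation of a function by its derivatives up to the second order. -/
lemma representation {H : Space → ℂ} (hH : ContDiff ℝ 2 H) {R : ℝ} (hR : 0 < R) :
    (volume : Measure Space).toSphere.real Set.univ • H 0 =
      (∫ y, kerZero R y • H y) + ∑ i, (∫ y, kerOne R i y • sd i H y) +
        ∑ i, ∑ j, ∫ y, kerTwo R i j y • sd j (sd i H) y := by
  obtain ⟨A, hA, hk⟩ := exists_kern_bound
  obtain ⟨k0, k1, k2⟩ := hk R hR
  have hsd : ∀ i, ContDiff ℝ 1 (sd i H) := fun i => contDiff_sd (n := 1) hH i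
  have i0 := k0.integrable_smul hH.continuous
  have i1 := fun i => (k1 i).integrable_smul (hsd i).continuous
  have i2 := fun i j => (k2 i j).integrable_smul (continuous_sd (hsd i) j)
  have i2' := fun i => integrable_finsetSum Finset.univ fun j _ => i2 i j
  have i1s := integrable_finsetSum Finset.univ fun i _ => i1 i
  have i2s := integrable_finsetSum Finset.univ fun i _ => i2' i
  -- After the radial integration the integrand is the constant H(0), whence the total surface
  -- measure in the formula.
  have := integral_polar ((i0.add i1s).add i2s)
  simp only [Pi.add_apply] at this
  simp only [integral_radial_eq hH hR, integral_const] at this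
  have e1 := integral_add (i0.add i1s) i2s
  simp only [Pi.add_apply] at e1
  rw [← this, e1, integral_add i0 i1s,
    integral_finsetSum _ fun i _ => i1 i, integral_finsetSum _ fun i _ => i2' i]
  congr 1
  exact Finset.sum_congr rfl fun i _ => integral_finsetSum _ fun j _ => i2 i j

/-! ### Mollification and weak derivatives -/

/-- The weak partial derivative: `v = ∂_i u`. -/
def WeakSd (i : Fin 3) (u v : Space → ℂ) : Prop :=
  ∀ ψ : Space → ℝ, ContDiff ℝ ∞ ψ → HasCompactSupport ψ →
    ∫ x, sd i ψ x • u x = -∫ x, ψ x • v x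

/-- The function `w ↦ ∫ ψ(x - w) u(x) dx`. -/
def moll (ψ : Space → ℝ) (u : Space → ℂ) (w : Space) : ℂ := ∫ x, ψ (x - w) • u x

lemma moll_eq_convolution (ψ : Space → ℝ) (u : Space → ℂ) :
    moll ψ u = convolution u (fun y => ψ (-y)) (ContinuousLinearMap.lsmul ℝ ℝ).flip volume := by
  funext w
  simp [moll, convolution]

lemma moll_zero_right (ψ : Space → ℝ) (u : Space → ℂ) : moll ψ u 0 = ∫ x, ψ x • u x := by
  simp [moll]

lemma moll_eq_translate (ψ : Space → ℝ) (u : Space → ℂ) (w : Space) :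
    moll ψ u w = ∫ x, ψ x • u (x + w) := by
  rw [moll, ← integral_add_right_eq_self _ w]
  simp

lemma hasCompactSupport_comp_neg {ψ : Space → ℝ} (hψ : HasCompactSupport ψ) :
    HasCompactSupport (fun y => ψ (-y)) :=
  hψ.comp_homeomorph (Homeomorph.neg Space)

lemma contDiff_moll {ψ : Space → ℝ} {u : Space → ℂ} {n : ℕ∞} (hψ : ContDiff ℝ n ψ)
    (hc : HasCompactSupport ψ) (hu : LocallyIntegrable u) : ContDiff ℝ n (moll ψ u) := by
  rw [moll_eq_convolution]
  exact (hasCompactSupport_comp_neg hc).contDiff_convolution_right _ hu (hψ.comp contDiff_neg)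

lemma sd_moll {ψ : Space → ℝ} {u : Space → ℂ} (hψ : ContDiff ℝ 1 ψ)
    (hc : HasCompactSupport ψ) (hu : LocallyIntegrable u) (i : Fin 3) (w : Space) :
    sd i (moll ψ u) w = -moll (sd i ψ) u w := by
  have hn : ContDiff ℝ 1 fun y => ψ (-y) := hψ.comp contDiff_neg
  have h := (hasCompactSupport_comp_neg hc).hasFDerivAt_convolution_right
    (ContinuousLinearMap.lsmul ℝ ℝ : ℝ →L[ℝ] ℂ →L[ℝ] ℂ).flip hu hn w
  rw [← moll_eq_convolution] at h
  rw [sd, h.fderiv, convolution_precompR_apply _ hu ((hasCompactSupport_comp_neg hc).fderiv ℝ)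
    (hn.continuous_fderiv one_ne_zero)]
  simp only [convolution, ContinuousLinearMap.flip_apply, ContinuousLinearMap.lsmul_apply, moll]
  rw [← integral_neg]
  congr 1
  funext x
  rw [← neg_smul]
  congr 1
  have : fderiv ℝ (fun y => ψ (-y)) (w - x) = -fderiv ℝ ψ (-(w - x)) := by
    have := ((hψ.differentiable one_ne_zero) (-(w - x))).hasFDerivAt.comp (w - x)
      (hasFDerivAt_id (𝕜 := ℝ) (w - x)).neg
    rw [HasFDerivAt.fderiv (f := fun y => ψ (-y)) this]
    ext a
    simp
  rw [this]
  simp [sd]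

/-- The derivative in w falls on ψ(x - w) with a minus sign. The weak derivative tested on this
translate of ψ moves it to u with another one. -/
lemma WeakSd.sd_moll {i : Fin 3} {u v : Space → ℂ} (h : WeakSd i u v) {ψ : Space → ℝ}
    (hψ : ContDiff ℝ ∞ ψ) (hc : HasCompactSupport ψ) (hu : LocallyIntegrable u) :
    sd i (moll ψ u) = moll ψ v := by
  funext w
  rw [SpinDecay.sd_moll (hψ.of_le (by simp)) hc hu]
  have h1 := h (fun x => ψ (x - w)) (by fun_prop)
    (hc.comp_homeomorph (Homeomorph.subRight w))
  have h2 : ∀ x, sd i (fun x => ψ (x - w)) x = sd i ψ (x - w) := fun x => by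
    simp only [sd]
    rw [fderiv_comp_sub]
  simp only [h2] at h1
  rw [moll, h1, neg_neg, moll]

/-! ### Kernel operators on locally square integrable functions -/

/-- Locally square integrable functions. -/
def LocL2 (h : Space → ℂ) : Prop :=
  ∀ ρ : ℝ, MemLp ((Metric.closedBall (0 : Space) ρ).indicator h) 2 volume

lemma LocL2.memLp_indicator {h : Space → ℂ} (hh : LocL2 h) (x : Space) (ρ : ℝ) :
    MemLp ((Metric.closedBall x ρ).indicator h) 2 volume := by
  have h1 := (hh (‖x‖ + ρ)).indicator (Metric.isClosed_closedBall (x := x) (ε := ρ)).measurableSet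
  rw [Set.indicator_indicator, Set.inter_eq_self_of_subset_left] at h1
  · exact h1
  · intro y hy
    rw [Metric.mem_closedBall, dist_eq_norm] at hy
    rw [mem_closedBall_zero_iff]
    have := norm_add_le x (y - x)
    rw [add_sub_cancel] at this
    linarith

lemma LocL2.aestronglyMeasurable {h : Space → ℂ} (hh : LocL2 h) : AEStronglyMeasurable h := by
  refine aestronglyMeasurable_of_tendsto_ae Filter.atTop
    (f := fun n : ℕ => (Metric.closedBall (0 : Space) n).indicator h)
    (fun n => (hh n).aestronglyMeasurable) (Filter.Eventually.of_forall fun x => ?_)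
  refine tendsto_const_nhds.congr' ?_
  filter_upwards [Filter.eventually_ge_atTop ⌈‖x‖⌉₊] with n hn
  rw [Set.indicator_of_mem]
  rw [mem_closedBall_zero_iff]
  exact (Nat.le_ceil _).trans (by exact_mod_cast hn)

lemma LocL2.locallyIntegrable {h : Space → ℂ} (hh : LocL2 h) : LocallyIntegrable h := by
  intro x
  refine ⟨Metric.closedBall x 1, Metric.closedBall_mem_nhds _ one_pos, ?_⟩
  have hm : MeasurableSet (Metric.closedBall x 1) := Metric.isClosed_closedBall.measurableSet
  rw [IntegrableOn]
  have h1 := (memLp_indicator_iff_restrict hm).1 (hh.memLp_indicator x 1)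
  have : IsFiniteMeasure ((volume : Measure Space).restrict (Metric.closedBall x 1)) :=
    ⟨by rw [Measure.restrict_apply_univ]; exact measure_closedBall_lt_top⟩
  exact h1.integrable (by norm_num)

lemma LocL2.norm {h : Space → ℂ} (hh : LocL2 h) : LocL2 (fun x => (‖h x‖ : ℂ)) := by
  intro ρ
  refine ((hh ρ).norm.ofReal (K := ℂ)).ae_eq (Filter.Eventually.of_forall fun x => ?_)
  by_cases hx : x ∈ Metric.closedBall (0 : Space) ρ
  · simp only [Set.indicator_of_mem hx]
    rfl
  · simp only [Set.indicator_of_notMem hx]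
    simp

/-- The integral operator `h ↦ ∫ k(y) h(x + y) dy`. -/
def kop (k : Space → ℝ) (h : Space → ℂ) (x : Space) : ℂ := ∫ y, k y • h (x + y)

lemma Kern.memLp {A R : ℝ} {k : Space → ℝ} (hk : Kern A R k) :
    MemLp (fun y => (k y : ℂ)) 2 volume := by
  have := (memLp_two_iff_integrable_sq hk.meas.aestronglyMeasurable).2 hk.integrable_sq
  exact this.ofReal

lemma Kern.abs {A R : ℝ} {k : Space → ℝ} (hk : Kern A R k) : Kern A R (fun y => |k y|) :=
  ⟨hk.meas.abs, fun y => by rw [abs_abs]; exact hk.bound y⟩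

lemma measurePreserving_translation (x : Space) :
    MeasurePreserving (fun y : Space => x + y) volume volume :=
  measurePreserving_add_left volume x

lemma Kern.smul_eq_smul_indicator {A R : ℝ} {k : Space → ℝ} (hk : Kern A R k) (h : Space → ℂ)
    {x : Space} {s : Set Space} (hs : ∀ y, ‖y‖ ≤ R → x + y ∈ s) (y : Space) :
    k y • h (x + y) = k y • s.indicator h (x + y) := by
  by_cases hy : ‖y‖ ≤ R
  · rw [Set.indicator_of_mem (hs y hy)]
  · simp [hk.eq_zero (not_le.1 hy)]

lemma Kern.integrable_smul_translate {A R : ℝ} {k : Space → ℝ} (hk : Kern A R k) {h : Space → ℂ}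
    (hh : LocL2 h) (x : Space) : Integrable (fun y => k y • h (x + y)) := by
  have hs : ∀ y, ‖y‖ ≤ R → x + y ∈ Metric.closedBall x R := fun y hy => by
    simpa [Metric.mem_closedBall, dist_eq_norm] using hy
  have h1 := (hh.memLp_indicator x R).comp_measurePreserving (measurePreserving_translation x)
  have := hk.memLp.integrable_mul h1
  refine this.congr (Filter.Eventually.of_forall fun y => ?_)
  simp only [hk.smul_eq_smul_indicator h hs y, Pi.mul_apply, Function.comp_apply,
    Complex.real_smul]

/-- Writing the operator as the L² pairing of the kernel with a translate of h gives its continuity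
(translations are strongly continuous on L²) and its bound (Cauchy–Schwarz) at once. -/
lemma Kern.kop_eq_inner {A R : ℝ} {k : Space → ℝ} (hk : Kern A R k) {h : Space → ℂ}
    {x : Space} {s : Set Space} (hs : ∀ y, ‖y‖ ≤ R → x + y ∈ s)
    (hm : MemLp (s.indicator h) 2 volume) :
    kop k h x = inner ℂ (hk.memLp.toLp _)
      (Lp.compMeasurePreserving _ (measurePreserving_translation x) (hm.toLp _)) := by
  rw [L2.inner_def, kop]
  refine integral_congr_ae ?_
  rw [Lp.toLp_compMeasurePreserving]
  filter_upwards [hk.memLp.coeFn_toLp,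
    (hm.comp_measurePreserving (measurePreserving_translation x)).coeFn_toLp] with y h1 h2
  rw [h1, h2, hk.smul_eq_smul_indicator h hs]
  simp [mul_comm]

lemma Kern.continuous_kop {A R : ℝ} {k : Space → ℝ} (hk : Kern A R k) {h : Space → ℂ}
    (hh : LocL2 h) : Continuous (kop k h) := by
  rw [continuous_iff_continuousAt]
  intro x₀
  -- This ball contains the ball of radius R about each point within distance 1 of x₀, so that one
  -- fixed element of L² is translated.
  set s := Metric.closedBall (0 : Space) (‖x₀‖ + 1 + R)
  have hm := hh (‖x₀‖ + 1 + R)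
  have hc : Continuous fun x : Space => inner ℂ (hk.memLp.toLp _)
      (Lp.compMeasurePreserving (fun y : Space => x + y) (measurePreserving_translation x)
        (hm.toLp _)) := by
    refine Continuous.inner continuous_const ?_
    have hT : Continuous fun x : Space => ContinuousMap.mk (fun y : Space => x + y) (by fun_prop) := by
      refine ContinuousMap.continuous_of_continuous_uncurry _ ?_
      exact continuous_fst.add continuous_snd
    exact Continuous.compMeasurePreservingLp (p := 2) (μ := volume) (ν := volume)
      (continuous_const (y := hm.toLp _)) hT (fun x => measurePreserving_translation x) (by norm_num)
  refine hc.continuousAt.congr ?_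
  filter_upwards [Metric.ball_mem_nhds x₀ one_pos] with x hx
  refine (hk.kop_eq_inner (fun y hy => ?_) hm).symm
  rw [mem_closedBall_zero_iff]
  rw [Metric.mem_ball, dist_eq_norm] at hx
  have h1 := norm_add_le x y
  have h2 := norm_add_le x₀ (x - x₀)
  rw [add_sub_cancel] at h2
  linarith

lemma norm_toLp_le {f : Space → ℂ} (hf : MemLp f 2 volume) {B : ℝ} (hB : 0 ≤ B)
    (h : ∫⁻ x, ENNReal.ofReal (‖f x‖ ^ 2) ≤ ENNReal.ofReal (B ^ 2)) : ‖hf.toLp f‖ ≤ B := by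
  rw [Lp.norm_toLp]
  refine ENNReal.toReal_le_of_le_ofReal hB ?_
  rw [eLpNorm_eq_lintegral_rpow_enorm_toReal (by norm_num) (by norm_num)]
  have : ∀ x, ‖f x‖ₑ ^ (2 : ENNReal).toReal = ENNReal.ofReal (‖f x‖ ^ 2) := fun x => by
    rw [ENNReal.ofReal_pow (norm_nonneg _), ofReal_norm]
    simp
  simp only [this]
  calc _ ≤ (ENNReal.ofReal (B ^ 2)) ^ (1 / (2 : ENNReal).toReal) :=
        ENNReal.rpow_le_rpow h (by simp)
    _ = _ := by
        rw [ENNReal.ofReal_rpow_of_nonneg (by positivity) (by simp)]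
        congr 1
        simp only [ENNReal.toReal_ofNat]
        rw [← Real.sqrt_eq_rpow, Real.sqrt_sq hB]

lemma Kern.norm_kop_le {A R : ℝ} (hR : 0 < R) (hA : 0 ≤ A) {k : Space → ℝ} (hk : Kern A R k)
    {h : Space → ℂ} (hh : LocL2 h) (x : Space) {B : ℝ} (hB : 0 ≤ B)
    (hb : ∫⁻ y in Metric.closedBall x R, ENNReal.ofReal (‖h y‖ ^ 2) ≤ ENNReal.ofReal (B ^ 2)) :
    ‖kop k h x‖ ≤
      A * Real.sqrt (3 * volume.real (Metric.ball (0 : Space) 1) * R) * B := by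
  have hm := hh.memLp_indicator x R
  rw [hk.kop_eq_inner (s := Metric.closedBall x R)
    (fun y hy => by simpa [Metric.mem_closedBall, dist_eq_norm] using hy) hm]
  refine (norm_inner_le_norm _ _).trans ?_
  rw [Lp.norm_compMeasurePreserving]
  refine mul_le_mul (norm_toLp_le _ (by positivity) ?_) (norm_toLp_le _ hB ?_) (norm_nonneg _)
    (by positivity)
  · rw [mul_pow, Real.sq_sqrt (by positivity)]
    have : ∀ y, ‖(k y : ℂ)‖ ^ 2 = k y ^ 2 := fun y => by simp
    simp only [this]
    rw [← ofReal_integral_eq_lintegral_ofReal hk.integrable_sq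
      (Filter.Eventually.of_forall fun y => sq_nonneg _)]
    exact ENNReal.ofReal_le_ofReal (hk.integral_sq_le hR)
  · rw [← lintegral_indicator Metric.isClosed_closedBall.measurableSet] at hb
    refine le_trans (le_of_eq ?_) hb
    congr 1
    funext y
    by_cases hy : y ∈ Metric.closedBall x R
    · simp only [Set.indicator_of_mem hy]
    · simp only [Set.indicator_of_notMem hy]
      simp

/-- Fubini's theorem transfers the kernel from h to its mollification, where the classical
representation formula applies. -/
lemma Kern.integral_smul_kop {A R : ℝ} {k : Space → ℝ} (hk : Kern A R k) {h : Space → ℂ}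
    (hh : LocL2 h) {ψ : Space → ℝ} (hψ : Continuous ψ) (hc : HasCompactSupport ψ) :
    ∫ x, ψ x • kop k h x = ∫ y, k y • moll ψ h y := by
  have hint : Integrable (fun p : Space × Space => ψ p.1 • k p.2 • h (p.1 + p.2))
      (volume.prod volume) := by
    have hms : AEStronglyMeasurable (fun p : Space × Space => h (p.1 + p.2))
        (volume.prod volume) :=
      hh.aestronglyMeasurable.comp_quasiMeasurePreserving
        (Measure.quasiMeasurePreserving_snd.comp
          (measurePreserving_prod_add (volume : Measure Space)
            (volume : Measure Space)).quasiMeasurePreserving)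
    have hm : AEStronglyMeasurable (fun p : Space × Space => ψ p.1 • k p.2 • h (p.1 + p.2))
        (volume.prod volume) :=
      ((hψ.comp continuous_fst).aestronglyMeasurable).smul
        (((hk.meas.comp measurable_snd).aestronglyMeasurable).smul hms)
    rw [integrable_prod_iff hm]
    refine ⟨Filter.Eventually.of_forall fun x =>
      (hk.integrable_smul_translate hh x).smul (ψ x), ?_⟩
    -- The inner integral of absolute values is the same kind of operator, for |k| and |h|. It is
    -- therefore continuous in x, and ψ has compact support.
    have hcont := hk.abs.continuous_kop hh.norm
    have : (fun x => ∫ y, ‖ψ x • k y • h (x + y)‖) =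
        fun x => |ψ x| * (kop (fun y => |k y|) (fun x => (‖h x‖ : ℂ)) x).re := by
      funext x
      have : kop (fun y => |k y|) (fun x => (‖h x‖ : ℂ)) x =
          ((∫ y, |k y| * ‖h (x + y)‖ : ℝ) : ℂ) := by
        rw [kop, ← integral_complex_ofReal]
        simp
      rw [this, Complex.ofReal_re, ← integral_const_mul]
      simp
    rw [this]
    refine Continuous.integrable_of_hasCompactSupport
      (hψ.abs.mul (Complex.continuous_re.comp hcont)) ?_
    exact HasCompactSupport.mul_right (f := fun x => |ψ x|) (hc.comp_left abs_zero)
  have := integral_integral_swap (f := fun x y => ψ x • k y • h (x + y)) hint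
  calc ∫ x, ψ x • kop k h x = ∫ x, ∫ y, ψ x • k y • h (x + y) := by
        simp only [kop, integral_smul]
    _ = ∫ y, ∫ x, ψ x • k y • h (x + y) := this
    _ = _ := by
        congr 1
        funext y
        rw [moll_eq_translate, ← integral_smul]
        congr 1
        funext x
        rw [smul_comm]

/-- The right hand side of the representation formula. -/
def repr (R : ℝ) (u : Space → ℂ) (v : Fin 3 → Space → ℂ) (w : Fin 3 → Fin 3 → Space → ℂ)
    (x : Space) : ℂ :=
  ((volume : Measure Space).toSphere.real Set.univ)⁻¹ • (kop (kerZero R) u x +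
    ∑ i, kop (kerOne R i) (v i) x + ∑ i, ∑ j, kop (kerTwo R i j) (w i j) x)

lemma continuous_repr {R : ℝ} (hR : 0 < R) {u : Space → ℂ} {v : Fin 3 → Space → ℂ}
    {w : Fin 3 → Fin 3 → Space → ℂ} (hu : LocL2 u) (hv : ∀ i, LocL2 (v i))
    (hw : ∀ i j, LocL2 (w i j)) : Continuous (repr R u v w) := by
  obtain ⟨A, hA, hk⟩ := exists_kern_bound
  obtain ⟨k0, k1, k2⟩ := hk R hR
  have c0 := k0.continuous_kop hu
  have c1 := fun i => (k1 i).continuous_kop (hv i)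
  have c2 := fun i j => (k2 i j).continuous_kop (hw i j)
  unfold repr
  fun_prop

/-- For each test function ψ the mollification of u is smooth, its value at 0 is ∫ψu and its
derivatives are the mollifications of the weak derivatives. The classical formula at 0 is thus the
asserted identity tested against ψ. -/
lemma ae_eq_repr {R : ℝ} (hR : 0 < R) {u : Space → ℂ} {v : Fin 3 → Space → ℂ}
    {w : Fin 3 → Fin 3 → Space → ℂ} (hu : LocL2 u) (hv : ∀ i, LocL2 (v i))
    (hw : ∀ i j, LocL2 (w i j)) (huv : ∀ i, WeakSd i u (v i))
    (hvw : ∀ i j, WeakSd j (v i) (w i j)) : u =ᵐ[volume] repr R u v w := by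
  obtain ⟨A, hA, hk⟩ := exists_kern_bound
  obtain ⟨k0, k1, k2⟩ := hk R hR
  refine ae_eq_of_integral_contDiff_smul_eq hu.locallyIntegrable
    (continuous_repr hR hu hv hw).locallyIntegrable fun ψ hψ hc => ?_
  have hc0 := hψ.continuous
  have hH : ContDiff ℝ 2 (moll ψ u) :=
    (contDiff_moll (n := 2) (hψ.of_le (by norm_cast)) hc hu.locallyIntegrable)
  have hrep := representation hH hR
  have e1 : ∀ i, sd i (moll ψ u) = moll ψ (v i) := fun i =>
    (huv i).sd_moll hψ hc hu.locallyIntegrable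
  have e2 : ∀ i j, sd j (sd i (moll ψ u)) = moll ψ (w i j) := fun i j => by
    rw [e1]
    exact (hvw i j).sd_moll hψ hc (hv i).locallyIntegrable
  simp only [e2] at hrep
  simp only [e1] at hrep
  rw [moll_zero_right] at hrep
  have hpos : (volume : Measure Space).toSphere.real Set.univ ≠ 0 := by
    rw [Measure.real, ENNReal.toReal_ne_zero]
    exact ⟨toSphere_univ_ne_zero, measure_ne_top _ _⟩
  rw [eq_inv_smul_iff₀ hpos |>.2 hrep]
  have int : ∀ {g : Space → ℂ}, Continuous g → Integrable fun x => ψ x • g x := fun hg =>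
    (hc0.smul hg).integrable_of_hasCompactSupport hc.smul_right
  have i0 := int (k0.continuous_kop hu)
  have i1 := fun i => int ((k1 i).continuous_kop (hv i))
  have i2 := fun i j => int ((k2 i j).continuous_kop (hw i j))
  have i2' := fun i => integrable_finsetSum Finset.univ fun j _ => i2 i j
  have i1s := integrable_finsetSum Finset.univ fun i _ => i1 i
  have i2s := integrable_finsetSum Finset.univ fun i _ => i2' i
  simp only [repr, smul_comm (ψ _) (((volume : Measure Space).toSphere.real Set.univ)⁻¹)]
  rw [integral_smul]
  congr 1
  simp only [smul_add, Finset.smul_sum]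
  have s1 := integral_add (i0.add i1s) i2s
  simp only [Pi.add_apply] at s1
  rw [s1, integral_add i0 i1s,
    integral_finsetSum _ fun i _ => i1 i, integral_finsetSum _ fun i _ => i2' i]
  rw [k0.integral_smul_kop hu hc0 hc]
  congr 1
  · congr 1
    exact Finset.sum_congr rfl fun i _ => ((k1 i).integral_smul_kop (hv i) hc0 hc).symm
  · refine Finset.sum_congr rfl fun i _ => ?_
    rw [integral_finsetSum _ fun j _ => i2 i j]
    exact Finset.sum_congr rfl fun j _ => ((k2 i j).integral_smul_kop (hw i j) hc0 hc).symm

/-! ### The weighted Sobolev embedding -/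

/-- `h` is locally integrable and its weighted `L²` norm is at most `M`. -/
def WL2 (β M : ℝ) (h : Space → ℂ) : Prop :=
  LocallyIntegrable h ∧ 0 ≤ M ∧
    ∫⁻ x, ENNReal.ofReal ((bracket ‖x‖ ^ (-(β + 3 / 2)) * ‖h x‖) ^ 2) ≤ ENNReal.ofReal (M ^ 2)

lemma WL2.setLIntegral_le {β M : ℝ} {h : Space → ℂ} (hh : WL2 β M h) {s : Set Space}
    (hs : MeasurableSet s) {C : ℝ} (hb : ∀ y ∈ s, bracket ‖y‖ ^ (β + 3 / 2) ≤ C) :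
    ∫⁻ y in s, ENNReal.ofReal (‖h y‖ ^ 2) ≤ ENNReal.ofReal ((C * M) ^ 2) := by
  calc ∫⁻ y in s, ENNReal.ofReal (‖h y‖ ^ 2)
      ≤ ∫⁻ y in s, ENNReal.ofReal (C ^ 2) *
          ENNReal.ofReal ((bracket ‖y‖ ^ (-(β + 3 / 2)) * ‖h y‖) ^ 2) := by
        refine setLIntegral_mono' hs fun y hy => ?_
        rw [← ENNReal.ofReal_mul (by positivity)]
        refine ENNReal.ofReal_le_ofReal ?_
        rw [← mul_pow, ← mul_assoc]
        refine pow_le_pow_left₀ (norm_nonneg _) (le_mul_of_one_le_left (norm_nonneg _) ?_) 2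
        rw [Real.rpow_neg (bracket_nonneg _), ← div_eq_mul_inv,
          one_le_div (Real.rpow_pos_of_pos (bracket_pos _) _)]
        exact hb y hy
    _ ≤ ∫⁻ y, ENNReal.ofReal (C ^ 2) *
          ENNReal.ofReal ((bracket ‖y‖ ^ (-(β + 3 / 2)) * ‖h y‖) ^ 2) := setLIntegral_le_lintegral _ _
    _ ≤ _ := by
        rw [lintegral_const_mul' _ _ ENNReal.ofReal_ne_top, mul_pow,
          ENNReal.ofReal_mul (by positivity)]
        gcongr
        exact hh.2.2

lemma WL2.locL2 {β M : ℝ} {h : Space → ℂ} (hh : WL2 β M h) : LocL2 h := by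
  intro ρ
  have hm : MeasurableSet (Metric.closedBall (0 : Space) ρ) :=
    Metric.isClosed_closedBall.measurableSet
  obtain ⟨C, hC⟩ := (isCompact_closedBall (0 : Space) ρ).exists_bound_of_continuousOn
    (continuous_bracket_rpow (β + 3 / 2)).continuousOn
  have hms := hh.1.aestronglyMeasurable
  have hle := hh.setLIntegral_le hm (C := |C|)
    fun y hy => (le_abs_self _).trans ((hC y hy).trans (le_abs_self _))
  rw [memLp_indicator_iff_restrict hm, memLp_two_iff_integrable_sq_norm hms.restrict]
  refine ⟨(hms.restrict.norm.pow 2), ?_⟩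
  rw [hasFiniteIntegral_iff_ofReal (Filter.Eventually.of_forall fun x => by positivity)]
  exact hle.trans_lt ENNReal.ofReal_lt_top

/-- `u` has weak derivatives `∂^α u` for `|α| ≤ J`, with norms at most `M` in the weighted `L²`
spaces with the exponents `β - |α|`. -/
def WSob : ℕ → ℝ → ℝ → (Space → ℂ) → Prop
  | 0, β, M, u => WL2 β M u
  | J + 1, β, M, u => WL2 β M u ∧ ∀ i, ∃ v, WeakSd i u v ∧ WSob J (β - 1) M v

lemma WSob.wL2 {J : ℕ} {β M : ℝ} {u : Space → ℂ} (h : WSob J β M u) : WL2 β M u := by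
  cases J
  · exact h
  · exact h.1

lemma WSob.pred {J : ℕ} {β M : ℝ} {u : Space → ℂ} (h : WSob (J + 1) β M u) : WSob J β M u := by
  induction J generalizing β u with
  | zero => exact h.1
  | succ J ih => exact ⟨h.1, fun i => by
      obtain ⟨v, hv, hs⟩ := h.2 i
      exact ⟨v, hv, ih hs⟩⟩

/-- The bracket is Lipschitz with constant 1, so it changes by at most one half of its value on this
ball. -/
lemma bracket_comparable {x y : Space} (h : y ∈ Metric.closedBall x (bracket ‖x‖ / 2)) :
    bracket ‖y‖ ≤ 2 * bracket ‖x‖ ∧ bracket ‖x‖ ≤ 2 * bracket ‖y‖ := by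
  rw [Metric.mem_closedBall, dist_eq_norm] at h
  have h1 : |‖y‖ - ‖x‖| ≤ bracket ‖x‖ / 2 := (abs_norm_sub_norm_le y x).trans h
  have key : ∀ a b : ℝ, bracket a ≤ bracket b + |a - b| := by
    intro a b
    have hb := abs_le_bracket b
    have hb0 := bracket_pos b
    refine abs_le_of_sq_le_sq' ?_ (by positivity) |>.2
    have e1 := bracket_sq a
    have e2 := bracket_sq b
    have e3 := sq_abs (a - b)
    have e4 : b * (a - b) ≤ bracket b * |a - b| := by
      calc b * (a - b) ≤ |b * (a - b)| := le_abs_self _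
        _ = |b| * |a - b| := abs_mul _ _
        _ ≤ _ := mul_le_mul_of_nonneg_right hb (abs_nonneg _)
    nlinarith
  have k1 := key ‖y‖ ‖x‖
  have k2 := key ‖x‖ ‖y‖
  rw [abs_sub_comm] at k2
  have := bracket_pos ‖x‖
  constructor <;> linarith

lemma WL2.norm_kop_le {β M : ℝ} {h : Space → ℂ} (hh : WL2 β M h) {A : ℝ} (hA : 0 ≤ A)
    {k : Space → ℝ} {x : Space} (hk : Kern A (bracket ‖x‖ / 2) k) :
    ‖kop k h x‖ ≤ A * Real.sqrt (3 * volume.real (Metric.ball (0 : Space) 1) / 2) *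
      Real.sqrt (bracket ‖x‖) * (2 ^ |β + 3 / 2| * bracket ‖x‖ ^ (β + 3 / 2) * M) := by
  have hb := bracket_pos ‖x‖
  have hC : 0 ≤ 2 ^ |β + 3 / 2| * bracket ‖x‖ ^ (β + 3 / 2) := by positivity
  have := hk.norm_kop_le (by positivity) hA hh.locL2 x
    (B := 2 ^ |β + 3 / 2| * bracket ‖x‖ ^ (β + 3 / 2) * M) (mul_nonneg hC hh.2.1)
    (hh.setLIntegral_le Metric.isClosed_closedBall.measurableSet fun y hy => by
      obtain ⟨h1, h2⟩ := bracket_comparable hy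
      exact rpow_le_of_comparable (bracket_pos _) hb one_le_two h1 h2)
  refine this.trans (le_of_eq ?_)
  rw [show 3 * volume.real (Metric.ball (0 : Space) 1) * (bracket ‖x‖ / 2) =
    3 * volume.real (Metric.ball (0 : Space) 1) / 2 * bracket ‖x‖ by ring,
    Real.sqrt_mul (by positivity)]
  ring

/-- The pointwise bound for functions with two weak derivatives in weighted `L²` spaces. -/
lemma exists_continuous_of_wSob (β : ℝ) : ∃ C : ℝ, 0 ≤ C ∧ ∀ {M : ℝ} {u : Space → ℂ},
    WSob 2 β M u → ∃ u' : Space → ℂ, Continuous u' ∧ u =ᵐ[volume] u' ∧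
      ∀ x, ‖u' x‖ ≤ C * M * bracket ‖x‖ ^ β := by
  obtain ⟨A, hA, hk⟩ := exists_kern_bound
  obtain ⟨V, hVd⟩ : ∃ V, Real.sqrt (3 * volume.real (Metric.ball (0 : Space) 1) / 2) = V := ⟨_, rfl⟩
  set T := (volume : Measure Space).toSphere.real Set.univ
  have hV : 0 ≤ V := hVd ▸ Real.sqrt_nonneg _
  have hT : 0 ≤ T := measureReal_nonneg
  set K : ℝ → ℝ := fun b => (2 : ℝ) ^ |b + 3 / 2| with hK
  have hK0 : ∀ b, 0 ≤ K b := fun b => by simp only [hK]; positivity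
  refine ⟨T⁻¹ * (A * V) * (4 * K β + 3 * (2 * K (β - 1)) + 9 * K (β - 1 - 1)),
    by have := hK0 β; have := hK0 (β - 1); have := hK0 (β - 1 - 1); positivity, ?_⟩
  intro M u ⟨hu, hu1⟩
  choose v huv hv using hu1
  choose w hvw hw using fun i => (hv i).2
  have hv' := fun i => (hv i).1
  have lu := hu.locL2
  have lv := fun i => (hv' i).locL2
  have lw := fun i j => (hw i j).locL2
  -- The representative is fixed with R = 1. At each x it is estimated with a radius adapted to x.
  refine ⟨repr 1 u v w, continuous_repr one_pos lu lv lw,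
    ae_eq_repr one_pos lu lv lw huv hvw, fun x => ?_⟩
  have hb := bracket_pos ‖x‖
  set b := bracket ‖x‖
  have hR : 0 < b / 2 := by positivity
  -- Representations with different radii are continuous and agree almost everywhere, hence
  -- everywhere.
  have heq : repr 1 u v w = repr (b / 2) u v w :=
    (Continuous.ae_eq_iff_eq volume (continuous_repr one_pos lu lv lw)
      (continuous_repr hR lu lv lw)).1
      ((ae_eq_repr one_pos lu lv lw huv hvw).symm.trans (ae_eq_repr hR lu lv lw huv hvw))
  obtain ⟨k0, k1, k2⟩ := hk (b / 2) hR
  have b0 := hu.norm_kop_le (by positivity) k0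
  have b1 := fun i => (hv' i).norm_kop_le (by positivity) (k1 i)
  have b2 := fun i j => (hw i j).norm_kop_le hA (k2 i j)
  set q := Real.sqrt b
  have hq : 0 < q := Real.sqrt_pos.2 hb
  have hqq : b = q ^ 2 := (Real.sq_sqrt hb.le).symm
  have e32 : b ^ (3 / 2 : ℝ) = q ^ 3 := by
    rw [show (3 / 2 : ℝ) = 1 + 1 / 2 by norm_num, Real.rpow_add hb, Real.rpow_one,
      ← Real.sqrt_eq_rpow, hqq]
    simp only [Real.sqrt_sq hq.le]
    ring
  -- Powers are counted in q = ⟨x⟩^(1/2). The kernel norms contribute q and, for the terms with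
  -- zero, one and two derivatives, q⁻⁴, q⁻² and 1. The weights contribute ⟨x⟩^β times q³, q and
  -- q⁻¹, so all three terms scale as ⟨x⟩^β.
  have r0 : b ^ (β + 3 / 2) = b ^ β * q ^ 3 := by rw [Real.rpow_add hb, e32]
  have r1 : b ^ (β - 1 + 3 / 2) = b ^ β * q := by
    rw [Real.rpow_add hb, Real.rpow_sub_one hb.ne', e32, hqq]
    field_simp
  have r2 : b ^ (β - 1 - 1 + 3 / 2) = b ^ β * q⁻¹ := by
    rw [Real.rpow_add hb, Real.rpow_sub_one hb.ne', Real.rpow_sub_one hb.ne', e32, hqq]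
    field_simp
  have B0 : ‖kop (kerZero (b / 2)) u x‖ ≤ A * V * (4 * K β) * (M * b ^ β) := by
    refine b0.trans (le_of_eq ?_)
    rw [r0, show ((b / 2) ^ 2)⁻¹ = 4 / q ^ 4 by rw [hqq]; field_simp; norm_num]
    simp only [hK, hVd]
    field_simp
  have B1 : ∀ i, ‖kop (kerOne (b / 2) i) (v i) x‖ ≤ A * V * (2 * K (β - 1)) * (M * b ^ β) := by
    intro i
    refine (b1 i).trans (le_of_eq ?_)
    rw [r1, show (b / 2)⁻¹ = 2 / q ^ 2 by rw [hqq]; field_simp]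
    simp only [hK, hVd]
    field_simp
  have B2 : ∀ i j, ‖kop (kerTwo (b / 2) i j) (w i j) x‖ ≤
      A * V * K (β - 1 - 1) * (M * b ^ β) := by
    intro i j
    refine (b2 i j).trans (le_of_eq ?_)
    rw [r2]
    simp only [hK, hVd]
    field_simp
  rw [heq, repr, norm_smul, norm_inv, Real.norm_eq_abs, abs_of_nonneg hT]
  have S1 : ‖∑ i, kop (kerOne (b / 2) i) (v i) x‖ ≤
      3 * (A * V * (2 * K (β - 1)) * (M * b ^ β)) := by
    refine (norm_sum_le_of_le _ fun i _ => B1 i).trans (le_of_eq ?_)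
    simp
  have S2 : ‖∑ i, ∑ j, kop (kerTwo (b / 2) i j) (w i j) x‖ ≤
      9 * (A * V * K (β - 1 - 1) * (M * b ^ β)) := by
    refine (norm_sum_le_of_le _ fun i _ => norm_sum_le_of_le _ fun j _ => B2 i j).trans
      (le_of_eq ?_)
    simp
    ring
  calc T⁻¹ * _ ≤ T⁻¹ * (A * V * (4 * K β) * (M * b ^ β) +
        3 * (A * V * (2 * K (β - 1)) * (M * b ^ β)) +
        9 * (A * V * K (β - 1 - 1) * (M * b ^ β))) := by
        refine mul_le_mul_of_nonneg_left ?_ (inv_nonneg.2 hT)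
        exact (norm_add_le _ _).trans (add_le_add ((norm_add_le _ _).trans (add_le_add B0 S1)) S2)
    _ = _ := by ring

/-! ### Continuous weak derivatives are classical -/

/-- A sequence of mollifiers. -/
def bump (n : ℕ) : ContDiffBump (0 : Space) where
  rIn := 1 / (2 * (n + 1))
  rOut := 1 / (n + 1)
  rIn_pos := by positivity
  rIn_lt_rOut := by
    apply one_div_lt_one_div_of_lt (by positivity)
    have : (0 : ℝ) < n + 1 := by positivity
    linarith

/-- The normalized mollifiers. -/
def bumpFun (n : ℕ) : Space → ℝ := (bump n).normed volume

lemma contDiff_bumpFun (n : ℕ) : ContDiff ℝ ∞ (bumpFun n) := (bump n).contDiff_normed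

lemma hasCompactSupport_bumpFun (n : ℕ) : HasCompactSupport (bumpFun n) :=
  (bump n).hasCompactSupport_normed

lemma norm_moll_bumpFun_sub_le {v : Space → ℂ} (hv : Continuous v) {n : ℕ} {w : Space} {ε : ℝ}
    (h : ∀ x : Space, ‖x‖ < 1 / (n + 1) → ‖v (x + w) - v w‖ ≤ ε) :
    ‖moll (bumpFun n) v w - v w‖ ≤ ε := by
  have hc := (contDiff_bumpFun n).continuous
  have i1 : Integrable fun x => bumpFun n x • v (x + w) :=
    (hc.smul (by fun_prop)).integrable_of_hasCompactSupport
      (hasCompactSupport_bumpFun n).smul_right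
  have i0 : Integrable (bumpFun n) :=
    hc.integrable_of_hasCompactSupport (hasCompactSupport_bumpFun n)
  have h1 : ∫ x, bumpFun n x = 1 := (bump n).integral_normed
  have h2 : v w = ∫ x, bumpFun n x • v w := by
    rw [integral_smul_const, h1, one_smul]
  rw [moll_eq_translate]
  nth_rewrite 1 [h2]
  rw [← integral_sub i1 (i0.smul_const _)]
  have h3 : ∫ x, bumpFun n x * ε = ε := by rw [integral_mul_const, h1, one_mul]
  rw [← h3]
  refine norm_integral_le_of_norm_le (i0.mul_const ε) (Filter.Eventually.of_forall fun x => ?_)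
  have h0 : 0 ≤ bumpFun n x := (bump n).nonneg_normed x
  rw [← smul_sub, norm_smul, Real.norm_eq_abs, abs_of_nonneg (h0 : 0 ≤ bumpFun n x)]
  by_cases hx : ‖x‖ < 1 / (n + 1)
  · exact mul_le_mul_of_nonneg_left (h x hx) h0
  · have : bumpFun n x = 0 := by
      by_contra hne
      have : x ∈ Function.support ((bump n).normed volume) := hne
      rw [ContDiffBump.support_normed_eq, mem_ball_zero_iff] at this
      exact hx this
    simp [this]

lemma tendstoLocallyUniformly_moll {v : Space → ℂ} (hv : Continuous v) :
    TendstoLocallyUniformlyOn (fun n => moll (bumpFun n) v) v Filter.atTop Set.univ := by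
  rw [Metric.tendstoLocallyUniformlyOn_iff]
  intro ε hε x₀ _
  obtain ⟨d, hd, hball⟩ := Metric.continuousAt_iff.1 (hv.continuousAt (x := x₀)) (ε / 4) (by positivity)
  refine ⟨Metric.ball x₀ (d / 2), mem_nhdsWithin_of_mem_nhds
    (Metric.ball_mem_nhds _ (by positivity)), ?_⟩
  have hlim := tendsto_one_div_add_atTop_nhds_zero_nat (𝕜 := ℝ)
  filter_upwards [hlim.eventually (gt_mem_nhds (show 0 < d / 2 by positivity))] with n hn
  intro w hw
  rw [dist_comm, dist_eq_norm]
  refine (norm_moll_bumpFun_sub_le hv (ε := ε / 2) fun x hx => ?_).trans_lt (by linarith)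
  rw [Metric.mem_ball] at hw
  have h1 : dist (v (x + w)) (v x₀) < ε / 4 := hball (by
    calc dist (x + w) x₀ ≤ dist (x + w) w + dist w x₀ := dist_triangle _ _ _
      _ < d := by rw [dist_eq_norm, add_sub_cancel_right]; linarith)
  have h2 : dist (v w) (v x₀) < ε / 4 := hball (by linarith)
  rw [← dist_eq_norm]
  linarith [dist_triangle_right (v (x + w)) (v w) (v x₀)]

/-- The linear map with the given partial derivatives. -/
def gradMap (a : Fin 3 → ℂ) : Space →L[ℝ] ℂ :=
  ∑ i, (EuclideanSpace.proj i : Space →L[ℝ] ℝ).smulRight (a i)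

lemma gradMap_apply (a : Fin 3 → ℂ) (y : Space) : gradMap a y = ∑ i, y i • a i := by
  simp [gradMap]

lemma norm_gradMap_sub_le (a b : Fin 3 → ℂ) : ‖gradMap a - gradMap b‖ ≤ ∑ i, ‖a i - b i‖ := by
  refine ContinuousLinearMap.opNorm_le_bound _ (by positivity) fun y => ?_
  rw [sub_apply, gradMap_apply, gradMap_apply, ← Finset.sum_sub_distrib,
    Finset.sum_mul]
  refine norm_sum_le_of_le _ fun i _ => ?_
  rw [← smul_sub, norm_smul, mul_comm]
  exact mul_le_mul_of_nonneg_left (PiLp.norm_apply_le y i) (norm_nonneg _)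

/-- The mollifications converge locally uniformly together with their derivatives, which are the
mollifications of the continuous weak derivatives. -/
lemma hasFDerivAt_of_weakSd {u : Space → ℂ} {v : Fin 3 → Space → ℂ} (hu : Continuous u)
    (hv : ∀ i, Continuous (v i)) (h : ∀ i, WeakSd i u (v i)) (x : Space) :
    HasFDerivAt u (gradMap fun i => v i x) x := by
  have hmu : ∀ n, ContDiff ℝ 1 (moll (bumpFun n) u) := fun n =>
    contDiff_moll (n := 1) ((contDiff_bumpFun n).of_le (by norm_cast))
      (hasCompactSupport_bumpFun n) hu.locallyIntegrable
  refine hasFDerivAt_of_tendstoLocallyUniformlyOn (l := Filter.atTop)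
    (f := fun n : ℕ => moll (bumpFun n) u)
    (f' := fun n w => gradMap fun i => moll (bumpFun n) (v i) w)
    (g' := fun w => gradMap fun i => v i w) isOpen_univ ?_ ?_ ?_ (Set.mem_univ x)
  · have hl := fun i => Metric.tendstoLocallyUniformlyOn_iff.1 (tendstoLocallyUniformly_moll (hv i))
    rw [Metric.tendstoLocallyUniformlyOn_iff]
    intro ε hε x₀ hx₀
    choose t ht hb using fun i => hl i (ε / 3) (by positivity) x₀ hx₀
    refine ⟨⋂ i, t i, (Filter.iInter_mem).2 ht, ?_⟩
    filter_upwards [Filter.eventually_all.2 hb] with n hn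
    intro y hy
    rw [dist_eq_norm]
    refine (norm_gradMap_sub_le _ _).trans_lt ?_
    rw [Fin.sum_univ_three]
    have := fun i => hn i y (Set.mem_iInter.1 hy i)
    simp only [dist_eq_norm] at this
    linarith [this 0, this 1, this 2]
  · intro n w _
    have h1 := ((hmu n).differentiable one_ne_zero w).hasFDerivAt
    convert h1 using 1
    ext y
    rw [gradMap_apply, fderiv_eq_sum_sd]
    refine Finset.sum_congr rfl fun i _ => ?_
    rw [(h i).sd_moll (contDiff_bumpFun n) (hasCompactSupport_bumpFun n) hu.locallyIntegrable]
  · intro w _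
    exact (tendstoLocallyUniformly_moll hu).tendsto_at (Set.mem_univ w)

lemma contDiff_one_of_weakSd {u : Space → ℂ} {v : Fin 3 → Space → ℂ} (hu : Continuous u)
    (hv : ∀ i, Continuous (v i)) (h : ∀ i, WeakSd i u (v i)) :
    ContDiff ℝ 1 u ∧ ∀ i, sd i u = v i := by
  have hd := hasFDerivAt_of_weakSd hu hv h
  have hs : ∀ i, sd i u = v i := fun i => by
    funext x
    rw [sd, (hd x).fderiv, gradMap_apply, Finset.sum_eq_single i]
    · simp
    · intro j _ hj
      simp [hj]
    · simp
  refine ⟨contDiff_one_iff_fderiv.2 ⟨fun x => (hd x).differentiableAt, ?_⟩, hs⟩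
  rw [funext fun x => (hd x).fderiv]
  unfold gradMap
  refine continuous_finsetSum _ fun i _ => ?_
  exact (ContinuousLinearMap.smulRightL ℝ Space ℂ (EuclideanSpace.proj i)).continuous.comp (hv i)

lemma WeakSd.congr_ae {i : Fin 3} {u u' v v' : Space → ℂ} (h : WeakSd i u v)
    (hu : u =ᵐ[volume] u') (hv : v =ᵐ[volume] v') : WeakSd i u' v' := by
  intro ψ hψ hc
  have := h ψ hψ hc
  rw [integral_congr_ae (g := fun x => sd i ψ x • u' x) (hu.mono fun x hx => by simp only [hx]),
    integral_congr_ae (f := fun x => ψ x • v x) (g := fun x => ψ x • v' x)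
      (hv.mono fun x hx => by simp only [hx])] at this
  exact this

/-- Induction on a. The representatives of u and of its weak derivatives are continuous, so the
latter are the classical derivatives of the former. The pointwise bound costs two derivatives at
every stage. -/
lemma exists_sym_of_wSob (a : ℕ) (β : ℝ) : ∃ C : ℝ, 0 ≤ C ∧ ∀ {M : ℝ} {u : Space → ℂ},
    WSob (a + 2) β M u → ∃ u' : Space → ℂ, u =ᵐ[volume] u' ∧ Sym a β (C * M) u' := by
  induction a generalizing β with
  | zero =>
    obtain ⟨C, hC, h⟩ := exists_continuous_of_wSob β
    refine ⟨C, hC, fun hu => ?_⟩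
    obtain ⟨u', h1, h2, h3⟩ := h hu
    exact ⟨u', h2, h1, h3⟩
  | succ a ih =>
    obtain ⟨C, hC, h⟩ := exists_continuous_of_wSob β
    obtain ⟨C', hC', h'⟩ := ih (β - 1)
    refine ⟨max C C', le_max_of_le_left hC, fun {M u} hu => ?_⟩
    have hM := hu.wL2.2.1
    have hu2 : WSob 2 β M u := by
      have : ∀ n, WSob (n + 2) β M u → WSob 2 β M u := by
        intro n
        induction n with
        | zero => exact id
        | succ n ihn => exact fun hs => ihn hs.pred
      exact this (a + 1) hu
    obtain ⟨u', c1, e1, b1⟩ := h hu2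
    choose v hv hvs using hu.2
    choose v' e2 s2 using fun i => h' (hvs i)
    obtain ⟨cd, hsd⟩ := contDiff_one_of_weakSd c1 (fun i => (s2 i).continuous)
      fun i => (hv i).congr_ae e1 (e2 i)
    have hm := mul_le_mul_of_nonneg_right (le_max_left C C') hM
    have hm' := mul_le_mul_of_nonneg_right (le_max_right C C') hM
    refine ⟨u', e1, cd, fun x => (b1 x).trans
      (mul_le_mul_of_nonneg_right hm (Real.rpow_nonneg (bracket_pos _).le _)), fun i => ?_⟩
    rw [hsd i]
    exact (s2 i).mono hm'

/-! ### The weighted Sobolev norm -/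

/-- Appending the index at the end makes the new derivative the first to act on ψ. This is the form
in which an existing weak derivative can be tested on ∂_i ψ. -/
lemma spacePartial_snoc {n : ℕ} (α : Fin n → Fin 3) (i : Fin 3) {ψ : Space → ℝ}
    (hψ : ContDiff ℝ ∞ ψ) :
    spacePartial (Fin.snoc α i : Fin (n + 1) → Fin 3) ψ = spacePartial α (sd i ψ) := by
  funext x
  have hd : ContDiff ℝ ∞ (fderiv ℝ ψ) := hψ.fderiv_right (by simp)
  have h1 : sd i ψ = (ContinuousLinearMap.apply ℝ ℝ (bas i)) ∘ (fderiv ℝ ψ) := rfl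
  rw [spacePartial, spacePartial, iteratedFDeriv_succ_apply_right, h1,
    ContinuousLinearMap.iteratedFDeriv_comp_left (n := ∞) _ hd.contDiffAt (by norm_cast; exact le_top)]
  have h2 : (Fin.init fun k : Fin (n + 1) =>
      (EuclideanSpace.single ((Fin.snoc α i : Fin (n + 1) → Fin 3) k) 1 : Space)) =
      fun k => EuclideanSpace.single (α k) 1 := by
    funext k
    simp [Fin.init]
  rw [h2]
  simp

/-- Testing the derivative of order n on ∂_i ψ and that of order n + 1 on ψ gives the same integral
of f, and the common sign (-1)^n cancels. -/
lemma IsWeakDeriv.weakSd {n : ℕ} {α : Fin n → Fin 3} {i : Fin 3} {f g v : Space → ℂ}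
    (hg : IsWeakDeriv α f g) (hv : IsWeakDeriv (Fin.snoc α i : Fin (n + 1) → Fin 3) f v) :
    WeakSd i g v := by
  intro ψ hψ hc
  have hs : ContDiff ℝ ∞ (sd i ψ) := by
    have hd : ContDiff ℝ ∞ (fderiv ℝ ψ) := hψ.fderiv_right (by simp)
    exact hd.clm_apply contDiff_const
  have hcs : HasCompactSupport (sd i ψ) :=
    (hc.fderiv ℝ).comp_left (g := fun L : Space →L[ℝ] ℝ => L (bas i)) rfl
  have h1 := hg.2.2 (sd i ψ) hs hcs
  have h2 := hv.2.2 ψ hψ hc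
  rw [spacePartial_snoc α i hψ, h1, pow_succ, mul_smul] at h2
  have h3 := smul_right_injective ℂ (pow_ne_zero n (by norm_num : (-1 : ℝ) ≠ 0)) h2
  simpa using h3

lemma IsWeakDeriv.ae_eq {n : ℕ} {α : Fin n → Fin 3} {f g g' : Space → ℂ}
    (hg : IsWeakDeriv α f g) (hg' : IsWeakDeriv α f g') : g =ᵐ[volume] g' := by
  refine ae_eq_of_integral_contDiff_smul_eq hg.2.1 hg'.2.1 fun ψ hψ hc => ?_
  have := (hg.2.2 ψ hψ hc).symm.trans (hg'.2.2 ψ hψ hc)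
  exact smul_right_injective ℂ (pow_ne_zero n (by norm_num : (-1 : ℝ) ≠ 0)) this

/-- The square of the weighted `L²` norm of the weak derivative `∂_α f`. -/
def weakNormSq {n : ℕ} (δ : ℝ) (α : Fin n → Fin 3) (f : Space → ℂ) : ENNReal :=
  ⨅ (g : Space → ℂ) (_ : IsWeakDeriv α f g),
    ∫⁻ x, ENNReal.ofReal ((bracket ‖x‖ ^ ((n : ℝ) - (δ + 3 / 2)) * ‖g x‖) ^ 2)

lemma weakNormSq_le {J n : ℕ} (hn : n ≤ J) (δ : ℝ) (α : Fin n → Fin 3) (f : Space → ℂ) :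
    weakNormSq δ α f ≤ sobolevNorm J δ f ^ 2 := by
  have h1 : sobolevNorm J δ f ^ 2 = ∑ n ∈ Finset.range (J + 1), ∑ α : Fin n → Fin 3,
      weakNormSq δ α f := by
    rw [sobolevNorm, ← ENNReal.rpow_natCast, ← ENNReal.rpow_mul]
    norm_num
    rfl
  rw [h1]
  calc weakNormSq δ α f ≤ ∑ α : Fin n → Fin 3, weakNormSq δ α f :=
        Finset.single_le_sum (f := fun α : Fin n → Fin 3 => weakNormSq δ α f)
          (fun _ _ => zero_le) (Finset.mem_univ α)
    _ ≤ _ := Finset.single_le_sum (f := fun n => ∑ α : Fin n → Fin 3, weakNormSq δ α f)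
          (fun _ _ => zero_le) (Finset.mem_range.2 (by omega))

/-- Any two weak derivatives agree almost everywhere, so the infimum in the norm is attained at each
of them. -/
lemma IsWeakDeriv.wL2 {J n : ℕ} (hn : n ≤ J) {δ : ℝ} {α : Fin n → Fin 3} {f g : Space → ℂ}
    (hf : sobolevNorm J δ f < ⊤) (hg : IsWeakDeriv α f g) :
    WL2 (δ - n) (sobolevNorm J δ f).toReal g := by
  refine ⟨hg.2.1, ENNReal.toReal_nonneg, ?_⟩
  rw [ENNReal.ofReal_pow ENNReal.toReal_nonneg, ENNReal.ofReal_toReal hf.ne]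
  refine le_trans ?_ (weakNormSq_le hn δ α f)
  refine le_iInf₂ fun g' hg' => le_of_eq ?_
  refine lintegral_congr_ae ((hg.ae_eq hg').mono fun x hx => ?_)
  simp only [hx]
  congr 5
  ring

/-- An infimum over the empty set is ∞, so a finite norm forces the weak derivative to exist. -/
lemma exists_isWeakDeriv {J n : ℕ} (hn : n ≤ J) {δ : ℝ} (α : Fin n → Fin 3) {f : Space → ℂ}
    (hf : sobolevNorm J δ f < ⊤) : ∃ g, IsWeakDeriv α f g := by
  by_contra hcon
  push Not at hcon
  have h1 : weakNormSq δ α f = ⊤ := by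
    simp [weakNormSq, hcon]
  have := weakNormSq_le hn δ α f
  rw [h1, top_le_iff] at this
  exact (ENNReal.pow_lt_top hf).ne this

lemma wSob_of_isWeakDeriv {J : ℕ} {δ : ℝ} {f : Space → ℂ} (hf : sobolevNorm J δ f < ⊤) (m : ℕ) :
    ∀ {n : ℕ}, n + m ≤ J → ∀ {α : Fin n → Fin 3} {g : Space → ℂ}, IsWeakDeriv α f g →
      WSob m (δ - n) (sobolevNorm J δ f).toReal g := by
  induction m with
  | zero => exact fun hn _ _ hg => hg.wL2 (by omega) hf
  | succ m ih =>
    intro n hn α g hg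
    refine ⟨hg.wL2 (by omega) hf, fun i => ?_⟩
    obtain ⟨v, hv⟩ := exists_isWeakDeriv (n := n + 1) (by omega)
      (Fin.snoc α i : Fin (n + 1) → Fin 3) hf
    refine ⟨v, hg.weakSd hv, ?_⟩
    have := ih (by omega) hv
    rwa [show δ - ((n + 1 : ℕ) : ℝ) = δ - n - 1 by push_cast; ring] at this

lemma wSob_of_memSobolev {J : ℕ} {δ : ℝ} {f : Space → ℂ} (hf : MemSobolev J δ f) :
    WSob J δ (sobolevNorm J δ f).toReal f := by
  obtain ⟨g, hg⟩ := exists_isWeakDeriv (n := 0) (Nat.zero_le J) (fun i => i.elim0) hf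
  have hff : IsWeakDeriv (n := 0) (fun i => i.elim0) f f := by
    refine ⟨hg.1, hg.1, fun ψ _ _ => ?_⟩
    simp [spacePartial]
  simpa using wSob_of_isWeakDeriv hf J (n := 0) (by omega) hff

lemma sobolevNorm_mono {J J' : ℕ} (h : J ≤ J') (δ : ℝ) (f : Space → ℂ) :
    sobolevNorm J δ f ≤ sobolevNorm J' δ f := by
  refine ENNReal.rpow_le_rpow ?_ (by norm_num)
  exact Finset.sum_le_sum_of_subset (Finset.range_mono (by omega))

/-! ### The spin basis -/

/-- The matrices describing the Cartesian frames. -/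
abbrev Mat : Type := Matrix (Fin 2) (Fin 2) ℂ

/-- The spinors `ι` (for `true`) and `o` (for `false`). -/
def spin (s : Bool) (U : Mat) (θ ϕ : ℝ) : Fin 2 → ℂ :=
  if s then iotaSpinor U θ ϕ else oSpinor U θ ϕ

/-- The phase `e^{iϕ/2}`. -/
def phase (ϕ : ℝ) : ℂ := Complex.exp (Complex.I * (ϕ / 2 : ℝ))

lemma phase_neg (ϕ : ℝ) : phase (-ϕ) = Complex.exp (-(Complex.I * (ϕ / 2 : ℝ))) := by
  rw [phase]
  congr 1
  push_cast
  ring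

lemma phase_mul_phase_neg (ϕ : ℝ) : phase ϕ * phase (-ϕ) = 1 := by
  rw [phase_neg, phase, ← Complex.exp_add, add_neg_cancel, Complex.exp_zero]

lemma conj_phase (ϕ : ℝ) : (starRingEnd ℂ) (phase ϕ) = phase (-ϕ) := by
  rw [phase_neg, phase, ← Complex.exp_conj, map_mul, Complex.conj_I, Complex.conj_ofReal, neg_mul]

lemma oSpinor_apply (U : Mat) (θ ϕ : ℝ) (A : Fin 2) : oSpinor U θ ϕ A =
    U A 0 * (Real.cos (θ / 2) * phase (-ϕ)) + U A 1 * (Real.sin (θ / 2) * phase ϕ) := by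
  rw [phase_neg]
  simp [oSpinor, Matrix.mulVec, dotProduct, phase]

lemma iotaSpinor_apply (U : Mat) (θ ϕ : ℝ) (A : Fin 2) : iotaSpinor U θ ϕ A =
    -(U A 0 * (Real.sin (θ / 2) * phase (-ϕ))) + U A 1 * (Real.cos (θ / 2) * phase ϕ) := by
  rw [phase_neg]
  simp [iotaSpinor, Matrix.mulVec, dotProduct, phase]

/-- Products of sines, cosines and phases with the entries of the frame matrix. -/
inductive Adm : (Mat → ℝ → ℝ → ℂ) → Prop
  | const (z : ℂ) : Adm fun _ _ _ => z
  | entry (A B : Fin 2) : Adm fun U _ _ => U A B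
  | entryConj (A B : Fin 2) : Adm fun U _ _ => (starRingEnd ℂ) (U A B)
  | cosHalf : Adm fun _ θ _ => (Real.cos (θ / 2) : ℂ)
  | sinHalf : Adm fun _ θ _ => (Real.sin (θ / 2) : ℂ)
  | phasePos : Adm fun _ _ ϕ => phase ϕ
  | phaseNeg : Adm fun _ _ ϕ => phase (-ϕ)
  | csc : Adm fun _ θ _ => (Real.sin θ : ℂ)⁻¹
  | add {c d : Mat → ℝ → ℝ → ℂ} : Adm c → Adm d → Adm fun U θ ϕ => c U θ ϕ + d U θ ϕ
  | mul {c d : Mat → ℝ → ℝ → ℂ} : Adm c → Adm d → Adm fun U θ ϕ => c U θ ϕ * d U θ ϕ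

lemma Adm.neg {c : Mat → ℝ → ℝ → ℂ} (h : Adm c) : Adm fun U θ ϕ => -c U θ ϕ := by
  simpa using (Adm.const (-1)).mul h

lemma Adm.sub {c d : Mat → ℝ → ℝ → ℂ} (hc : Adm c) (hd : Adm d) :
    Adm fun U θ ϕ => c U θ ϕ - d U θ ϕ := by
  simpa [sub_eq_add_neg] using hc.add hd.neg

lemma Adm.sum {ι : Type*} (s : Finset ι) {c : ι → Mat → ℝ → ℝ → ℂ} (h : ∀ i, Adm (c i)) :
    Adm fun U θ ϕ => ∑ i ∈ s, c i U θ ϕ := by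
  classical
  induction s using Finset.induction_on with
  | empty => simpa using Adm.const 0
  | insert a s ha ih => simpa [Finset.sum_insert ha] using (h a).add ih

lemma Adm.prod {ι : Type*} (s : Finset ι) {c : ι → Mat → ℝ → ℝ → ℂ} (h : ∀ i, Adm (c i)) :
    Adm fun U θ ϕ => ∏ i ∈ s, c i U θ ϕ := by
  classical
  induction s using Finset.induction_on with
  | empty => simpa using Adm.const 1
  | insert a s ha ih => simpa [Finset.prod_insert ha] using (h a).mul ih

lemma Adm.spin (s : Bool) (A : Fin 2) : Adm fun U θ ϕ => spin s U θ ϕ A := by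
  cases s
  · simp only [SpinDecay.spin, Bool.false_eq_true, if_false, oSpinor_apply]
    exact ((Adm.entry A 0).mul (Adm.cosHalf.mul Adm.phaseNeg)).add
      ((Adm.entry A 1).mul (Adm.sinHalf.mul Adm.phasePos))
  · simp only [SpinDecay.spin, if_true, iotaSpinor_apply]
    exact ((Adm.entry A 0).mul (Adm.sinHalf.mul Adm.phaseNeg)).neg.add
      ((Adm.entry A 1).mul (Adm.cosHalf.mul Adm.phasePos))

lemma Adm.spinConj (s : Bool) (A : Fin 2) :
    Adm fun U θ ϕ => (starRingEnd ℂ) (SpinDecay.spin s U θ ϕ A) := by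
  cases s
  · simp only [SpinDecay.spin, Bool.false_eq_true, if_false, oSpinor_apply, map_add, map_mul,
      conj_phase, Complex.conj_ofReal, neg_neg]
    exact ((Adm.entryConj A 0).mul (Adm.cosHalf.mul Adm.phasePos)).add
      ((Adm.entryConj A 1).mul (Adm.sinHalf.mul Adm.phaseNeg))
  · simp only [SpinDecay.spin, if_true, iotaSpinor_apply, map_add, map_mul, map_neg,
      conj_phase, Complex.conj_ofReal, neg_neg]
    exact ((Adm.entryConj A 0).mul (Adm.sinHalf.mul Adm.phasePos)).neg.add
      ((Adm.entryConj A 1).mul (Adm.cosHalf.mul Adm.phaseNeg))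

lemma Adm.spinVec (s s' : Bool) (μ : Fin 4) :
    Adm fun U θ ϕ => spinVec (SpinDecay.spin s U θ ϕ) (SpinDecay.spin s' U θ ϕ) μ := by
  unfold SpinDecay.spinVec
  exact Adm.sum _ fun A => Adm.sum _ fun A' =>
    ((Adm.spin s A).mul (Adm.spinConj s' A')).mul (Adm.const _)

lemma cos_eq_half (θ : ℝ) : (Real.cos θ : ℂ) =
    Real.cos (θ / 2) * Real.cos (θ / 2) - Real.sin (θ / 2) * Real.sin (θ / 2) := by
  have := Real.cos_add (θ / 2) (θ / 2)
  rw [add_halves] at this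
  rw [this]
  push_cast
  ring

lemma sin_eq_half (θ : ℝ) : (Real.sin θ : ℂ) =
    Real.sin (θ / 2) * Real.cos (θ / 2) + Real.cos (θ / 2) * Real.sin (θ / 2) := by
  have := Real.sin_add (θ / 2) (θ / 2)
  rw [add_halves] at this
  rw [this]
  push_cast
  ring

lemma Adm.cos : Adm fun _ θ _ => (Real.cos θ : ℂ) := by
  rw [funext fun _ => funext fun θ => funext fun _ => cos_eq_half θ]
  exact (Adm.cosHalf.mul Adm.cosHalf).sub (Adm.sinHalf.mul Adm.sinHalf)

lemma Adm.sin : Adm fun _ θ _ => (Real.sin θ : ℂ) := by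
  rw [funext fun _ => funext fun θ => funext fun _ => sin_eq_half θ]
  exact (Adm.sinHalf.mul Adm.cosHalf).add (Adm.cosHalf.mul Adm.sinHalf)

lemma hasDerivAt_cosHalf (θ : ℝ) : HasDerivAt (fun θ : ℝ => (Real.cos (θ / 2) : ℂ))
    (-(1 / 2) * (Real.sin (θ / 2) : ℂ)) θ := by
  have h := (Real.hasDerivAt_cos (θ / 2)).comp θ ((hasDerivAt_id θ).div_const 2)
  refine (h.ofReal_comp).congr_deriv ?_
  push_cast
  ring

lemma hasDerivAt_sinHalf (θ : ℝ) : HasDerivAt (fun θ : ℝ => (Real.sin (θ / 2) : ℂ))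
    (1 / 2 * (Real.cos (θ / 2) : ℂ)) θ := by
  have h := (Real.hasDerivAt_sin (θ / 2)).comp θ ((hasDerivAt_id θ).div_const 2)
  refine (h.ofReal_comp).congr_deriv ?_
  push_cast
  ring

lemma hasDerivAt_phase (ϕ : ℝ) : HasDerivAt phase (Complex.I / 2 * phase ϕ) ϕ := by
  have h1 : HasDerivAt (fun ϕ : ℝ => Complex.I * ((ϕ / 2 : ℝ) : ℂ)) (Complex.I * ((1 / 2 : ℝ) : ℂ)) ϕ :=
    (((hasDerivAt_id ϕ).div_const 2).ofReal_comp).const_mul _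
  refine h1.cexp.congr_deriv ?_
  rw [phase]
  push_cast
  ring

lemma hasDerivAt_phase_neg (ϕ : ℝ) :
    HasDerivAt (fun ϕ => phase (-ϕ)) (-(Complex.I / 2) * phase (-ϕ)) ϕ := by
  have := (hasDerivAt_phase (-ϕ)).scomp ϕ (hasDerivAt_neg ϕ)
  refine this.congr_deriv ?_
  simp

lemma hasDerivAt_csc {θ : ℝ} (h0 : 0 < θ) (hπ : θ < Real.pi) :
    HasDerivAt (fun θ : ℝ => (Real.sin θ : ℂ)⁻¹)
      (-((Real.cos θ : ℂ) * ((Real.sin θ : ℂ)⁻¹ * (Real.sin θ : ℂ)⁻¹))) θ := by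
  have hs := (Real.sin_pos_of_pos_of_lt_pi h0 hπ).ne'
  have h := ((Real.hasDerivAt_sin θ).inv hs).ofReal_comp
  simp only [Pi.inv_apply, Complex.ofReal_inv] at h
  refine h.congr_deriv ?_
  push_cast
  ring

/-- The coefficients form an algebra generated by functions whose angular derivatives stay in the
algebra. Away from the poles the cosecant is the only generator for which this needs θ in (0, π). -/
lemma Adm.exists_deriv {c : Mat → ℝ → ℝ → ℂ} (h : Adm c) : ∃ c₁ c₂, Adm c₁ ∧ Adm c₂ ∧
    ∀ U θ ϕ, 0 < θ → θ < Real.pi → HasDerivAt (fun η => c U η ϕ) (c₁ U θ ϕ) θ ∧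
      HasDerivAt (fun η => c U θ η) (c₂ U θ ϕ) ϕ := by
  induction h with
  | const z => exact ⟨_, _, .const 0, .const 0, fun U θ ϕ _ _ =>
      ⟨hasDerivAt_const _ _, hasDerivAt_const _ _⟩⟩
  | entry A B => exact ⟨_, _, .const 0, .const 0, fun U θ ϕ _ _ =>
      ⟨hasDerivAt_const _ _, hasDerivAt_const _ _⟩⟩
  | entryConj A B => exact ⟨_, _, .const 0, .const 0, fun U θ ϕ _ _ =>
      ⟨hasDerivAt_const _ _, hasDerivAt_const _ _⟩⟩
  | cosHalf => exact ⟨_, _, (Adm.const _).mul .sinHalf, .const 0, fun U θ ϕ _ _ =>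
      ⟨hasDerivAt_cosHalf θ, hasDerivAt_const _ _⟩⟩
  | sinHalf => exact ⟨_, _, (Adm.const _).mul .cosHalf, .const 0, fun U θ ϕ _ _ =>
      ⟨hasDerivAt_sinHalf θ, hasDerivAt_const _ _⟩⟩
  | phasePos => exact ⟨_, _, .const 0, (Adm.const _).mul .phasePos, fun U θ ϕ _ _ =>
      ⟨hasDerivAt_const _ _, hasDerivAt_phase ϕ⟩⟩
  | phaseNeg => exact ⟨_, _, .const 0, (Adm.const _).mul .phaseNeg, fun U θ ϕ _ _ =>
      ⟨hasDerivAt_const _ _, hasDerivAt_phase_neg ϕ⟩⟩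
  | csc => exact ⟨_, _, (Adm.cos.mul (Adm.csc.mul Adm.csc)).neg, .const 0, fun U θ ϕ h0 hπ =>
      ⟨hasDerivAt_csc h0 hπ, hasDerivAt_const _ _⟩⟩
  | add hc hd ihc ihd =>
    obtain ⟨c₁, c₂, a1, a2, hc'⟩ := ihc
    obtain ⟨d₁, d₂, b1, b2, hd'⟩ := ihd
    exact ⟨_, _, a1.add b1, a2.add b2, fun U θ ϕ h0 hπ =>
      ⟨(hc' U θ ϕ h0 hπ).1.fun_add (hd' U θ ϕ h0 hπ).1,
        (hc' U θ ϕ h0 hπ).2.fun_add (hd' U θ ϕ h0 hπ).2⟩⟩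
  | mul hc hd ihc ihd =>
    obtain ⟨c₁, c₂, a1, a2, hc'⟩ := ihc
    obtain ⟨d₁, d₂, b1, b2, hd'⟩ := ihd
    exact ⟨_, _, (a1.mul hd).add (hc.mul b1), (a2.mul hd).add (hc.mul b2), fun U θ ϕ h0 hπ =>
      ⟨(hc' U θ ϕ h0 hπ).1.fun_mul (hd' U θ ϕ h0 hπ).1,
        (hc' U θ ϕ h0 hπ).2.fun_mul (hd' U θ ϕ h0 hπ).2⟩⟩

/-- The frame matrices form `SU(2)`. -/
abbrev SU : Set Mat := {U | U ∈ Matrix.specialUnitaryGroup (Fin 2) ℂ}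

lemma norm_phase (ϕ : ℝ) : ‖phase ϕ‖ = 1 := by
  rw [phase, Complex.norm_exp]
  simp

/-- Entries of unitary matrices have modulus at most 1, which makes the bound independent of the
frame. The distance θ₀ from the poles is needed only for the cosecant. -/
lemma Adm.exists_bound {c : Mat → ℝ → ℝ → ℂ} (h : Adm c) {θ₀ : ℝ} (hθ₀ : 0 < θ₀) :
    ∃ C, 0 ≤ C ∧ ∀ U ∈ SU, ∀ θ ϕ, θ₀ ≤ θ → θ ≤ Real.pi - θ₀ → ‖c U θ ϕ‖ ≤ C := by
  have hU : ∀ U ∈ SU, ∀ A B, ‖U A B‖ ≤ 1 := fun U hU A B =>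
    entry_norm_bound_of_unitary (Matrix.mem_specialUnitaryGroup_iff.1 hU).1 A B
  induction h with
  | const z => exact ⟨‖z‖, norm_nonneg _, fun _ _ _ _ _ _ => le_rfl⟩
  | entry A B => exact ⟨1, zero_le_one, fun U h _ _ _ _ => hU U h A B⟩
  | entryConj A B => exact ⟨1, zero_le_one, fun U h _ _ _ _ => by simpa using hU U h A B⟩
  | cosHalf => exact ⟨1, zero_le_one, fun U h θ _ _ _ => by
      rw [Complex.norm_real]; exact Real.abs_cos_le_one _⟩
  | sinHalf => exact ⟨1, zero_le_one, fun U h θ _ _ _ => by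
      rw [Complex.norm_real]; exact Real.abs_sin_le_one _⟩
  | phasePos => exact ⟨1, zero_le_one, fun U h θ ϕ _ _ => (norm_phase ϕ).le⟩
  | phaseNeg => exact ⟨1, zero_le_one, fun U h θ ϕ _ _ => (norm_phase (-ϕ)).le⟩
  | csc =>
    have hc : ContinuousOn (fun θ : ℝ => (Real.sin θ : ℂ)⁻¹) (Set.Icc θ₀ (Real.pi - θ₀)) := by
      intro θ hθ
      exact (hasDerivAt_csc (hθ₀.trans_le hθ.1)
        (by linarith [hθ.2])).continuousAt.continuousWithinAt
    obtain ⟨C, hC⟩ := isCompact_Icc.exists_bound_of_continuousOn hc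
    exact ⟨|C|, abs_nonneg _, fun U _ θ _ h1 h2 => (hC θ ⟨h1, h2⟩).trans (le_abs_self _)⟩
  | add hc hd ihc ihd =>
    obtain ⟨C, hC, hc'⟩ := ihc
    obtain ⟨D, hD, hd'⟩ := ihd
    exact ⟨C + D, by positivity, fun U h θ ϕ h1 h2 => (norm_add_le _ _).trans
      (add_le_add (hc' U h θ ϕ h1 h2) (hd' U h θ ϕ h1 h2))⟩
  | mul hc hd ihc ihd =>
    obtain ⟨C, hC, hc'⟩ := ihc
    obtain ⟨D, hD, hd'⟩ := ihd
    exact ⟨C * D, by positivity, fun U h θ ϕ h1 h2 => (norm_mul_le _ _).trans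
      (mul_le_mul (hc' U h θ ϕ h1 h2) (hd' U h θ ϕ h1 h2) (norm_nonneg _) hC)⟩

/-- The `θ`-derivative of the spin basis. -/
lemma hasDerivAt_spin_theta (s : Bool) (U : Mat) (θ ϕ : ℝ) (A : Fin 2) :
    HasDerivAt (fun η => spin s U η ϕ A)
      ((if s then -(1 / 2) else 1 / 2) * spin (!s) U θ ϕ A) θ := by
  have hc := hasDerivAt_cosHalf θ
  have hs := hasDerivAt_sinHalf θ
  cases s
  · simp only [spin, Bool.false_eq_true, if_false, Bool.not_false, if_true, oSpinor_apply,
      iotaSpinor_apply]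
    refine (((hc.mul_const (phase (-ϕ))).const_mul (U A 0)).fun_add
      ((hs.mul_const (phase ϕ)).const_mul (U A 1))).congr_deriv ?_
    ring
  · simp only [spin, Bool.not_true, Bool.false_eq_true, if_false, if_true, oSpinor_apply,
      iotaSpinor_apply]
    refine (((hs.mul_const (phase (-ϕ))).const_mul (U A 0)).fun_neg.fun_add
      ((hc.mul_const (phase ϕ)).const_mul (U A 1))).congr_deriv ?_
    ring

/-- The `ϕ`-derivative of the spin basis. -/
lemma hasDerivAt_spin_phi (s : Bool) (U : Mat) (θ ϕ : ℝ) (A : Fin 2) :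
    HasDerivAt (fun η => spin s U θ η A)
      (Complex.I / 2 * ((if s then 1 else -1) * Real.cos θ * spin s U θ ϕ A +
        Real.sin θ * spin (!s) U θ ϕ A)) ϕ := by
  have hp := hasDerivAt_phase ϕ
  have hn := hasDerivAt_phase_neg ϕ
  have h1 : (Real.cos (θ / 2) : ℂ) ^ 2 + (Real.sin (θ / 2) : ℂ) ^ 2 = 1 := by
    exact_mod_cast Real.cos_sq_add_sin_sq (θ / 2)
  rw [cos_eq_half θ, sin_eq_half θ]
  cases s
  · simp only [spin, Bool.false_eq_true, if_false, Bool.not_false, if_true, oSpinor_apply,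
      iotaSpinor_apply]
    refine (((hn.const_mul _).const_mul (U A 0)).fun_add
      ((hp.const_mul _).const_mul (U A 1))).congr_deriv ?_
    linear_combination (Complex.I / 2 * (U A 0 * Real.cos (θ / 2) * phase (-ϕ) -
      U A 1 * Real.sin (θ / 2) * phase ϕ)) * h1
  · simp only [spin, Bool.not_true, Bool.false_eq_true, if_false, if_true, oSpinor_apply,
      iotaSpinor_apply]
    refine (((hn.const_mul _).const_mul (U A 0)).fun_neg.fun_add
      ((hp.const_mul _).const_mul (U A 1))).congr_deriv ?_
    linear_combination (-(Complex.I / 2) * (U A 0 * Real.sin (θ / 2) * phase (-ϕ) +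
      U A 1 * Real.cos (θ / 2) * phase ϕ)) * h1

/-- The spin basis is orthonormal. -/
lemma spin_orthonormal {U : Mat} (hU : U ∈ SU) (s s' : Bool) (θ ϕ : ℝ) :
    ∑ A, spin s U θ ϕ A * (starRingEnd ℂ) (spin s' U θ ϕ A) = if s = s' then 1 else 0 := by
  have hu : star U * U = 1 := (Matrix.mem_unitaryGroup_iff'.1 (Matrix.mem_specialUnitaryGroup_iff.1 hU).1)
  have e : ∀ i j, ∑ A, (starRingEnd ℂ) (U A i) * U A j = if i = j then 1 else 0 := by
    intro i j
    have := congrFun (congrFun hu i) j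
    simpa [Matrix.mul_apply, Matrix.star_apply, Matrix.one_apply] using this
  have h1 : (Real.cos (θ / 2) : ℂ) ^ 2 + (Real.sin (θ / 2) : ℂ) ^ 2 = 1 := by
    exact_mod_cast Real.cos_sq_add_sin_sq (θ / 2)
  have hp := phase_mul_phase_neg ϕ
  have e00 := e 0 0
  have e01 := e 0 1
  have e10 := e 1 0
  have e11 := e 1 1
  simp only [Fin.sum_univ_two, if_true, Fin.zero_eq_one_iff, Fin.one_eq_zero_iff,
    OfNat.ofNat_ne_one, if_false] at e00 e01 e10 e11
  set c : ℂ := (Real.cos (θ / 2) : ℂ)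
  set d : ℂ := (Real.sin (θ / 2) : ℂ)
  cases s <;> cases s' <;>
    simp only [spin, Bool.false_eq_true, if_false, if_true, oSpinor_apply, iotaSpinor_apply,
      Fin.sum_univ_two, map_add, map_neg, map_mul, conj_phase, Complex.conj_ofReal, neg_neg,
      Bool.true_eq_false]
  · linear_combination (c ^ 2 * phase ϕ * phase (-ϕ)) * e00 + (d ^ 2 * phase ϕ * phase (-ϕ)) * e11 +
      c * d * phase ϕ ^ 2 * e01 + c * d * phase (-ϕ) ^ 2 * e10 + phase ϕ * phase (-ϕ) * h1 + hp
  · linear_combination (-c * d * phase ϕ * phase (-ϕ)) * e00 + (c * d * phase ϕ * phase (-ϕ)) * e11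
      - d ^ 2 * phase ϕ ^ 2 * e01 + c ^ 2 * phase (-ϕ) ^ 2 * e10
  · linear_combination (-c * d * phase ϕ * phase (-ϕ)) * e00 + (c * d * phase ϕ * phase (-ϕ)) * e11
      + c ^ 2 * phase ϕ ^ 2 * e01 - d ^ 2 * phase (-ϕ) ^ 2 * e10
  · linear_combination (d ^ 2 * phase ϕ * phase (-ϕ)) * e00 + (c ^ 2 * phase ϕ * phase (-ϕ)) * e11 -
      c * d * phase ϕ ^ 2 * e01 - c * d * phase (-ϕ) ^ 2 * e10 + phase ϕ * phase (-ϕ) * h1 + hp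

/-- The spin basis is complete. -/
lemma spin_complete {U : Mat} (hU : U ∈ SU) (θ ϕ : ℝ) (A B : Fin 2) :
    ∑ s, spin s U θ ϕ A * (starRingEnd ℂ) (spin s U θ ϕ B) = if A = B then 1 else 0 := by
  have hu : U * star U = 1 := (Matrix.mem_unitaryGroup_iff.1 (Matrix.mem_specialUnitaryGroup_iff.1 hU).1)
  have e : ∑ i, U A i * (starRingEnd ℂ) (U B i) = if A = B then 1 else 0 := by
    have := congrFun (congrFun hu A) B
    simpa [Matrix.mul_apply, Matrix.star_apply, Matrix.one_apply] using this
  have h1 : (Real.cos (θ / 2) : ℂ) ^ 2 + (Real.sin (θ / 2) : ℂ) ^ 2 = 1 := by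
    exact_mod_cast Real.cos_sq_add_sin_sq (θ / 2)
  have hp := phase_mul_phase_neg ϕ
  rw [← e]
  simp only [Fintype.sum_bool, spin, Bool.false_eq_true, if_false, if_true, oSpinor_apply,
    iotaSpinor_apply, Fin.sum_univ_two, map_add, map_neg, map_mul, conj_phase,
    Complex.conj_ofReal, neg_neg]
  linear_combination (U A 0 * (starRingEnd ℂ) (U B 0) + U A 1 * (starRingEnd ℂ) (U B 1)) *
    (phase ϕ * phase (-ϕ) * h1 + hp)

/-! ### The null tetrad -/

lemma infeld_symm (A A' : Fin 2) (μ : Fin 4) :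
    (starRingEnd ℂ) (infeld A A' μ) = infeld A' A μ := by
  fin_cases A <;> fin_cases A' <;> fin_cases μ <;> simp [infeld]

lemma conj_spinVec (κ lam : Fin 2 → ℂ) (μ : Fin 4) :
    (starRingEnd ℂ) (spinVec κ lam μ) = spinVec lam κ μ := by
  simp only [spinVec, map_sum, map_mul, Complex.conj_conj, infeld_symm]
  rw [Finset.sum_comm]
  refine Finset.sum_congr rfl fun A _ => Finset.sum_congr rfl fun A' _ => ?_
  ring

lemma infeld_zero (A A' : Fin 2) : infeld A A' 0 = if A = A' then 1 / (Real.sqrt 2 : ℂ) else 0 := by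
  fin_cases A <;> fin_cases A' <;> simp [infeld]

lemma infeld_trace (i : Fin 3) : infeld 0 0 i.succ + infeld 1 1 i.succ = 0 := by
  fin_cases i <;> simp [infeld]

lemma spinVec_zero {U : Mat} (hU : U ∈ SU) (s s' : Bool) (θ ϕ : ℝ) :
    spinVec (spin s U θ ϕ) (spin s' U θ ϕ) 0 = if s = s' then 1 / (Real.sqrt 2 : ℂ) else 0 := by
  have := spin_orthonormal hU s s' θ ϕ
  have h2 : spinVec (spin s U θ ϕ) (spin s' U θ ϕ) 0 = 1 / (Real.sqrt 2 : ℂ) *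
      ∑ A, spin s U θ ϕ A * (starRingEnd ℂ) (spin s' U θ ϕ A) := by
    simp only [spinVec, infeld_zero, Fin.sum_univ_two]
    simp
    ring
  rw [h2, this]
  split_ifs <;> simp

/-- By completeness of the spin basis l + n corresponds to the identity matrix, which is paired to
zero with the spatial symbols because these are trace-free. -/
lemma spinVec_iota {U : Mat} (hU : U ∈ SU) (θ ϕ : ℝ) (i : Fin 3) :
    spinVec (spin true U θ ϕ) (spin true U θ ϕ) i.succ =
      -spinVec (spin false U θ ϕ) (spin false U θ ϕ) i.succ := by
  have h := spin_complete hU θ ϕ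
  have h00 := h 0 0
  have h01 := h 0 1
  have h10 := h 1 0
  have h11 := h 1 1
  have ht := infeld_trace i
  simp only [Fintype.sum_bool, if_true, Fin.zero_eq_one_iff, Fin.one_eq_zero_iff,
    OfNat.ofNat_ne_one, if_false] at h00 h01 h10 h11
  simp only [spinVec, Fin.sum_univ_two]
  linear_combination infeld 0 0 i.succ * h00 + infeld 0 1 i.succ * h01 +
    infeld 1 0 i.succ * h10 + infeld 1 1 i.succ * h11 + ht

/-- The components of the unit radial vector. -/
def rad (U : Mat) (i : Fin 3) (θ ϕ : ℝ) : ℝ :=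
  Real.sqrt 2 * (spinVec (spin false U θ ϕ) (spin false U θ ϕ) i.succ).re

/-- The components of the `θ`-derivative of the unit radial vector. -/
def radTheta (U : Mat) (i : Fin 3) (θ ϕ : ℝ) : ℝ :=
  Real.sqrt 2 * (spinVec (spin false U θ ϕ) (spin true U θ ϕ) i.succ).re

/-- The components of the `ϕ`-derivative of the unit radial vector. -/
def radPhi (U : Mat) (i : Fin 3) (θ ϕ : ℝ) : ℝ :=
  Real.sqrt 2 * (Real.sin θ * (spinVec (spin false U θ ϕ) (spin true U θ ϕ) i.succ).im)

lemma sphPoint_apply (U : Mat) (r θ ϕ : ℝ) (i : Fin 3) :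
    sphPoint U r θ ϕ i = r * rad U i θ ϕ := rfl

lemma spinVec_self_re (κ : Fin 2 → ℂ) (μ : Fin 4) : ((spinVec κ κ μ).re : ℂ) = spinVec κ κ μ :=
  Complex.conj_eq_iff_re.1 (conj_spinVec κ κ μ)

lemma coe_rad (U : Mat) (i : Fin 3) (θ ϕ : ℝ) :
    (rad U i θ ϕ : ℂ) = Real.sqrt 2 * spinVec (spin false U θ ϕ) (spin false U θ ϕ) i.succ := by
  rw [rad, Complex.ofReal_mul, spinVec_self_re]

lemma coe_radTheta (U : Mat) (i : Fin 3) (θ ϕ : ℝ) :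
    (radTheta U i θ ϕ : ℂ) = Real.sqrt 2 / 2 *
      (spinVec (spin false U θ ϕ) (spin true U θ ϕ) i.succ +
        spinVec (spin true U θ ϕ) (spin false U θ ϕ) i.succ) := by
  rw [radTheta, ← conj_spinVec (spin false U θ ϕ) (spin true U θ ϕ), Complex.ofReal_mul,
    Complex.re_eq_add_conj]
  ring

lemma coe_radPhi (U : Mat) (i : Fin 3) (θ ϕ : ℝ) :
    (radPhi U i θ ϕ : ℂ) = Real.sqrt 2 / 2 * Complex.I * Real.sin θ *
      (spinVec (spin true U θ ϕ) (spin false U θ ϕ) i.succ -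
        spinVec (spin false U θ ϕ) (spin true U θ ϕ) i.succ) := by
  rw [radPhi, ← conj_spinVec (spin false U θ ϕ) (spin true U θ ϕ), Complex.ofReal_mul,
    Complex.ofReal_mul, Complex.im_eq_sub_conj]
  field_simp
  rw [Complex.I_sq]
  ring

lemma Adm.rad (i : Fin 3) : Adm fun U θ ϕ => (rad U i θ ϕ : ℂ) := by
  simp only [coe_rad]
  exact (Adm.const _).mul (Adm.spinVec _ _ _)

lemma Adm.radTheta (i : Fin 3) : Adm fun U θ ϕ => (radTheta U i θ ϕ : ℂ) := by
  simp only [coe_radTheta]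
  exact (Adm.const _).mul ((Adm.spinVec _ _ _).add (Adm.spinVec _ _ _))

lemma Adm.radPhi (i : Fin 3) : Adm fun U θ ϕ => (radPhi U i θ ϕ : ℂ) := by
  simp only [coe_radPhi]
  exact ((Adm.const _).mul Adm.sin).mul ((Adm.spinVec _ _ _).sub (Adm.spinVec _ _ _))

lemma sum_rad_sq {U : Mat} (hU : U ∈ SU) (θ ϕ : ℝ) : ∑ i, rad U i θ ϕ ^ 2 = 1 := by
  have h := spin_orthonormal hU false false θ ϕ
  have hs : (Real.sqrt 2 : ℂ) ^ 2 = 2 := by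
    rw [← Complex.ofReal_pow, Real.sq_sqrt (by norm_num)]
    norm_num
  have hs0 : (Real.sqrt 2 : ℂ) ≠ 0 := by
    intro h0
    rw [h0] at hs
    norm_num at hs
  have : ((∑ i, rad U i θ ϕ ^ 2 : ℝ) : ℂ) = 1 := by
    push_cast
    simp only [coe_rad, Fin.sum_univ_three, spinVec, Fin.sum_univ_two, infeld] at h ⊢
    set a := spin false U θ ϕ 0
    set b := spin false U θ ϕ 1
    simp at h ⊢
    field_simp
    linear_combination (a * (starRingEnd ℂ) a + b * (starRingEnd ℂ) b + 1) * h +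
      (a * (starRingEnd ℂ) b - b * (starRingEnd ℂ) a) ^ 2 * Complex.I_sq
  exact_mod_cast this

lemma hasDerivAt_spinVec {κ lam : ℝ → Fin 2 → ℂ} {κ' lam' : Fin 2 → ℂ} {η : ℝ}
    (hκ : ∀ A, HasDerivAt (fun η => κ η A) (κ' A) η)
    (hl : ∀ A, HasDerivAt (fun η => lam η A) (lam' A) η) (μ : Fin 4) :
    HasDerivAt (fun η => spinVec (κ η) (lam η) μ)
      (spinVec κ' (lam η) μ + spinVec (κ η) lam' μ) η := by
  unfold spinVec
  rw [← Finset.sum_add_distrib]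
  refine HasDerivAt.fun_sum fun A _ => ?_
  rw [← Finset.sum_add_distrib]
  refine HasDerivAt.fun_sum fun A' _ => ?_
  have hc : HasDerivAt (fun η => (starRingEnd ℂ) (lam η A')) ((starRingEnd ℂ) (lam' A')) η :=
    (hl A').star
  exact (((hκ A).fun_mul hc).mul_const _).congr_deriv (by ring)

lemma hasDerivAt_re {f : ℝ → ℂ} {f' : ℂ} {η : ℝ} (h : HasDerivAt f f' η) :
    HasDerivAt (fun η => (f η).re) f'.re η :=
  (Complex.reCLM.hasFDerivAt (x := f η)).comp_hasDerivAt η h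

lemma spinVec_false_true_conj (U : Mat) (θ ϕ : ℝ) (μ : Fin 4) :
    spinVec (spin true U θ ϕ) (spin false U θ ϕ) μ =
      (starRingEnd ℂ) (spinVec (spin false U θ ϕ) (spin true U θ ϕ) μ) :=
  (conj_spinVec _ _ _).symm

lemma hasDerivAt_rad_theta (U : Mat) (i : Fin 3) (θ ϕ : ℝ) :
    HasDerivAt (fun η => rad U i η ϕ) (radTheta U i θ ϕ) θ := by
  have h := hasDerivAt_spinVec (fun A => hasDerivAt_spin_theta false U θ ϕ A)
    (fun A => hasDerivAt_spin_theta false U θ ϕ A) i.succ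
  refine ((hasDerivAt_re h).const_mul (Real.sqrt 2)).congr_deriv ?_
  rw [radTheta]
  congr 1
  have e : spinVec (fun A => (if false = true then -(1 / 2) else 1 / 2) * spin (!false) U θ ϕ A)
        (spin false U θ ϕ) i.succ + spinVec (spin false U θ ϕ)
        (fun A => (if false = true then -(1 / 2) else 1 / 2) * spin (!false) U θ ϕ A) i.succ =
      1 / 2 * (spinVec (spin true U θ ϕ) (spin false U θ ϕ) i.succ +
        spinVec (spin false U θ ϕ) (spin true U θ ϕ) i.succ) := by
    have h2 : (starRingEnd ℂ) (1 / 2) = (1 / 2 : ℂ) := by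
      simpa using Complex.conj_ofReal (1 / 2)
    simp only [spinVec, Fin.sum_univ_two, Bool.false_eq_true, if_false, Bool.not_false, map_mul, h2]
    ring
  rw [e, spinVec_false_true_conj, add_comm, Complex.add_conj]
  push_cast
  rw [← mul_assoc]
  norm_num

lemma hasDerivAt_rad_phi (U : Mat) (i : Fin 3) (θ ϕ : ℝ) :
    HasDerivAt (fun η => rad U i θ η) (radPhi U i θ ϕ) ϕ := by
  have h := hasDerivAt_spinVec (fun A => hasDerivAt_spin_phi false U θ ϕ A)
    (fun A => hasDerivAt_spin_phi false U θ ϕ A) i.succ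
  refine ((hasDerivAt_re h).const_mul (Real.sqrt 2)).congr_deriv ?_
  rw [radPhi]
  congr 1
  set κ : Fin 2 → ℂ := fun A => Complex.I / 2 * ((if false = true then 1 else -1) * Real.cos θ *
    spin false U θ ϕ A + Real.sin θ * spin (!false) U θ ϕ A) with hκ
  have e : spinVec κ (spin false U θ ϕ) i.succ + spinVec (spin false U θ ϕ) κ i.succ =
      -(Complex.I / 2 * Real.sin θ * (spinVec (spin false U θ ϕ) (spin true U θ ϕ) i.succ -
        spinVec (spin true U θ ϕ) (spin false U θ ϕ) i.succ)) := by
    have h2 : (starRingEnd ℂ) (Complex.I / 2) = -(Complex.I / 2) := by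
      rw [map_div₀, Complex.conj_I, show (starRingEnd ℂ) 2 = 2 from Complex.conj_ofReal 2, neg_div]
    simp only [hκ, spinVec, Fin.sum_univ_two, Bool.false_eq_true, if_false, Bool.not_false, map_mul,
      map_add, map_neg, map_one, h2, Complex.conj_ofReal]
    ring
  rw [e, spinVec_false_true_conj, Complex.sub_conj]
  have : -(Complex.I / 2 * Real.sin θ * (((2 * (spinVec (spin false U θ ϕ) (spin true U θ ϕ)
      i.succ).im : ℝ) : ℂ) * Complex.I)) =
      ((Real.sin θ * (spinVec (spin false U θ ϕ) (spin true U θ ϕ) i.succ).im : ℝ) : ℂ) := by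
    simp only [Complex.ofReal_mul, Complex.ofReal_ofNat]
    linear_combination (-(Real.sin θ : ℂ) *
      (spinVec (spin false U θ ϕ) (spin true U θ ϕ) i.succ).im) * Complex.I_sq
  rw [this, Complex.ofReal_re]

/-- Differentiate Σ ω_i² = 1. -/
lemma sum_rad_mul_radTheta {U : Mat} (hU : U ∈ SU) (θ ϕ : ℝ) :
    ∑ i, rad U i θ ϕ * radTheta U i θ ϕ = 0 := by
  have h : HasDerivAt (fun η => ∑ i, rad U i η ϕ ^ 2)
      (∑ i, ((2 : ℕ) : ℝ) * rad U i θ ϕ ^ (2 - 1) * radTheta U i θ ϕ) θ :=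
    HasDerivAt.fun_sum fun i _ => (hasDerivAt_rad_theta U i θ ϕ).fun_pow 2
  simp only [sum_rad_sq hU] at h
  have := h.unique (hasDerivAt_const _ _)
  simp only [Fin.sum_univ_three] at this ⊢
  push_cast at this
  linarith

lemma sum_rad_mul_radPhi {U : Mat} (hU : U ∈ SU) (θ ϕ : ℝ) :
    ∑ i, rad U i θ ϕ * radPhi U i θ ϕ = 0 := by
  have h : HasDerivAt (fun η => ∑ i, rad U i θ η ^ 2)
      (∑ i, ((2 : ℕ) : ℝ) * rad U i θ ϕ ^ (2 - 1) * radPhi U i θ ϕ) ϕ :=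
    HasDerivAt.fun_sum fun i _ => (hasDerivAt_rad_phi U i θ ϕ).fun_pow 2
  simp only [sum_rad_sq hU] at h
  have := h.unique (hasDerivAt_const _ _)
  simp only [Fin.sum_univ_three] at this ⊢
  push_cast at this
  linarith

lemma norm_sphPoint {U : Mat} (hU : U ∈ SU) {r : ℝ} (hr : 0 ≤ r) (θ ϕ : ℝ) :
    ‖sphPoint U r θ ϕ‖ = r := by
  rw [EuclideanSpace.norm_eq]
  simp only [sphPoint_apply, Real.norm_eq_abs, sq_abs, mul_pow]
  rw [← Finset.mul_sum, sum_rad_sq hU, mul_one, Real.sqrt_sq hr]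

/-! ### Derivatives in spherical coordinates -/

lemma hasDerivAt_comp_space {F : Mink → ℂ} {t : ℝ} {X : ℝ → Space} {a : Fin 3 → ℝ} {η : ℝ}
    (hF : DifferentiableAt ℝ F (t, X η)) (hX : ∀ i, HasDerivAt (fun η => X η i) (a i) η) :
    HasDerivAt (fun η => F (t, X η)) (∑ i, a i • pd i.succ F (t, X η)) η := by
  have h1 : HasDerivAt X (WithLp.toLp 2 a) η := by
    have := (PiLp.continuousLinearEquiv 2 ℝ fun _ : Fin 3 => ℝ).symm.hasFDerivAt.comp_hasDerivAt η
      (hasDerivAt_pi.2 hX)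
    exact this
  have h2 : HasDerivAt (fun η => (t, X η)) ((0 : ℝ), (WithLp.toLp 2 a : Space)) η :=
    (hasDerivAt_const η t).prodMk h1
  have h3 := hF.hasFDerivAt.comp_hasDerivAt η h2
  rw [fderiv_eq_sum_pd] at h3
  refine HasDerivAt.congr_deriv (f := fun η => F (t, X η)) h3 ?_
  simp

lemma hasDerivAt_sph_t {F : Mink → ℂ} {t : ℝ} {X : Space} (hF : DifferentiableAt ℝ F (t, X)) :
    HasDerivAt (fun τ => F (τ, X)) (pd 0 F (t, X)) t := by
  have h2 : HasDerivAt (fun τ : ℝ => (τ, X)) ((1 : ℝ), (0 : Space)) t :=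
    (hasDerivAt_id t).prodMk (hasDerivAt_const t X)
  exact hF.hasFDerivAt.comp_hasDerivAt t h2

lemma hasDerivAt_sph_r {F : Mink → ℂ} {U : Mat} {t r θ ϕ : ℝ}
    (hF : DifferentiableAt ℝ F (t, sphPoint U r θ ϕ)) :
    HasDerivAt (fun ρ => F (t, sphPoint U ρ θ ϕ))
      (∑ i, rad U i θ ϕ • pd i.succ F (t, sphPoint U r θ ϕ)) r :=
  hasDerivAt_comp_space hF fun i => by
    simpa [sphPoint_apply] using (hasDerivAt_id r).mul_const (rad U i θ ϕ)

lemma hasDerivAt_sph_theta {F : Mink → ℂ} {U : Mat} {t r θ ϕ : ℝ}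
    (hF : DifferentiableAt ℝ F (t, sphPoint U r θ ϕ)) :
    HasDerivAt (fun η => F (t, sphPoint U r η ϕ))
      (∑ i, (r * radTheta U i θ ϕ) • pd i.succ F (t, sphPoint U r θ ϕ)) θ :=
  hasDerivAt_comp_space hF fun i => (hasDerivAt_rad_theta U i θ ϕ).const_mul r

lemma hasDerivAt_sph_phi {F : Mink → ℂ} {U : Mat} {t r θ ϕ : ℝ}
    (hF : DifferentiableAt ℝ F (t, sphPoint U r θ ϕ)) :
    HasDerivAt (fun η => F (t, sphPoint U r θ η))
      (∑ i, (r * radPhi U i θ ϕ) • pd i.succ F (t, sphPoint U r θ ϕ)) ϕ :=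
  hasDerivAt_comp_space hF fun i => (hasDerivAt_rad_phi U i θ ϕ).const_mul r

/-! ### Operators in spherical coordinates -/

/-- Operators from functions on Minkowski space to functions of the spherical coordinates. -/
abbrev Op : Type := (Mink → ℂ) → Mat → CoordFun

/-- The action of a word in the vector fields. -/
def wact (w : List Gen) (χ : Mink → ℂ) : Mink → ℂ := w.foldr Gen.act χ

/-- The number of translations in a word. -/
def wwt (w : List Gen) : ℕ := (w.map Gen.wt).sum

lemma wact_cons (γ : Gen) (w : List Gen) (χ : Mink → ℂ) : wact (γ :: w) χ = γ.act (wact w χ) := rfl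

lemma wwt_cons (γ : Gen) (w : List Gen) : wwt (γ :: w) = γ.wt + wwt w := by
  simp [wwt]

lemma contDiff_act {n : ℕ} {F : Mink → ℂ} (hF : ContDiff ℝ (n + 1 : ℕ) F) (γ : Gen) :
    ContDiff ℝ n (γ.act F) := by
  have h : ∀ μ, ContDiff ℝ n (pd μ F) := fun μ => contDiff_pd hF μ
  cases γ with
  | d μ => exact h μ
  | S =>
    have h0 := h 0
    have hi := fun i : Fin 3 => h i.succ
    unfold Gen.act
    fun_prop
  | L i =>
    have h0 := h 0
    have hi := h i.succ
    unfold Gen.act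
    fun_prop
  | R i j =>
    have h0 := h i.succ
    have hi := h j.succ
    unfold Gen.act
    fun_prop

lemma contDiff_wact {n : ℕ} {F : Mink → ℂ} (w : List Gen) (hF : ContDiff ℝ (n + w.length : ℕ) F) :
    ContDiff ℝ n (wact w F) := by
  induction w generalizing n with
  | nil => exact hF
  | cons γ w ih =>
    refine contDiff_act (ih ?_) γ
    rw [List.length_cons] at hF
    exact hF.of_le (by norm_cast; omega)

/-- The basic operators. -/
def term (c : Mat → ℝ → ℝ → ℂ) (p a : ℕ) (w : List Gen) : Op := fun χ U t r θ ϕ =>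
  c U θ ϕ * (((r⁻¹) ^ p * ((t + r)⁻¹) ^ a : ℝ) : ℂ) * wact w χ (t, sphPoint U r θ ϕ)

/-- The region where the spherical coordinates are regular and `t` is positive. -/
structure Reg (U : Mat) (t r θ : ℝ) : Prop where
  su : U ∈ SU
  t_pos : 0 < t
  r_pos : 0 < r
  θ_pos : 0 < θ
  θ_lt : θ < Real.pi

/-- The operators of order `n` which lose at most `b` powers of `⟨u⟩`. -/
inductive Cl (n b : ℕ) : Op → Prop
  | term {c : Mat → ℝ → ℝ → ℂ} (hc : Adm c) (p a : ℕ) (w : List Gen)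
      (hn : p + a + wwt w = n) (hb : wwt w ≤ b) (hw : w.length ≤ n) : Cl n b (term c p a w)
  | add {O O' : Op} : Cl n b O → Cl n b O' →
      Cl n b fun χ U t r θ ϕ => O χ U t r θ ϕ + O' χ U t r θ ϕ
  | congr {O O' : Op} : Cl n b O → (∀ χ : Mink → ℂ, ContDiff ℝ n χ →
      ∀ U t r θ ϕ, Reg U t r θ → O' χ U t r θ ϕ = O χ U t r θ ϕ) → Cl n b O'

lemma Cl.mono {n b b' : ℕ} {O : Op} (h : Cl n b O) (hb : b ≤ b') : Cl n b' O := by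
  induction h with
  | term hc p a w hn hbw hw => exact .term hc p a w hn (hbw.trans hb) hw
  | add _ _ ih ih' => exact ih.add ih'
  | congr _ he ih => exact ih.congr he

lemma Cl.coef_mul {n b : ℕ} {O : Op} (h : Cl n b O) {c : Mat → ℝ → ℝ → ℂ} (hc : Adm c) :
    Cl n b fun χ U t r θ ϕ => c U θ ϕ * O χ U t r θ ϕ := by
  induction h with
  | term hd p a w hn hb hw =>
    refine (Cl.term (hc.mul hd) p a w hn hb hw).congr fun χ _ U t r θ ϕ _ => ?_
    simp only [SpinDecay.term]
    ring
  | add _ _ ih ih' =>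
    refine (ih.add ih').congr fun χ _ U t r θ ϕ _ => ?_
    ring
  | congr _ he ih =>
    exact ih.congr fun χ hχ U t r θ ϕ hr => by rw [he χ hχ U t r θ ϕ hr]

lemma Cl.zero (n b : ℕ) : Cl n b fun _ _ _ _ _ _ => 0 := by
  refine (Cl.term (.const 0) n 0 [] (by simp [wwt]) (by simp [wwt]) (by simp)).congr
    fun χ _ U t r θ ϕ _ => ?_
  simp [SpinDecay.term]

lemma Cl.sum {ι : Type*} (s : Finset ι) {n b : ℕ} {O : ι → Op} (h : ∀ i, Cl n b (O i)) :
    Cl n b fun χ U t r θ ϕ => ∑ i ∈ s, O i χ U t r θ ϕ := by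
  classical
  induction s using Finset.induction_on with
  | empty => simpa using Cl.zero n b
  | insert a s ha ih => simpa [Finset.sum_insert ha] using (h a).add ih

/-- S = t∂_t + r∂_r and Σ ω_i L_i = t∂_r + r∂_t add up to (t+r)(∂_t + ∂_r). This exchange of a
translation for weight-zero fields is the gain of a power of ⟨v⟩ by D. -/
lemma radial_identity {F : Mink → ℂ} {U : Mat} {t r θ : ℝ} (ϕ : ℝ) (h : Reg U t r θ) :
    pd 0 F (t, sphPoint U r θ ϕ) + ∑ i, rad U i θ ϕ • pd i.succ F (t, sphPoint U r θ ϕ) =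
      (((t + r)⁻¹ : ℝ) : ℂ) * (Gen.act .S F (t, sphPoint U r θ ϕ) +
        ∑ i, rad U i θ ϕ • Gen.act (.L i) F (t, sphPoint U r θ ϕ)) := by
  have hv : ((t : ℂ) + r) ≠ 0 := by
    have := add_pos h.t_pos h.r_pos
    exact_mod_cast this.ne'
  have hs : (rad U 0 θ ϕ : ℂ) ^ 2 + (rad U 1 θ ϕ : ℂ) ^ 2 + (rad U 2 θ ϕ : ℂ) ^ 2 = 1 := by
    have := sum_rad_sq h.su θ ϕ
    rw [Fin.sum_univ_three] at this
    exact_mod_cast this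
  simp only [Gen.act, sphPoint_apply, Fin.sum_univ_three, Complex.real_smul]
  push_cast
  field_simp
  linear_combination (-(r : ℂ) * pd 0 F (t, sphPoint U r θ ϕ)) * hs

/-- With x = rω, Σ ω_i τ_j R_ij = r(|ω|² τ·∂ - (ω·τ) ω·∂), and the last term vanishes for tangential
τ. -/
lemma tangential_identity {F : Mink → ℂ} {U : Mat} {t r θ : ℝ} (ϕ : ℝ) (h : Reg U t r θ)
    {τ : Fin 3 → ℝ} (hτ : ∑ i, rad U i θ ϕ * τ i = 0) :
    ∑ i, τ i • pd i.succ F (t, sphPoint U r θ ϕ) =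
      ((r⁻¹ : ℝ) : ℂ) * ∑ i, ∑ j, (rad U i θ ϕ * τ j) •
        Gen.act (.R i j) F (t, sphPoint U r θ ϕ) := by
  have hr : (r : ℂ) ≠ 0 := by exact_mod_cast h.r_pos.ne'
  have hs : (rad U 0 θ ϕ : ℂ) ^ 2 + (rad U 1 θ ϕ : ℂ) ^ 2 + (rad U 2 θ ϕ : ℂ) ^ 2 = 1 := by
    have := sum_rad_sq h.su θ ϕ
    rw [Fin.sum_univ_three] at this
    exact_mod_cast this
  have ht : (rad U 0 θ ϕ : ℂ) * τ 0 + rad U 1 θ ϕ * τ 1 + rad U 2 θ ϕ * τ 2 = 0 := by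
    rw [Fin.sum_univ_three] at hτ
    exact_mod_cast hτ
  obtain ⟨G, hG⟩ : ∃ G : Fin 3 → ℂ, ∀ i, pd i.succ F (t, sphPoint U r θ ϕ) = G i :=
    ⟨_, fun _ => rfl⟩
  simp only [Gen.act, sphPoint_apply, hG, Fin.sum_univ_three, Complex.real_smul]
  push_cast
  field_simp
  linear_combination (-((τ 0 : ℂ) * G 0 + τ 1 * G 1 + τ 2 * G 2)) * hs +
    (rad U 0 θ ϕ * G 0 + rad U 1 θ ϕ * G 1 + rad U 2 θ ϕ * G 2) * ht

/-- The coordinate derivatives of an operator of class `Cl n b`. -/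
lemma Cl.exists_deriv {n b : ℕ} {O : Op} (h : Cl n b O) : ∃ Ot Or Oθ Oϕ : Op,
    (∀ χ : Mink → ℂ, ContDiff ℝ (n + 1 : ℕ) χ → ∀ U t r θ ϕ, Reg U t r θ →
      HasDerivAt (fun τ => O χ U τ r θ ϕ) (Ot χ U t r θ ϕ) t ∧
      HasDerivAt (fun ρ => O χ U t ρ θ ϕ) (Or χ U t r θ ϕ) r ∧
      HasDerivAt (fun η => O χ U t r η ϕ) (Oθ χ U t r θ ϕ) θ ∧
      HasDerivAt (fun η => O χ U t r θ η) (Oϕ χ U t r θ ϕ) ϕ) ∧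
    Cl (n + 1) b (fun χ U t r θ ϕ => Ot χ U t r θ ϕ + Or χ U t r θ ϕ) ∧
    Cl (n + 1) (b + 1) (fun χ U t r θ ϕ => Ot χ U t r θ ϕ - Or χ U t r θ ϕ) ∧
    Cl (n + 1) b (fun χ U t r θ ϕ => ((r⁻¹ : ℝ) : ℂ) * Oθ χ U t r θ ϕ) ∧
    Cl (n + 1) b (fun χ U t r θ ϕ => ((r⁻¹ : ℝ) : ℂ) * Oϕ χ U t r θ ϕ) := by
  induction h with
  | @term c hc p a w hn hb hw =>
    obtain ⟨c₁, c₂, hc1, hc2, hder⟩ := hc.exists_deriv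
    -- These are the product rule in each coordinate: derivatives of the weights, derivatives of the
    -- coefficient, and one more translation in front of the word.
    refine ⟨fun χ U t r θ ϕ => SpinDecay.term (fun U θ ϕ => -(a : ℂ) * c U θ ϕ) p (a + 1) w χ U t r θ ϕ +
        SpinDecay.term c p a (.d 0 :: w) χ U t r θ ϕ,
      fun χ U t r θ ϕ => SpinDecay.term (fun U θ ϕ => -(p : ℂ) * c U θ ϕ) (p + 1) a w χ U t r θ ϕ +
        SpinDecay.term (fun U θ ϕ => -(a : ℂ) * c U θ ϕ) p (a + 1) w χ U t r θ ϕ +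
        ∑ i : Fin 3, SpinDecay.term (fun U θ ϕ => c U θ ϕ * rad U i θ ϕ) p a (.d i.succ :: w) χ U t r θ ϕ,
      fun χ U t r θ ϕ => SpinDecay.term c₁ p a w χ U t r θ ϕ +
        r * ∑ i : Fin 3, SpinDecay.term (fun U θ ϕ => c U θ ϕ * radTheta U i θ ϕ) p a (.d i.succ :: w) χ U t r θ ϕ,
      fun χ U t r θ ϕ => SpinDecay.term c₂ p a w χ U t r θ ϕ +
        r * ∑ i : Fin 3, SpinDecay.term (fun U θ ϕ => c U θ ϕ * radPhi U i θ ϕ) p a (.d i.succ :: w) χ U t r θ ϕ,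
      ?_, ?_, ?_, ?_, ?_⟩
    · intro χ hχ U t r θ ϕ hr
      have hF1 : ContDiff ℝ 1 (wact w χ) :=
        contDiff_wact (n := 1) w (hχ.of_le (by norm_cast; omega))
      have hF : DifferentiableAt ℝ (wact w χ) (t, sphPoint U r θ ϕ) :=
        (hF1.differentiable one_ne_zero) _
      have hr0 := hr.r_pos.ne'
      have hv0 : t + r ≠ 0 := (add_pos hr.t_pos hr.r_pos).ne'
      have hrc : (r : ℂ) ≠ 0 := by exact_mod_cast hr0
      have hvc : (t : ℂ) + r ≠ 0 := by exact_mod_cast hv0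
      have hvp : ∀ {f : ℝ → ℝ} {x : ℝ}, HasDerivAt f 1 x → f x ≠ 0 → ∀ m : ℕ,
          HasDerivAt (fun x => ((f x)⁻¹) ^ m) (-(m : ℝ) * ((f x)⁻¹) ^ (m + 1)) x := by
        intro f x hf hx m
        refine ((hf.fun_inv hx).fun_pow m).congr_deriv ?_
        rcases m with _ | m
        · simp
        · simp only [Nat.add_sub_cancel]
          rw [div_eq_mul_inv, ← inv_pow]
          ring
      have dv_t : HasDerivAt (fun τ => τ + r) 1 t := (hasDerivAt_id t).add_const r
      have dv_r : HasDerivAt (fun ρ => t + ρ) 1 r := (hasDerivAt_id r).const_add t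
      refine ⟨?_, ?_, ?_, ?_⟩
      · have h1 := ((hvp dv_t hv0 a).const_mul ((r⁻¹) ^ p)).ofReal_comp
        have := (h1.const_mul (c U θ ϕ)).fun_mul (hasDerivAt_sph_t hF)
        refine this.congr_deriv ?_
        simp only [SpinDecay.term, wact_cons, Gen.act]
        push_cast
        ring
      · have h1 := ((hvp (hasDerivAt_id r) hr0 p).fun_mul (hvp dv_r hv0 a)).ofReal_comp
        have := (h1.const_mul (c U θ ϕ)).fun_mul (hasDerivAt_sph_r hF)
        refine this.congr_deriv ?_
        simp only [SpinDecay.term, wact_cons, Gen.act, Complex.real_smul, Fin.sum_univ_three, id]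
        push_cast
        ring
      · have := ((hder U θ ϕ hr.θ_pos hr.θ_lt).1.mul_const
          (((r⁻¹) ^ p * ((t + r)⁻¹) ^ a : ℝ) : ℂ)).fun_mul (hasDerivAt_sph_theta hF)
        refine this.congr_deriv ?_
        simp only [SpinDecay.term, wact_cons, Gen.act, Complex.real_smul, Fin.sum_univ_three]
        push_cast
        ring
      · have := ((hder U θ ϕ hr.θ_pos hr.θ_lt).2.mul_const
          (((r⁻¹) ^ p * ((t + r)⁻¹) ^ a : ℝ) : ℂ)).fun_mul (hasDerivAt_sph_phi hF)
        refine this.congr_deriv ?_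
        simp only [SpinDecay.term, wact_cons, Gen.act, Complex.real_smul, Fin.sum_univ_three]
        push_cast
        ring
    -- In ∂_t + ∂_r both derivatives hit (t+r)^(-a), whence 2a. The translations are exchanged for
    -- (t+r)⁻¹ times S and L_i, so the number of translations does not grow.
    · have k1 : Cl (n + 1) b (SpinDecay.term (fun U θ ϕ => -(2 * a : ℂ) * c U θ ϕ) p (a + 1) w) :=
        .term ((Adm.const _).mul hc) _ _ _ (by omega) hb (by omega)
      have k2 : Cl (n + 1) b (SpinDecay.term (fun U θ ϕ => -(p : ℂ) * c U θ ϕ) (p + 1) a w) :=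
        .term ((Adm.const _).mul hc) _ _ _ (by omega) hb (by omega)
      have k3 : Cl (n + 1) b (SpinDecay.term c p (a + 1) (.S :: w)) :=
        .term hc _ _ _ (by rw [wwt_cons]; simp only [Gen.wt]; omega)
          (by rw [wwt_cons]; simp only [Gen.wt]; omega) (by rw [List.length_cons]; omega)
      have k4 := Cl.sum Finset.univ fun i : Fin 3 =>
        (Cl.term (hc.mul (Adm.rad i)) p (a + 1) (.L i :: w)
          (by rw [wwt_cons]; simp only [Gen.wt]; omega)
          (by rw [wwt_cons]; simp only [Gen.wt]; omega) (by rw [List.length_cons]; omega) :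
          Cl (n + 1) b _)
      refine (((k1.add k2).add k3).add k4).congr fun χ hχ U t r θ ϕ hr => ?_
      have hid := radial_identity (F := wact w χ) ϕ hr
      obtain ⟨G, hG⟩ : ∃ G : Fin 3 → ℂ,
          ∀ i, pd i.succ (wact w χ) (t, sphPoint U r θ ϕ) = G i := ⟨_, fun _ => rfl⟩
      have e0 : Gen.act (.d 0) (wact w χ) = pd 0 (wact w χ) := rfl
      have ei : ∀ i : Fin 3, Gen.act (.d i.succ) (wact w χ) = pd i.succ (wact w χ) := fun i => rfl
      simp only [SpinDecay.term, wact_cons, e0, ei, hG, pow_succ ((t + r)⁻¹), Fin.sum_univ_three,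
        Complex.real_smul] at hid ⊢
      push_cast at hid ⊢
      linear_combination (c U θ ϕ * ((r : ℂ)⁻¹) ^ p * (((t : ℂ) + r)⁻¹) ^ a) * hid
    -- In ∂_t - ∂_r the derivatives of (t+r)^(-a) cancel. The translations remain, which raises the
    -- bound on their number by one.
    · have k1 : Cl (n + 1) (b + 1) (SpinDecay.term c p a (.d 0 :: w)) :=
        .term hc _ _ _ (by rw [wwt_cons]; simp only [Gen.wt]; omega)
          (by rw [wwt_cons]; simp only [Gen.wt]; omega) (by rw [List.length_cons]; omega)
      have k2 : Cl (n + 1) (b + 1) (SpinDecay.term (fun U θ ϕ => (p : ℂ) * c U θ ϕ) (p + 1) a w) :=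
        .term ((Adm.const _).mul hc) _ _ _ (by omega) (by omega) (by omega)
      have k3 := Cl.sum Finset.univ fun i : Fin 3 =>
        (Cl.term ((hc.mul (Adm.rad i)).neg) p a (.d i.succ :: w)
          (by rw [wwt_cons]; simp only [Gen.wt]; omega)
          (by rw [wwt_cons]; simp only [Gen.wt]; omega) (by rw [List.length_cons]; omega) :
          Cl (n + 1) (b + 1) _)
      refine ((k1.add k2).add k3).congr fun χ hχ U t r θ ϕ hr => ?_
      simp only [SpinDecay.term, Fin.sum_univ_three]
      ring
    -- With the factor r⁻¹ the θ-derivative becomes a combination of rotations with weight r⁻¹,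
    -- again without additional translations.
    · have k1 : Cl (n + 1) b (SpinDecay.term c₁ (p + 1) a w) :=
        .term hc1 _ _ _ (by omega) hb (by omega)
      have k2 := Cl.sum Finset.univ fun i : Fin 3 => Cl.sum Finset.univ fun j : Fin 3 =>
        (Cl.term ((hc.mul (Adm.rad i)).mul (Adm.radTheta j)) (p + 1) a (.R i j :: w)
          (by rw [wwt_cons]; simp only [Gen.wt]; omega)
          (by rw [wwt_cons]; simp only [Gen.wt]; omega) (by rw [List.length_cons]; omega) :
          Cl (n + 1) b _)
      refine (k1.add k2).congr fun χ hχ U t r θ ϕ hr => ?_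
      have hid := tangential_identity (F := wact w χ) ϕ hr (sum_rad_mul_radTheta hr.su θ ϕ)
      have hr0 : (r : ℂ) ≠ 0 := by exact_mod_cast hr.r_pos.ne'
      have hrr : (r : ℂ)⁻¹ * r = 1 := inv_mul_cancel₀ hr0
      obtain ⟨G, hG⟩ : ∃ G : Fin 3 → ℂ,
          ∀ i, pd i.succ (wact w χ) (t, sphPoint U r θ ϕ) = G i := ⟨_, fun _ => rfl⟩
      have ei : ∀ i : Fin 3, Gen.act (.d i.succ) (wact w χ) = pd i.succ (wact w χ) := fun i => rfl
      simp only [SpinDecay.term, wact_cons, ei, hG, pow_succ (r⁻¹), Fin.sum_univ_three,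
        Complex.real_smul] at hid ⊢
      push_cast at hid ⊢
      linear_combination (c U θ ϕ * ((r : ℂ)⁻¹) ^ p * (((t : ℂ) + r)⁻¹) ^ a) * hid +
        (c U θ ϕ * ((r : ℂ)⁻¹) ^ p * (((t : ℂ) + r)⁻¹) ^ a *
          (radTheta U 0 θ ϕ * G 0 + radTheta U 1 θ ϕ * G 1 + radTheta U 2 θ ϕ * G 2)) * hrr
    · have k1 : Cl (n + 1) b (SpinDecay.term c₂ (p + 1) a w) :=
        .term hc2 _ _ _ (by omega) hb (by omega)
      have k2 := Cl.sum Finset.univ fun i : Fin 3 => Cl.sum Finset.univ fun j : Fin 3 =>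
        (Cl.term ((hc.mul (Adm.rad i)).mul (Adm.radPhi j)) (p + 1) a (.R i j :: w)
          (by rw [wwt_cons]; simp only [Gen.wt]; omega)
          (by rw [wwt_cons]; simp only [Gen.wt]; omega) (by rw [List.length_cons]; omega) :
          Cl (n + 1) b _)
      refine (k1.add k2).congr fun χ hχ U t r θ ϕ hr => ?_
      have hid := tangential_identity (F := wact w χ) ϕ hr (sum_rad_mul_radPhi hr.su θ ϕ)
      have hr0 : (r : ℂ) ≠ 0 := by exact_mod_cast hr.r_pos.ne'
      have hrr : (r : ℂ)⁻¹ * r = 1 := inv_mul_cancel₀ hr0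
      obtain ⟨G, hG⟩ : ∃ G : Fin 3 → ℂ,
          ∀ i, pd i.succ (wact w χ) (t, sphPoint U r θ ϕ) = G i := ⟨_, fun _ => rfl⟩
      have ei : ∀ i : Fin 3, Gen.act (.d i.succ) (wact w χ) = pd i.succ (wact w χ) := fun i => rfl
      simp only [SpinDecay.term, wact_cons, ei, hG, pow_succ (r⁻¹), Fin.sum_univ_three,
        Complex.real_smul] at hid ⊢
      push_cast at hid ⊢
      linear_combination (c U θ ϕ * ((r : ℂ)⁻¹) ^ p * (((t : ℂ) + r)⁻¹) ^ a) * hid +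
        (c U θ ϕ * ((r : ℂ)⁻¹) ^ p * (((t : ℂ) + r)⁻¹) ^ a *
          (radPhi U 0 θ ϕ * G 0 + radPhi U 1 θ ϕ * G 1 + radPhi U 2 θ ϕ * G 2)) * hrr
  | add _ _ ih ih' =>
    obtain ⟨Ot, Or, Oθ, Oϕ, hd, h1, h2, h3, h4⟩ := ih
    obtain ⟨Ot', Or', Oθ', Oϕ', hd', h1', h2', h3', h4'⟩ := ih'
    refine ⟨fun χ U t r θ ϕ => Ot χ U t r θ ϕ + Ot' χ U t r θ ϕ,
      fun χ U t r θ ϕ => Or χ U t r θ ϕ + Or' χ U t r θ ϕ,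
      fun χ U t r θ ϕ => Oθ χ U t r θ ϕ + Oθ' χ U t r θ ϕ,
      fun χ U t r θ ϕ => Oϕ χ U t r θ ϕ + Oϕ' χ U t r θ ϕ, ?_, ?_, ?_, ?_, ?_⟩
    · intro χ hχ U t r θ ϕ hr
      have a := hd χ hχ U t r θ ϕ hr
      have b := hd' χ hχ U t r θ ϕ hr
      exact ⟨a.1.fun_add b.1, a.2.1.fun_add b.2.1, a.2.2.1.fun_add b.2.2.1,
        a.2.2.2.fun_add b.2.2.2⟩
    · exact (h1.add h1').congr fun χ hχ U t r θ ϕ hr => by ring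
    · exact (h2.add h2').congr fun χ hχ U t r θ ϕ hr => by ring
    · exact (h3.add h3').congr fun χ hχ U t r θ ϕ hr => by ring
    · exact (h4.add h4').congr fun χ hχ U t r θ ϕ hr => by ring
  | congr _ he ih =>
    obtain ⟨Ot, Or, Oθ, Oϕ, hd, hcl⟩ := ih
    refine ⟨Ot, Or, Oθ, Oϕ, fun χ hχ U t r θ ϕ hr => ?_, hcl⟩
    have he' := he χ (hχ.of_le (by norm_cast; omega)) U
    have a := hd χ hχ U t r θ ϕ hr
    -- The identity is known only on `Reg`. This region is open in t, r and θ and does not restrict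
    -- ϕ, so the identity may be differentiated.
    refine ⟨a.1.congr_of_eventuallyEq ?_, a.2.1.congr_of_eventuallyEq ?_,
      a.2.2.1.congr_of_eventuallyEq ?_, a.2.2.2.congr_of_eventuallyEq ?_⟩
    · filter_upwards [lt_mem_nhds hr.t_pos] with τ hτ
      exact he' _ _ _ _ ⟨hr.su, hτ, hr.r_pos, hr.θ_pos, hr.θ_lt⟩
    · filter_upwards [lt_mem_nhds hr.r_pos] with τ hτ
      exact he' _ _ _ _ ⟨hr.su, hr.t_pos, hτ, hr.θ_pos, hr.θ_lt⟩
    · filter_upwards [lt_mem_nhds hr.θ_pos, gt_mem_nhds hr.θ_lt] with τ hτ hτ'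
      exact he' _ _ _ _ ⟨hr.su, hr.t_pos, hr.r_pos, hτ, hτ'⟩
    · exact Filter.Eventually.of_forall fun τ => he' _ _ _ _ hr

lemma Cl.opD {n b : ℕ} {O : Op} (h : Cl n b O) : Cl (n + 1) b fun χ U => opD (O χ U) := by
  obtain ⟨Ot, Or, Oθ, Oϕ, hd, h1, h2, h3, h4⟩ := h.exists_deriv
  refine (h1.coef_mul (.const (1 / (Real.sqrt 2 : ℂ)))).congr fun χ hχ U t r θ ϕ hr => ?_
  obtain ⟨a1, a2, a3, a4⟩ := hd χ hχ U t r θ ϕ hr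
  rw [SpinDecay.opD, a1.deriv, a2.deriv]

lemma Cl.opD' {n b : ℕ} {O : Op} (h : Cl n b O) :
    Cl (n + 1) (b + 1) fun χ U => opD' (O χ U) := by
  obtain ⟨Ot, Or, Oθ, Oϕ, hd, h1, h2, h3, h4⟩ := h.exists_deriv
  refine (h2.coef_mul (.const (1 / (Real.sqrt 2 : ℂ)))).congr fun χ hχ U t r θ ϕ hr => ?_
  obtain ⟨a1, a2, a3, a4⟩ := hd χ hχ U t r θ ϕ hr
  rw [SpinDecay.opD', a1.deriv, a2.deriv]

lemma Cl.opDelta {n b : ℕ} {O : Op} (h : Cl n b O) : Cl (n + 1) b fun χ U => opDelta (O χ U) := by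
  obtain ⟨Ot, Or, Oθ, Oϕ, hd, h1, h2, h3, h4⟩ := h.exists_deriv
  refine ((h3.coef_mul (.const (1 / (Real.sqrt 2 : ℂ)))).add (h4.coef_mul
    ((Adm.const (Complex.I / (Real.sqrt 2 : ℂ))).mul Adm.csc))).congr fun χ hχ U t r θ ϕ hr => ?_
  obtain ⟨a1, a2, a3, a4⟩ := hd χ hχ U t r θ ϕ hr
  rw [SpinDecay.opDelta, a3.deriv, a4.deriv]
  simp only [Complex.ofReal_mul, Complex.ofReal_inv]
  rw [div_eq_mul_inv _ (Real.sin θ : ℂ), one_div, mul_inv, div_eq_mul_inv, div_eq_mul_inv]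
  ring

lemma Cl.opDelta' {n b : ℕ} {O : Op} (h : Cl n b O) :
    Cl (n + 1) b fun χ U => opDelta' (O χ U) := by
  obtain ⟨Ot, Or, Oθ, Oϕ, hd, h1, h2, h3, h4⟩ := h.exists_deriv
  refine ((h3.coef_mul (.const (1 / (Real.sqrt 2 : ℂ)))).add (h4.coef_mul
    ((Adm.const (-(Complex.I / (Real.sqrt 2 : ℂ)))).mul Adm.csc))).congr
    fun χ hχ U t r θ ϕ hr => ?_
  obtain ⟨a1, a2, a3, a4⟩ := hd χ hχ U t r θ ϕ hr
  rw [SpinDecay.opDelta', a3.deriv, a4.deriv]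
  simp only [Complex.ofReal_mul, Complex.ofReal_inv]
  rw [div_eq_mul_inv _ (Real.sin θ : ℂ), one_div, mul_inv, div_eq_mul_inv, div_eq_mul_inv]
  ring

lemma mVec_eq (U : Mat) (θ ϕ : ℝ) (i : Fin 3) :
    mVec U θ ϕ i = spinVec (spin false U θ ϕ) (spin true U θ ϕ) i.succ := rfl

lemma Cl.angGrad {n b : ℕ} {O : Op} (h : Cl n b O) (i : Fin 3) :
    Cl (n + 1) b fun χ U => angGrad U i (O χ U) := by
  refine ((h.opDelta.coef_mul (Adm.spinVec true false i.succ)).add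
    (h.opDelta'.coef_mul (Adm.spinVec false true i.succ))).congr fun χ hχ U t r θ ϕ hr => ?_
  rw [SpinDecay.angGrad, mVec_eq, conj_spinVec]

lemma Cl.angPow {n b : ℕ} {O : Op} (h : Cl n b O) (m : ℕ) (α : Fin m → Fin 3) :
    Cl (n + m) b fun χ U => angPow U m α (O χ U) := by
  induction m with
  | zero => exact h
  | succ m ih => exact (ih (Fin.tail α)).angGrad (α 0)

lemma Cl.opD_iterate {n b : ℕ} {O : Op} (h : Cl n b O) (k : ℕ) :
    Cl (n + k) b fun χ U => SpinDecay.opD^[k] (O χ U) := by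
  induction k with
  | zero => exact h
  | succ k ih =>
    simp only [Function.iterate_succ_apply']
    exact ih.opD

lemma Cl.opD'_iterate {n b : ℕ} {O : Op} (h : Cl n b O) (k : ℕ) :
    Cl (n + k) (b + k) fun χ U => SpinDecay.opD'^[k] (O χ U) := by
  induction k with
  | zero => exact h
  | succ k ih =>
    simp only [Function.iterate_succ_apply']
    exact ih.opD'

/-! ### The null components of the spinor field -/

lemma contDiff_nabla {n : ℕ} {F : Mink → ℂ} (hF : ContDiff ℝ (n + 1 : ℕ) F) (A A' : Fin 2) :
    ContDiff ℝ n (nabla A A' F) := by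
  have h : ∀ μ, ContDiff ℝ n (pd μ F) := fun μ => contDiff_pd hF μ
  unfold nabla
  fun_prop

lemma contDiff_hertzField {n q : ℕ} (ξ : Fin q → Fin 2 → ℂ) {χ : Mink → ℂ}
    (hχ : ContDiff ℝ (n + q : ℕ) χ) (a : Fin q → Fin 2) : ContDiff ℝ n (hertzField q ξ χ a) := by
  induction q generalizing n with
  | zero => exact hχ
  | succ q ih =>
    have h : ∀ A', ContDiff ℝ n (nabla (a 0) A' (hertzField q (Fin.tail ξ) χ (Fin.tail a))) :=
      fun A' => contDiff_nabla (ih (Fin.tail ξ) (hχ.of_le (by norm_cast; omega)) (Fin.tail a)) _ _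
    unfold hertzField
    fun_prop

/-- The derivative along the tetrad vector with the spinors `s` and `s'`, in terms of the
coordinate derivatives. -/
def tetVal (s s' : Bool) (r θ : ℝ) (a b c d : ℂ) : ℂ :=
  if s = s' then (1 / (Real.sqrt 2 : ℂ)) * (a + (if s then -1 else 1) * b)
  else (1 / ((r * Real.sqrt 2 : ℝ) : ℂ)) *
    (c + (if s then -1 else 1) * (Complex.I / (Real.sin θ : ℂ)) * d)

/-- The derivative along the tetrad vector with the spinors `s` and `s'`. -/
def tet (s s' : Bool) (F : CoordFun) : CoordFun := fun t r θ ϕ =>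
  tetVal s s' r θ (deriv (fun τ => F τ r θ ϕ) t) (deriv (fun ρ => F t ρ θ ϕ) r)
    (deriv (fun η => F t r η ϕ) θ) (deriv (fun η => F t r θ η) ϕ)

/-- Of the four tetrad directions only ι paired with ῑ, which is D', costs a translation. -/
lemma Cl.tet {n b : ℕ} {O : Op} (h : Cl n b O) (s s' : Bool) :
    Cl (n + 1) (b + if s && s' then 1 else 0) fun χ U => tet s s' (O χ U) := by
  cases s <;> cases s'
  · refine Cl.congr (O := fun χ U => SpinDecay.opD (O χ U)) (by simpa using h.opD)
      fun χ _ U t r θ ϕ _ => ?_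
    simp [SpinDecay.tet, tetVal, SpinDecay.opD]
  · refine Cl.congr (O := fun χ U => SpinDecay.opDelta (O χ U)) (by simpa using h.opDelta)
      fun χ _ U t r θ ϕ _ => ?_
    simp [SpinDecay.tet, tetVal, SpinDecay.opDelta]
  · refine Cl.congr (O := fun χ U => SpinDecay.opDelta' (O χ U)) (by simpa using h.opDelta')
      fun χ _ U t r θ ϕ _ => ?_
    simp [SpinDecay.tet, tetVal, SpinDecay.opDelta', sub_eq_add_neg]
  · refine Cl.congr (O := fun χ U => SpinDecay.opD' (O χ U)) (by simpa using h.opD')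
      fun χ _ U t r θ ϕ _ => ?_
    simp [SpinDecay.tet, tetVal, SpinDecay.opD', sub_eq_add_neg]

lemma sqrt_two_ne_zero : (Real.sqrt 2 : ℂ) ≠ 0 := by
  exact_mod_cast (Real.sqrt_pos.2 (by norm_num : (0 : ℝ) < 2)).ne'

lemma sqrt_two_sq : (Real.sqrt 2 : ℂ) ^ 2 = 2 := by
  rw [← Complex.ofReal_pow, Real.sq_sqrt (by norm_num)]
  norm_num

/-- The coordinate derivatives of a function on Minkowski space, combined to the derivative along
a tetrad vector. -/
lemma tetVal_comp {F : Mink → ℂ} {U : Mat} {t r θ : ℝ} (ϕ : ℝ) (h : Reg U t r θ) (s s' : Bool) :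
    tetVal s s' r θ (pd 0 F (t, sphPoint U r θ ϕ))
      (∑ i, rad U i θ ϕ • pd i.succ F (t, sphPoint U r θ ϕ))
      (∑ i, (r * radTheta U i θ ϕ) • pd i.succ F (t, sphPoint U r θ ϕ))
      (∑ i, (r * radPhi U i θ ϕ) • pd i.succ F (t, sphPoint U r θ ϕ)) =
    ∑ μ, spinVec (spin s U θ ϕ) (spin s' U θ ϕ) μ * pd μ F (t, sphPoint U r θ ϕ) := by
  have h2 := sqrt_two_ne_zero
  have h22 := sqrt_two_sq
  have hr : (r : ℂ) ≠ 0 := by exact_mod_cast h.r_pos.ne'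
  have hs : (Real.sin θ : ℂ) ≠ 0 := by
    exact_mod_cast (Real.sin_pos_of_pos_of_lt_pi h.θ_pos h.θ_lt).ne'
  obtain ⟨G, hG⟩ : ∃ G : Fin 3 → ℂ, ∀ i, pd i.succ F (t, sphPoint U r θ ϕ) = G i :=
    ⟨_, fun _ => rfl⟩
  have e4 := Fin.sum_univ_succ fun μ : Fin 4 =>
    spinVec (spin s U θ ϕ) (spin s' U θ ϕ) μ * pd μ F (t, sphPoint U r θ ϕ)
  rw [e4, spinVec_zero h.su]
  simp only [hG, Complex.real_smul, Complex.ofReal_mul, coe_rad, coe_radTheta, coe_radPhi]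
  cases s <;> cases s' <;>
    simp only [tetVal, Bool.false_eq_true, Bool.true_eq_false, if_true, if_false, one_mul, zero_mul,
      zero_add, Complex.ofReal_mul, spinVec_iota h.su, Fin.sum_univ_three]
  · field_simp
  · obtain ⟨m, hm⟩ : ∃ m : Fin 3 → ℂ, ∀ i : Fin 3,
        spinVec (spin false U θ ϕ) (spin true U θ ϕ) i.succ = m i := ⟨_, fun _ => rfl⟩
    obtain ⟨m', hm'⟩ : ∃ m' : Fin 3 → ℂ, ∀ i : Fin 3,
        spinVec (spin true U θ ϕ) (spin false U θ ϕ) i.succ = m' i := ⟨_, fun _ => rfl⟩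
    simp only [hm, hm']
    field_simp
    linear_combination ((m' 0 - m 0) * G 0 + (m' 1 - m 1) * G 1 + (m' 2 - m 2) * G 2) *
      Complex.I_sq
  · obtain ⟨m, hm⟩ : ∃ m : Fin 3 → ℂ, ∀ i : Fin 3,
        spinVec (spin false U θ ϕ) (spin true U θ ϕ) i.succ = m i := ⟨_, fun _ => rfl⟩
    obtain ⟨m', hm'⟩ : ∃ m' : Fin 3 → ℂ, ∀ i : Fin 3,
        spinVec (spin true U θ ϕ) (spin false U θ ϕ) i.succ = m' i := ⟨_, fun _ => rfl⟩
    simp only [hm, hm']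
    field_simp
    linear_combination (-((m' 0 - m 0) * G 0 + (m' 1 - m 1) * G 1 + (m' 2 - m 2) * G 2)) *
      Complex.I_sq
  · field_simp
    ring

/-- The coefficients of the derivatives of the spin basis along the tetrad. -/
def spinCoef (s s' σ σ' : Bool) (θ : ℝ) : ℂ :=
  if s = s' then 0 else (1 / (Real.sqrt 2 : ℂ)) *
    (if σ' = σ then (if s then 1 else -1) * (if σ then 1 else -1) / 2 *
        ((Real.cos θ : ℂ) * (Real.sin θ : ℂ)⁻¹)
      else (if σ then -1 else 1) / 2 + (if s then 1 else -1) / 2)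

lemma Adm.spinCoef (s s' σ σ' : Bool) : Adm fun _ θ _ => spinCoef s s' σ σ' θ := by
  unfold SpinDecay.spinCoef
  cases s <;> cases s' <;> cases σ <;> cases σ' <;>
    simp only [Bool.false_eq_true, Bool.true_eq_false, if_true, if_false] <;>
    first
    | exact Adm.const _
    | exact (Adm.const _).mul ((Adm.const _).mul (Adm.cos.mul Adm.csc))

/-- The spin basis depends on the angles alone. Its derivatives along l and n vanish, and those
along m and m̄ are r⁻¹ times bounded combinations of the basis. -/
lemma tetVal_spin {U : Mat} {t r θ : ℝ} (ϕ : ℝ) (h : Reg U t r θ) (s s' σ : Bool) (A : Fin 2) :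
    tetVal s s' r θ 0 0 ((if σ then -(1 / 2) else 1 / 2) * spin (!σ) U θ ϕ A)
      (Complex.I / 2 * ((if σ then 1 else -1) * Real.cos θ * spin σ U θ ϕ A +
        Real.sin θ * spin (!σ) U θ ϕ A)) =
      ((r⁻¹ : ℝ) : ℂ) * ∑ σ', spinCoef s s' σ σ' θ * spin σ' U θ ϕ A := by
  have h2 := sqrt_two_ne_zero
  have hr : (r : ℂ) ≠ 0 := by exact_mod_cast h.r_pos.ne'
  have hs : (Real.sin θ : ℂ) ≠ 0 := by
    exact_mod_cast (Real.sin_pos_of_pos_of_lt_pi h.θ_pos h.θ_lt).ne'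
  have hI := Complex.I_sq
  obtain ⟨o, ho⟩ : ∃ o, spin false U θ ϕ A = o := ⟨_, rfl⟩
  obtain ⟨ι, hι⟩ : ∃ ι, spin true U θ ϕ A = ι := ⟨_, rfl⟩
  obtain ⟨c, hc⟩ : ∃ c : ℂ, (Real.cos θ : ℂ) = c := ⟨_, rfl⟩
  obtain ⟨d, hd⟩ : ∃ d : ℂ, (Real.sin θ : ℂ) = d := ⟨_, rfl⟩
  rw [hd] at hs
  cases s <;> cases s' <;> cases σ <;>
    simp only [tetVal, spinCoef, Bool.false_eq_true, Bool.true_eq_false, if_true, if_false,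
      Fintype.sum_bool, Bool.not_true, Bool.not_false, Complex.ofReal_mul, Complex.ofReal_inv,
      ho, hι, hc, hd, mul_zero, zero_mul, add_zero] <;>
    field_simp <;> ring_nf <;> simp only [Complex.I_sq] <;> ring

/-- The components of the spinor field in the spin basis. -/
def pat (q : ℕ) (ξ : Fin q → Fin 2 → ℂ) (s : Fin q → Bool) : Op := fun χ U t r θ ϕ =>
  ∑ a : Fin q → Fin 2, (∏ k, spin (s k) U θ ϕ (a k)) *
    hertzField q ξ χ a (t, sphPoint U r θ ϕ)

/-- The number of factors `ι`. -/
def numIota {q : ℕ} (s : Fin q → Bool) : ℕ := ∑ k, if s k then 1 else 0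

lemma numIota_update {q : ℕ} (s : Fin q → Bool) (k : Fin q) (σ : Bool) :
    numIota (Function.update s k σ) + (if s k then 1 else 0) = numIota s + if σ then 1 else 0 := by
  unfold numIota
  rw [← Finset.add_sum_erase _ _ (Finset.mem_univ k),
    ← Finset.add_sum_erase _ (fun k => if s k then 1 else 0) (Finset.mem_univ k)]
  have : ∑ x ∈ Finset.univ.erase k, (if Function.update s k σ x then 1 else 0) =
      ∑ x ∈ Finset.univ.erase k, if s x then 1 else 0 :=
    Finset.sum_congr rfl fun j hj => by rw [Function.update_of_ne (Finset.ne_of_mem_erase hj)]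
  rw [this, Function.update_self]
  omega

/-- The contraction of a constant spinor with the spin basis. -/
def contr (ξ : Fin 2 → ℂ) (s : Bool) (U : Mat) (θ ϕ : ℝ) : ℂ := ∑ A', spin s U θ ϕ A' * ξ A'

lemma Adm.contr (ξ : Fin 2 → ℂ) (s : Bool) : Adm fun U θ ϕ => contr ξ s U θ ϕ :=
  Adm.sum _ fun A' => (Adm.spin s A').mul (Adm.const _)

/-- The constant spinor is expanded in the conjugate spin basis by completeness. This turns the
contraction of ∇_{AA'} into derivatives along the tetrad, with coefficients depending only on the
angles. -/
lemma sum_spin_nabla {F : Mink → ℂ} {U : Mat} (hU : U ∈ SU) (ξ : Fin 2 → ℂ) (s : Bool) (θ ϕ : ℝ)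
    (p : Mink) :
    ∑ A, spin s U θ ϕ A * ∑ A', ξ A' * nabla A A' F p =
      ∑ s', contr ξ s' U θ ϕ * ∑ μ, spinVec (spin s U θ ϕ) (spin s' U θ ϕ) μ * pd μ F p := by
  have hξ : ∀ A', ξ A' = ∑ s', contr ξ s' U θ ϕ * (starRingEnd ℂ) (spin s' U θ ϕ A') := by
    intro A'
    have h := fun B => spin_complete hU θ ϕ B A'
    have h0 := h 0
    have h1 := h 1
    simp only [Fintype.sum_bool] at h0 h1
    simp only [contr, Fintype.sum_bool, Fin.sum_univ_two]
    have : ξ A' = ξ 0 * (if (0 : Fin 2) = A' then 1 else 0) +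
        ξ 1 * (if (1 : Fin 2) = A' then 1 else 0) := by
      fin_cases A' <;> simp
    rw [this, ← h0, ← h1]
    ring
  have e : ∀ A A', ξ A' * nabla A A' F p = ∑ s', contr ξ s' U θ ϕ *
      ((starRingEnd ℂ) (spin s' U θ ϕ A') * nabla A A' F p) := by
    intro A A'
    nth_rewrite 1 [hξ A']
    rw [Finset.sum_mul]
    exact Finset.sum_congr rfl fun _ _ => by ring
  have e' : ∀ A, ∑ A', ξ A' * nabla A A' F p = ∑ A', ∑ s', contr ξ s' U θ ϕ *
      ((starRingEnd ℂ) (spin s' U θ ϕ A') * nabla A A' F p) :=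
    fun A => Finset.sum_congr rfl fun A' _ => e A A'
  rw [Finset.sum_congr rfl fun A _ => by rw [e' A]]
  simp only [nabla, spinVec, Fintype.sum_bool, Fin.sum_univ_two, Fin.sum_univ_four]
  ring

/-- Derivatives along a tetrad vector are linear in the coordinate derivatives. -/
lemma tetVal_linear (s s' : Bool) (r θ : ℝ) : ∃ α β γ ε : ℂ, ∀ a b c d,
    tetVal s s' r θ a b c d = α * a + β * b + γ * c + ε * d := by
  by_cases h : s = s'
  · exact ⟨1 / (Real.sqrt 2 : ℂ), 1 / (Real.sqrt 2 : ℂ) * (if s then -1 else 1), 0, 0,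
      fun a b c d => by rw [tetVal, if_pos h]; ring⟩
  · exact ⟨0, 0, 1 / ((r * Real.sqrt 2 : ℝ) : ℂ), 1 / ((r * Real.sqrt 2 : ℝ) : ℂ) *
      ((if s then -1 else 1) * (Complex.I / (Real.sin θ : ℂ))),
      fun a b c d => by rw [tetVal, if_neg h]; ring⟩

/-- The outermost derivative of the potential is contracted with spinors standing to its left. The
Leibniz rule moves the remaining basis spinors inside it, and each correction replaces one of them
by a basis element with a spin coefficient. -/
lemma pat_succ {q : ℕ} (ξ : Fin (q + 1) → Fin 2 → ℂ) (s : Fin (q + 1) → Bool) {χ : Mink → ℂ}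
    (hχ : ContDiff ℝ (q + 1 : ℕ) χ) {U : Mat} {t r θ : ℝ} (ϕ : ℝ) (h : Reg U t r θ) :
    pat (q + 1) ξ s χ U t r θ ϕ = ∑ s', contr (ξ 0) s' U θ ϕ *
      (tet (s 0) s' (pat q (Fin.tail ξ) (Fin.tail s) χ U) t r θ ϕ -
        ((r⁻¹ : ℝ) : ℂ) * ∑ k, ∑ σ', spinCoef (s 0) s' (Fin.tail s k) σ' θ *
          pat q (Fin.tail ξ) (Function.update (Fin.tail s) k σ') χ U t r θ ϕ) := by
  set ξ' := Fin.tail ξ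
  set σ := Fin.tail s
  set X := sphPoint U r θ ϕ with hX
  set H : (Fin q → Fin 2) → Mink → ℂ := hertzField q ξ' χ with hH
  have hdiff : ∀ a p, DifferentiableAt ℝ (H a) p := fun a p =>
    (contDiff_hertzField (n := 1) ξ' (hχ.of_le (by norm_cast; omega)) a).differentiable
      one_ne_zero p
  set B : (Fin q → Fin 2) → ℂ := fun a => ∏ k, spin (σ k) U θ ϕ (a k) with hB
  have hleft : pat (q + 1) ξ s χ U t r θ ϕ = ∑ s', contr (ξ 0) s' U θ ϕ *
      ∑ a, B a * ∑ μ, spinVec (spin (s 0) U θ ϕ) (spin s' U θ ϕ) μ * pd μ (H a) (t, X) := by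
    have e1 : pat (q + 1) ξ s χ U t r θ ϕ = ∑ a, B a *
        ∑ A, spin (s 0) U θ ϕ A * ∑ A', ξ 0 A' * nabla A A' (H a) (t, X) := by
      rw [pat, ← (Fin.consEquiv fun _ : Fin (q + 1) => Fin 2).sum_comp, Fintype.sum_prod_type,
        Finset.sum_comm]
      refine Finset.sum_congr rfl fun a _ => ?_
      rw [Finset.mul_sum]
      refine Finset.sum_congr rfl fun A _ => ?_
      have e2 : Fin.consEquiv (fun _ : Fin (q + 1) => Fin 2) (A, a) = Fin.cons A a := rfl
      have e3 : Fin.tail (Fin.cons A a : Fin (q + 1) → Fin 2) = a := Fin.tail_cons _ _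
      rw [e2, Fin.prod_univ_succ, hertzField, e3]
      simp only [Fin.cons_zero, Fin.cons_succ]
      simp only [hB, hH, hX, σ, Fin.tail, ξ']
      ring
    rw [e1, Finset.sum_congr rfl fun a _ => by
      rw [sum_spin_nabla h.su (ξ 0) (s 0) θ ϕ, Finset.mul_sum], Finset.sum_comm]
    refine Finset.sum_congr rfl fun s' _ => ?_
    rw [Finset.mul_sum]
    exact Finset.sum_congr rfl fun a _ => by ring
  rw [hleft]
  refine Finset.sum_congr rfl fun s' _ => ?_
  congr 1
  -- The t- and r-derivatives act on the field only. The angular ones also act on the product of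
  -- basis spinors, one slot at a time.
  have dθ : ∀ a : Fin q → Fin 2, HasDerivAt (fun η => ∏ k, spin (σ k) U η ϕ (a k)) _ θ := fun a =>
    HasDerivAt.fun_finsetProd fun k _ => hasDerivAt_spin_theta (σ k) U θ ϕ (a k)
  have dϕ : ∀ a : Fin q → Fin 2, HasDerivAt (fun η => ∏ k, spin (σ k) U θ η (a k)) _ ϕ := fun a =>
    HasDerivAt.fun_finsetProd fun k _ => hasDerivAt_spin_phi (σ k) U θ ϕ (a k)
  have ht : HasDerivAt (fun τ => pat q ξ' σ χ U τ r θ ϕ) _ t :=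
    HasDerivAt.fun_sum fun a _ => (hasDerivAt_sph_t (hdiff a (t, X))).const_mul (B a)
  have hr : HasDerivAt (fun ρ => pat q ξ' σ χ U t ρ θ ϕ) _ r :=
    HasDerivAt.fun_sum fun a _ => (hasDerivAt_sph_r (hdiff a (t, X))).const_mul (B a)
  have hθ : HasDerivAt (fun η => pat q ξ' σ χ U t r η ϕ) _ θ :=
    HasDerivAt.fun_sum fun a _ => (dθ a).fun_mul (hasDerivAt_sph_theta (hdiff a (t, X)))
  have hϕ : HasDerivAt (fun η => pat q ξ' σ χ U t r θ η) _ ϕ :=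
    HasDerivAt.fun_sum fun a _ => (dϕ a).fun_mul (hasDerivAt_sph_phi (hdiff a (t, X)))
  rw [tet, ht.deriv, hr.deriv, hθ.deriv, hϕ.deriv]
  have hcomp : ∀ a, ∑ μ, spinVec (spin (s 0) U θ ϕ) (spin s' U θ ϕ) μ * pd μ (H a) (t, X) = _ :=
    fun a => (tetVal_comp ϕ h (s 0) s').symm
  have hupd : ∀ (k : Fin q) (σ' : Bool), pat q ξ' (Function.update σ k σ') χ U t r θ ϕ =
      ∑ a, ((∏ j ∈ Finset.univ.erase k, spin (σ j) U θ ϕ (a j)) * spin σ' U θ ϕ (a k)) *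
        H a (t, X) := by
    intro k σ'
    refine Finset.sum_congr rfl fun a _ => ?_
    congr 1
    rw [← Finset.mul_prod_erase _ _ (Finset.mem_univ k), Function.update_self, mul_comm]
    congr 1
    exact Finset.prod_congr rfl fun j hj => by
      rw [Function.update_of_ne (Finset.ne_of_mem_erase hj)]
  -- Linearity in the four coordinate derivatives separates both parts of the Leibniz rule, without
  -- distinguishing the tetrad vectors.
  obtain ⟨α, β, γ, ε, hT⟩ := tetVal_linear (s 0) s' r θ
  have hcoef : ∀ k (a : Fin q → Fin 2), _ = _ := fun k a =>
    tetVal_spin (t := t) ϕ h (s 0) s' (σ k) (a k)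
  have hrhs : ((r⁻¹ : ℝ) : ℂ) * ∑ k, ∑ σ', spinCoef (s 0) s' (σ k) σ' θ *
      pat q ξ' (Function.update σ k σ') χ U t r θ ϕ =
      ∑ a, H a (t, X) * ∑ k, (∏ j ∈ Finset.univ.erase k, spin (σ j) U θ ϕ (a j)) *
        (((r⁻¹ : ℝ) : ℂ) * ∑ σ', spinCoef (s 0) s' (σ k) σ' θ * spin σ' U θ ϕ (a k)) := by
    simp only [hupd, Finset.mul_sum]
    conv_rhs => rw [Finset.sum_comm]
    refine Finset.sum_congr rfl fun k _ => ?_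
    conv_rhs => rw [Finset.sum_comm]
    exact Finset.sum_congr rfl fun σ' _ => Finset.sum_congr rfl fun a _ => by ring
  rw [hrhs, hT]
  simp only [← hcoef, hcomp, hT, smul_eq_mul, Finset.mul_sum (s := (Finset.univ : Finset (Fin q → Fin 2))),
    ← Finset.sum_add_distrib, ← Finset.sum_sub_distrib]
  refine Finset.sum_congr rfl fun a _ => ?_
  simp only [mul_zero, zero_add, Finset.sum_add_distrib, mul_add (∏ j ∈ _, _), mul_left_comm (∏ j ∈ _, _) γ,
    mul_left_comm (∏ j ∈ _, _) ε, ← Finset.mul_sum]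
  rw [← hX, ← hH, show ∏ j, spin (σ j) U θ ϕ (a j) = B a from rfl]
  ring

lemma Cl.inv_r_mul {n b : ℕ} {O : Op} (h : Cl n b O) :
    Cl (n + 1) b fun χ U t r θ ϕ => ((r⁻¹ : ℝ) : ℂ) * O χ U t r θ ϕ := by
  induction h with
  | term hd p a w hn hb hw =>
    refine (Cl.term hd (p + 1) a w (by omega) hb (by omega)).congr fun χ _ U t r θ ϕ _ => ?_
    simp only [SpinDecay.term, pow_succ, Complex.ofReal_mul]
    ring
  | add _ _ ih ih' =>
    refine (ih.add ih').congr fun χ _ U t r θ ϕ _ => ?_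
    ring
  | congr _ he ih =>
    exact ih.congr fun χ hχ U t r θ ϕ hr => by
      rw [he χ (hχ.of_le (by norm_cast; omega)) U t r θ ϕ hr]

lemma numIota_eq_add_tail {q : ℕ} (s : Fin (q + 1) → Bool) :
    numIota s = (if s 0 then 1 else 0) + numIota (Fin.tail s) := Fin.sum_univ_succ _

/-- Induction on the valence through `pat_succ`. The derivative term costs a translation only if the
new factor is ι. The corrections carry r⁻¹ and must not contain more factors ι than the original
pattern. -/
lemma Cl.pat {q : ℕ} (ξ : Fin q → Fin 2 → ℂ) (s : Fin q → Bool) :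
    Cl q (numIota s) (pat q ξ s) := by
  induction q with
  | zero =>
    refine (Cl.term (.const 1) 0 0 [] (by simp [wwt]) (by simp [wwt]) (by simp)).congr
      fun χ _ U t r θ ϕ _ => ?_
    simp [SpinDecay.pat, SpinDecay.term, hertzField, wact]
  | succ q ih =>
    have hup : ∀ s' k σ', Cl (q + 1) (numIota s) fun χ U t r θ ϕ =>
        spinCoef (s 0) s' (Fin.tail s k) σ' θ * (((r⁻¹ : ℝ) : ℂ) *
          SpinDecay.pat q (Fin.tail ξ) (Function.update (Fin.tail s) k σ') χ U t r θ ϕ) := by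
      intro s' k σ'
      have hn := numIota_update (Fin.tail s) k σ'
      have ht := numIota_eq_add_tail s
      by_cases hle : numIota (Function.update (Fin.tail s) k σ') ≤ numIota s
      · exact ((ih (Fin.tail ξ) _).inv_r_mul.mono hle).coef_mul (Adm.spinCoef _ _ _ _)
      · refine (Cl.zero _ _).congr fun χ _ U t r θ ϕ _ => ?_
        -- More factors ι could arise only if the new factor is o and a correction changes another o
        -- into ι. Such a term would come from the ι-part of the derivative of o along m, and this
        -- coefficient (the shear of l) is 1/2 - 1/2 = 0.
        have h0 : spinCoef (s 0) s' (Fin.tail s k) σ' θ = 0 := by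
          cases h0 : s 0 <;> cases s' <;> cases h1 : Fin.tail s k <;> cases σ' <;>
            simp only [h0, h1, Bool.false_eq_true, if_true, if_false] at hn ht <;>
            first
            | omega
            | (simp [SpinDecay.spinCoef]; done)
            | (simp [SpinDecay.spinCoef]; norm_num)
        rw [h0, zero_mul]
    have htet : ∀ s', Cl (q + 1) (numIota s) fun χ U =>
        SpinDecay.tet (s 0) s' (SpinDecay.pat q (Fin.tail ξ) (Fin.tail s) χ U) := fun s' =>
      ((ih (Fin.tail ξ) (Fin.tail s)).tet (s 0) s').mono (by
        rw [numIota_eq_add_tail s]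
        cases s 0 <;> cases s' <;> simp [add_comm])
    refine (Cl.sum Finset.univ fun s' => ((htet s').add ((Cl.sum Finset.univ fun k =>
      Cl.sum Finset.univ fun σ' => hup s' k σ').coef_mul (.const (-1)))).coef_mul
        (Adm.contr (ξ 0) s')).congr fun χ hχ U t r θ ϕ hr => ?_
    rw [pat_succ ξ s hχ ϕ hr]
    refine Finset.sum_congr rfl fun s' _ => ?_
    simp only [Finset.mul_sum, sub_eq_add_neg, ← Finset.sum_neg_distrib]
    congr 2
    refine Finset.sum_congr rfl fun k _ => Finset.sum_congr rfl fun σ' _ => ?_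
    ring

/-- The null components of the spinor field, as an operator acting on the potential. -/
lemma Cl.component {q : ℕ} (ξ : Fin q → Fin 2 → ℂ) (i : ℕ) :
    Cl q i fun χ U => component U (hertzField q ξ χ) i := by
  have h := Cl.pat ξ fun k => decide ((k : ℕ) < i)
  refine (h.mono ?_).congr fun χ _ U t r θ ϕ _ => ?_
  · unfold numIota
    simp only [decide_eq_true_eq, Finset.sum_boole, Nat.cast_id]
    rw [Fin.card_filter_val_lt]
    exact min_le_right _ _
  · refine Finset.sum_congr rfl fun a _ => ?_
    congr 1
    refine Finset.prod_congr rfl fun k _ => ?_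
    simp only [spin, decide_eq_true_eq]

/-- The derivatives of the null components, as operators acting on the potential. -/
lemma Cl.nullDeriv {q : ℕ} (ξ : Fin q → Fin 2 → ℂ) (i k l m : ℕ)
    (α : Fin m → Fin 3) :
    Cl (q + m + l + k) (i + l) fun χ U => SpinDecay.opD^[k] (SpinDecay.opD'^[l]
      (SpinDecay.angPow U m α (SpinDecay.component U (hertzField q ξ χ) i))) :=
  (((Cl.component ξ i).angPow m α).opD'_iterate l).opD_iterate k

/-! ### Decay of the operators applied to solutions -/

lemma Good.of_le {a a' : ℕ} {β M : ℝ} {χ : Mink → ℂ} (h : Good a β M χ) (ha : a' ≤ a) :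
    Good a' β M χ := by
  induction a, ha using Nat.le_induction with
  | base => exact h
  | succ a _ ih => exact ih h.pred

/-- Iteration of `Good.act`: every letter costs one degree of regularity, and only translations
lower the order. -/
lemma Good.wact (w : List Gen) (a : ℕ) : ∃ C, 0 ≤ C ∧ ∀ {β M : ℝ} {χ : Mink → ℂ},
    Good (a + w.length) β M χ → Good a (β - wwt w) (C * M) (wact w χ) := by
  induction w generalizing a with
  | nil => exact ⟨1, zero_le_one, fun h => by simpa [SpinDecay.wact, wwt] using h⟩
  | cons γ w ih =>
    obtain ⟨C, hC, h⟩ := ih (a + 1)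
    refine ⟨3 * (a + 3) * C, by positivity, fun {β M χ} hg => ?_⟩
    have h1 := (h (hg.of_le (by rw [List.length_cons]; omega))).act γ
    rw [wact_cons, wwt_cons]
    convert h1 using 1
    · push_cast
      ring
    · ring

lemma Good.wact_zero (w : List Gen) {n : ℕ} (hw : w.length ≤ n) : ∃ C, 0 ≤ C ∧
    ∀ {β M : ℝ} {χ : Mink → ℂ}, Good n β M χ → Good 0 (β - wwt w) (C * M) (SpinDecay.wact w χ) := by
  obtain ⟨C, hC, h⟩ := Good.wact w 0
  exact ⟨C, hC, fun hg => h (hg.of_le (by omega))⟩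

lemma extRate_nonneg (β u v : ℝ) : 0 ≤ extRate β u v := by
  have hu := bracket_nonneg u
  have hv := bracket_nonneg v
  unfold extRate
  split_ifs <;> positivity

/-- Trading decay in `v` for decay in `u`. -/
lemma rpow_mul_extRate_le {δ b b' u v : ℝ} (huv : |u| ≤ |v|) (hb : b' ≤ b) :
    bracket v ^ b' * extRate (δ - b') u v ≤ bracket v ^ b * extRate (δ - b) u v := by
  have hu := bracket_pos u
  have hv := bracket_pos v
  have hle := bracket_mono huv
  unfold extRate
  by_cases h1 : 1 + (δ - b') < 0
  -- If the rate with fewer translations is already in the regime of ⟨u⟩, so is the other, and ⟨u⟩ ≤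
  -- ⟨v⟩ compares the remaining powers.
  · rw [if_pos h1, if_pos (by linarith)]
    have e1 : bracket u ^ (1 + (δ - b')) = bracket u ^ (1 + (δ - b)) * bracket u ^ (b - b') := by
      rw [← Real.rpow_add hu]
      congr 1
      ring
    have e2 : bracket v ^ b = bracket v ^ b' * bracket v ^ (b - b') := by
      rw [← Real.rpow_add hv]
      congr 1
      ring
    rw [e1, e2, mul_div_assoc', mul_div_assoc']
    refine div_le_div_of_nonneg_right ?_ hv.le
    have := Real.rpow_le_rpow hu.le hle (sub_nonneg.2 hb)
    have h3 : 0 ≤ bracket v ^ b' * bracket u ^ (1 + (δ - b)) := by positivity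
    calc _ = bracket v ^ b' * bracket u ^ (1 + (δ - b)) * bracket u ^ (b - b') := by ring
      _ ≤ bracket v ^ b' * bracket u ^ (1 + (δ - b)) * bracket v ^ (b - b') := by gcongr
      _ = _ := by ring
  -- Here the left side is ⟨v⟩^δ. The right side equals it, or it has crossed the threshold and is
  -- larger because ⟨u⟩ carries a negative exponent.
  · rw [if_neg h1, ← Real.rpow_add hv]
    by_cases h2 : 1 + (δ - b) < 0
    · rw [if_pos h2]
      have e1 : bracket v ^ (b' + (δ - b')) =
          bracket v ^ b * (bracket v ^ (1 + (δ - b)) / bracket v) := by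
        rw [mul_div_assoc', ← Real.rpow_add hv, ← Real.rpow_sub_one hv.ne']
        congr 1
        ring
      rw [e1]
      have := Real.rpow_le_rpow_of_nonpos hu hle h2.le
      gcongr
    · rw [if_neg h2, ← Real.rpow_add hv]
      apply le_of_eq
      congr 1
      ring

/-- In a term with w translations the weights are of size ⟨v⟩^(w-n) and the solution decays at the
rate of order δ - w. `rpow_mul_extRate_le` replaces w by its upper bound b. -/
lemma Cl.bound {n b : ℕ} {O : Op} (h : Cl n b O) {δ : ℝ} (hδ : ∀ z : ℤ, δ ≠ (z : ℝ)) {θ₀ : ℝ}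
    (hθ₀ : 0 < θ₀) : ∃ C, 0 ≤ C ∧ ∀ {M : ℝ} {χ : Mink → ℂ}, Good n δ M χ →
      ∀ U ∈ SU, ∀ t r θ ϕ, 1 < r → r / 3 < t → t < 3 * r → θ₀ ≤ θ → θ ≤ Real.pi - θ₀ →
        ‖O χ U t r θ ϕ‖ ≤
          C * M * (bracket (t + r) ^ ((b : ℝ) - n) * extRate (δ - b) (t - r) (t + r)) := by
  induction h with
  | @term c hc p a w hn hb hw =>
    obtain ⟨C₁, hC₁, h1⟩ := hc.exists_bound hθ₀
    obtain ⟨C₂, hC₂, h2⟩ := Good.wact_zero w hw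
    -- This excludes the logarithmic case for every possible number of translations, and it is where
    -- δ ∉ ℤ enters.
    have hne : 1 + (δ - (wwt w : ℝ)) ≠ 0 := fun h0 => hδ ((wwt w : ℤ) - 1) (by
      push_cast
      linarith)
    obtain ⟨C₃, hC₃, h3⟩ := Good.exterior hne
    refine ⟨C₁ * (5 ^ p * 5 ^ a) * (C₃ * C₂), by positivity,
      fun {M χ} hg U hU t r θ ϕ hr ht1 ht2 hθ1 hθ2 => ?_⟩
    have hM := hg.nonneg
    have hX := norm_sphPoint hU (by linarith : 0 ≤ r) θ ϕ
    have hA := h1 U hU θ ϕ hθ1 hθ2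
    have hB := h3 (h2 hg) t (sphPoint U r θ ϕ) (by rwa [hX]) (by rwa [hX]) (by rwa [hX])
    rw [hX] at hB
    set v := bracket (t + r) with hv
    have hvp : 0 < v := bracket_pos _
    -- From t < 3r and r > 1: ⟨v⟩² ≤ 1 + 16r² ≤ 25r². Hence r⁻¹ and (t+r)⁻¹ are both at most 5/⟨v⟩.
    have hv5 : v ≤ 5 * r := by
      rw [hv, bracket, Real.sqrt_le_left (by linarith)]
      nlinarith
    have hr0 : 0 < r := by linarith
    have i1 : r⁻¹ ≤ 5 * v⁻¹ := by
      rw [← div_eq_mul_inv, le_div_iff₀ hvp, inv_mul_le_iff₀ hr0]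
      linarith
    have i2 : (t + r)⁻¹ ≤ 5 * v⁻¹ :=
      (inv_anti₀ hr0 (by linarith : r ≤ t + r)).trans i1
    have hD : (r⁻¹) ^ p * ((t + r)⁻¹) ^ a ≤ (5 ^ p * 5 ^ a) * v ^ ((wwt w : ℝ) - n) := by
      have e : v ^ ((wwt w : ℝ) - n) = (v⁻¹) ^ p * (v⁻¹) ^ a := by
        rw [← pow_add, ← Real.rpow_natCast, Real.inv_rpow hvp.le, ← Real.rpow_neg hvp.le]
        congr 1
        rw [← hn]
        push_cast
        ring
      have j1 : (r⁻¹) ^ p ≤ (5 * v⁻¹) ^ p := pow_le_pow_left₀ (by positivity) i1 p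
      have j2 : ((t + r)⁻¹) ^ a ≤ (5 * v⁻¹) ^ a :=
        pow_le_pow_left₀ (inv_nonneg.2 (by linarith)) i2 a
      rw [e]
      calc _ ≤ (5 * v⁻¹) ^ p * (5 * v⁻¹) ^ a :=
            mul_le_mul j1 j2 (pow_nonneg (inv_nonneg.2 (by linarith)) a) (by positivity)
        _ = _ := by rw [mul_pow, mul_pow]; ring
    have hE : v ^ ((wwt w : ℝ) - n) * extRate (δ - wwt w) (t - r) (t + r) ≤
        v ^ ((b : ℝ) - n) * extRate (δ - b) (t - r) (t + r) := by
      have huv : |t - r| ≤ |t + r| := by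
        rw [abs_of_pos (by linarith : 0 < t + r), abs_le]
        constructor <;> linarith
      have := rpow_mul_extRate_le (δ := δ) huv (Nat.cast_le.2 hb : (wwt w : ℝ) ≤ b)
      rw [Real.rpow_sub hvp, Real.rpow_sub hvp, div_mul_eq_mul_div, div_mul_eq_mul_div]
      gcongr
    have hD0 : 0 ≤ (r⁻¹) ^ p * ((t + r)⁻¹) ^ a :=
      mul_nonneg (by positivity) (pow_nonneg (inv_nonneg.2 (by linarith)) a)
    have hx := extRate_nonneg (δ - wwt w) (t - r) (t + r)
    rw [SpinDecay.term, norm_mul, norm_mul, Complex.norm_real, Real.norm_of_nonneg hD0]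
    calc _ ≤ C₁ * ((5 ^ p * 5 ^ a) * v ^ ((wwt w : ℝ) - n)) *
          (C₃ * (C₂ * M) * extRate (δ - wwt w) (t - r) (t + r)) := by gcongr
      _ = C₁ * (5 ^ p * 5 ^ a) * (C₃ * C₂) * M *
          (v ^ ((wwt w : ℝ) - n) * extRate (δ - wwt w) (t - r) (t + r)) := by ring
      _ ≤ _ := by gcongr
  | add _ _ ih ih' =>
    obtain ⟨C, hC, h⟩ := ih
    obtain ⟨C', hC', h'⟩ := ih'
    refine ⟨C + C', by positivity, fun {M χ} hg U hU t r θ ϕ hr ht1 ht2 hθ1 hθ2 => ?_⟩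
    have e := h hg U hU t r θ ϕ hr ht1 ht2 hθ1 hθ2
    have e' := h' hg U hU t r θ ϕ hr ht1 ht2 hθ1 hθ2
    refine (norm_add_le _ _).trans ((add_le_add e e').trans (le_of_eq ?_))
    ring
  | congr _ he ih =>
    obtain ⟨C, hC, h⟩ := ih
    refine ⟨C, hC, fun {M χ} hg U hU t r θ ϕ hr ht1 ht2 hθ1 hθ2 => ?_⟩
    rw [he χ hg.contDiff U t r θ ϕ ⟨hU, by linarith, by linarith, by linarith, by linarith⟩]
    exact h hg U hU t r θ ϕ hr ht1 ht2 hθ1 hθ2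

/-! ### Operators with constant coefficients -/

/-- The homogeneous differential operators of order `n` with constant coefficients. -/
inductive ConstOp (n : ℕ) : ((Mink → ℂ) → Mink → ℂ) → Prop
  | word (w : List Gen) (hl : w.length = n) (hw : wwt w = n) : ConstOp n (wact w)
  | const_mul (c : ℂ) {T : (Mink → ℂ) → Mink → ℂ} : ConstOp n T →
      ConstOp n fun χ p => c * T χ p
  | add {T T' : (Mink → ℂ) → Mink → ℂ} : ConstOp n T → ConstOp n T' →
      ConstOp n fun χ p => T χ p + T' χ p
  | congr {T T' : (Mink → ℂ) → Mink → ℂ} : ConstOp n T →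
      (∀ χ : Mink → ℂ, ContDiff ℝ n χ → T' χ = T χ) → ConstOp n T'

lemma ConstOp.contDiff {n m : ℕ} {T : (Mink → ℂ) → Mink → ℂ} (h : ConstOp n T) {χ : Mink → ℂ}
    (hχ : ContDiff ℝ (m + n : ℕ) χ) : ContDiff ℝ m (T χ) := by
  induction h with
  | word w hl hw => exact contDiff_wact w (by rwa [hl])
  | const_mul c _ ih => exact contDiff_const.mul ih
  | add _ _ ih ih' => exact ih.add ih'
  | congr _ he ih => rwa [he χ (hχ.of_le (by norm_cast; omega))]

lemma ConstOp.sum {ι : Type*} (s : Finset ι) {n : ℕ} {T : ι → (Mink → ℂ) → Mink → ℂ}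
    (hs : s.Nonempty) (h : ∀ i, ConstOp n (T i)) : ConstOp n fun χ p => ∑ i ∈ s, T i χ p := by
  classical
  induction hs using Finset.Nonempty.cons_induction with
  | singleton a => simpa using h a
  | cons a s ha hs ih =>
    simp only [Finset.sum_cons]
    exact (h a).add ih

lemma ConstOp.pd {n : ℕ} {T : (Mink → ℂ) → Mink → ℂ} (h : ConstOp n T) (μ : Fin 4) :
    ConstOp (n + 1) fun χ => pd μ (T χ) := by
  have hd : ∀ {T : (Mink → ℂ) → Mink → ℂ}, ConstOp n T → ∀ {χ : Mink → ℂ},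
      ContDiff ℝ (n + 1 : ℕ) χ → Differentiable ℝ (T χ) := fun h χ hχ =>
    (h.contDiff (m := 1) (by rwa [add_comm])).differentiable one_ne_zero
  induction h with
  | word w hl hw =>
    exact (ConstOp.word (.d μ :: w) (by simp [hl]) (by rw [wwt_cons, hw, Gen.wt, add_comm]))
  | const_mul c h ih =>
    refine (ih.const_mul c).congr fun χ hχ => funext fun p => ?_
    simp only [SpinDecay.pd]
    rw [fderiv_const_mul (hd h hχ p)]
    rfl
  | add h h' ih ih' =>
    refine (ih.add ih').congr fun χ hχ => funext fun p => ?_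
    simp only [SpinDecay.pd]
    rw [fderiv_fun_add (hd h hχ p) (hd h' hχ p)]
    rfl
  | congr _ he ih =>
    exact ih.congr fun χ hχ => by rw [he χ (hχ.of_le (by norm_cast; omega))]

lemma ConstOp.iterPd {n : ℕ} {T : (Mink → ℂ) → Mink → ℂ} (h : ConstOp n T) (m : ℕ)
    (α : Fin m → Fin 4) : ConstOp (n + m) fun χ => iterPd m α (T χ) := by
  induction m with
  | zero => exact h
  | succ m ih => exact (ih (Fin.tail α)).pd (α 0)

lemma ConstOp.hertzField {q : ℕ} (ξ : Fin q → Fin 2 → ℂ) (a : Fin q → Fin 2) :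
    ConstOp q fun χ => hertzField q ξ χ a := by
  induction q with
  | zero => exact .word [] rfl rfl
  | succ q ih =>
    exact ConstOp.sum _ Finset.univ_nonempty fun A' => (ConstOp.sum _ Finset.univ_nonempty fun μ =>
      ((ih (Fin.tail ξ) (Fin.tail a)).pd μ).const_mul (infeld (a 0) A' μ)).const_mul (ξ 0 A')

/-- The region and the rate are left abstract, so that one induction serves both the interior
estimate and the bound near the origin. -/
lemma ConstOp.bound_of_good {n : ℕ} {T : (Mink → ℂ) → Mink → ℂ} (h : ConstOp n T) (β : ℝ)
    {s : Set Mink} {ρ : Mink → ℝ} (hρ : ∃ C, 0 ≤ C ∧ ∀ {M : ℝ} {χ : Mink → ℂ},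
      Good 0 (β - n) M χ → ∀ p ∈ s, ‖χ p‖ ≤ C * M * ρ p) :
    ∃ C, 0 ≤ C ∧ ∀ {M : ℝ} {χ : Mink → ℂ}, Good n β M χ → ∀ p ∈ s, ‖T χ p‖ ≤ C * M * ρ p := by
  obtain ⟨C₀, hC₀, h0⟩ := hρ
  induction h with
  | word w hl hw =>
    obtain ⟨C, hC, h1⟩ := Good.wact_zero w hl.le
    refine ⟨C₀ * C, by positivity, fun hg p hp => ?_⟩
    have := h1 hg
    rw [hw] at this
    exact (h0 this p hp).trans_eq (by ring)
  | const_mul c _ ih =>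
    obtain ⟨C, hC, h⟩ := ih
    refine ⟨‖c‖ * C, by positivity, fun {M χ} hg p hp => ?_⟩
    rw [norm_mul]
    exact (mul_le_mul_of_nonneg_left (h hg p hp) (norm_nonneg c)).trans_eq (by ring)
  | add _ _ ih ih' =>
    obtain ⟨C, hC, h⟩ := ih
    obtain ⟨C', hC', h'⟩ := ih'
    refine ⟨C + C', by positivity, fun {M χ} hg p hp => ?_⟩
    exact (norm_add_le _ _).trans ((add_le_add (h hg p hp) (h' hg p hp)).trans_eq (by ring))
  | congr _ he ih =>
    obtain ⟨C, hC, h⟩ := ih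
    exact ⟨C, hC, fun {M χ} hg p hp => by rw [he χ hg.contDiff]; exact h hg p hp⟩

/-- The operators of order `n` built from differential operators with constant coefficients, with
coefficients depending on the angles. -/
inductive Cl₀ (n : ℕ) : Op → Prop
  | term {c : Mat → ℝ → ℝ → ℂ} (hc : Adm c) {T : (Mink → ℂ) → Mink → ℂ} (hT : ConstOp n T) :
      Cl₀ n fun χ U t r θ ϕ => c U θ ϕ * T χ (t, sphPoint U r θ ϕ)
  | add {O O' : Op} : Cl₀ n O → Cl₀ n O' →
      Cl₀ n fun χ U t r θ ϕ => O χ U t r θ ϕ + O' χ U t r θ ϕ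
  | congr {O O' : Op} : Cl₀ n O → (∀ χ : Mink → ℂ, ContDiff ℝ n χ →
      ∀ U t r θ ϕ, O' χ U t r θ ϕ = O χ U t r θ ϕ) → Cl₀ n O'

lemma Cl₀.const_mul {n : ℕ} {O : Op} (h : Cl₀ n O) (k : ℂ) :
    Cl₀ n fun χ U t r θ ϕ => k * O χ U t r θ ϕ := by
  induction h with
  | term hc hT =>
    refine (Cl₀.term ((Adm.const k).mul hc) hT).congr fun χ _ U t r θ ϕ => ?_
    ring
  | add _ _ ih ih' =>
    refine (ih.add ih').congr fun χ _ U t r θ ϕ => ?_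
    ring
  | congr _ he ih => exact ih.congr fun χ hχ U t r θ ϕ => by rw [he χ hχ]

lemma Cl₀.sum {ι : Type*} (s : Finset ι) (hs : s.Nonempty) {n : ℕ} {O : ι → Op}
    (h : ∀ i, Cl₀ n (O i)) : Cl₀ n fun χ U t r θ ϕ => ∑ i ∈ s, O i χ U t r θ ϕ := by
  classical
  induction hs using Finset.Nonempty.cons_induction with
  | singleton a => simpa using h a
  | cons a s ha hs ih =>
    simp only [Finset.sum_cons]
    exact (h a).add ih

/-- No angular derivatives are taken, so neither r⁻¹ nor the cotangent of θ appears in new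
coefficients, and no regularity of the coordinates is required. -/
lemma Cl₀.exists_deriv {n : ℕ} {O : Op} (h : Cl₀ n O) : ∃ Ot Or : Op,
    (∀ χ : Mink → ℂ, ContDiff ℝ (n + 1 : ℕ) χ → ∀ U t r θ ϕ,
      HasDerivAt (fun τ => O χ U τ r θ ϕ) (Ot χ U t r θ ϕ) t ∧
      HasDerivAt (fun ρ => O χ U t ρ θ ϕ) (Or χ U t r θ ϕ) r) ∧
    Cl₀ (n + 1) Ot ∧ Cl₀ (n + 1) Or := by
  induction h with
  | @term c hc T hT =>
    refine ⟨fun χ U t r θ ϕ => c U θ ϕ * pd 0 (T χ) (t, sphPoint U r θ ϕ),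
      fun χ U t r θ ϕ => ∑ i : Fin 3, c U θ ϕ * rad U i θ ϕ *
        pd i.succ (T χ) (t, sphPoint U r θ ϕ), ?_, .term hc (hT.pd 0),
      Cl₀.sum _ Finset.univ_nonempty fun i => .term (hc.mul (Adm.rad i)) (hT.pd i.succ)⟩
    intro χ hχ U t r θ ϕ
    have hF : DifferentiableAt ℝ (T χ) (t, sphPoint U r θ ϕ) :=
      (hT.contDiff (m := 1) (by rwa [add_comm])).differentiable one_ne_zero _
    refine ⟨(hasDerivAt_sph_t hF).const_mul _,
      ((hasDerivAt_sph_r hF).const_mul _).congr_deriv ?_⟩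
    rw [Finset.mul_sum]
    exact Finset.sum_congr rfl fun i _ => by rw [Complex.real_smul]; ring
  | add _ _ ih ih' =>
    obtain ⟨Ot, Or, hd, h1, h2⟩ := ih
    obtain ⟨Ot', Or', hd', h1', h2'⟩ := ih'
    exact ⟨_, _, fun χ hχ U t r θ ϕ =>
      ⟨(hd χ hχ U t r θ ϕ).1.fun_add (hd' χ hχ U t r θ ϕ).1,
        (hd χ hχ U t r θ ϕ).2.fun_add (hd' χ hχ U t r θ ϕ).2⟩, h1.add h1', h2.add h2'⟩
  | congr _ he ih =>
    obtain ⟨Ot, Or, hd, h1, h2⟩ := ih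
    refine ⟨Ot, Or, fun χ hχ U t r θ ϕ => ?_, h1, h2⟩
    have e := he χ (hχ.of_le (by norm_cast; omega)) U
    simp only [e]
    exact hd χ hχ U t r θ ϕ

lemma Cl₀.opD {n : ℕ} {O : Op} (h : Cl₀ n O) : Cl₀ (n + 1) fun χ U => opD (O χ U) := by
  obtain ⟨Ot, Or, hd, h1, h2⟩ := h.exists_deriv
  refine ((h1.add h2).const_mul (1 / (Real.sqrt 2 : ℂ))).congr fun χ hχ U t r θ ϕ => ?_
  rw [SpinDecay.opD, (hd χ hχ U t r θ ϕ).1.deriv, (hd χ hχ U t r θ ϕ).2.deriv]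

lemma Cl₀.opD' {n : ℕ} {O : Op} (h : Cl₀ n O) : Cl₀ (n + 1) fun χ U => opD' (O χ U) := by
  obtain ⟨Ot, Or, hd, h1, h2⟩ := h.exists_deriv
  refine ((h1.add (h2.const_mul (-1))).const_mul (1 / (Real.sqrt 2 : ℂ))).congr
    fun χ hχ U t r θ ϕ => ?_
  rw [SpinDecay.opD', (hd χ hχ U t r θ ϕ).1.deriv, (hd χ hχ U t r θ ϕ).2.deriv]
  ring

lemma Cl₀.component {q : ℕ} (ξ : Fin q → Fin 2 → ℂ) (i : ℕ) :
    Cl₀ q fun χ U => component U (hertzField q ξ χ) i := by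
  refine Cl₀.sum _ Finset.univ_nonempty fun a => ?_
  refine (Cl₀.term (Adm.prod Finset.univ fun k : Fin q => Adm.spin (decide ((k : ℕ) < i)) (a k))
    (ConstOp.hertzField ξ a)).congr fun χ _ U t r θ ϕ => ?_
  simp only [spin, decide_eq_true_eq]

lemma Cl₀.nullDeriv {q : ℕ} (ξ : Fin q → Fin 2 → ℂ) (i k l : ℕ) :
    Cl₀ (q + l + k) fun χ U => SpinDecay.opD^[k] (SpinDecay.opD'^[l]
      (SpinDecay.component U (hertzField q ξ χ) i)) := by
  have h1 : Cl₀ (q + l) fun χ U => SpinDecay.opD'^[l]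
      (SpinDecay.component U (SpinDecay.hertzField q ξ χ) i) := by
    induction l with
    | zero => exact Cl₀.component ξ i
    | succ l ih =>
      simp only [Function.iterate_succ_apply']
      exact ih.opD'
  induction k with
  | zero => exact h1
  | succ k ih =>
    simp only [Function.iterate_succ_apply']
    exact ih.opD

/-- This reaches r = 0, where `Cl.bound` is not available. It is the reason why r > 1 is needed only
together with angular derivatives. -/
lemma Cl₀.bound {n : ℕ} {O : Op} (h : Cl₀ n O) (δ : ℝ) {θ₀ : ℝ} (hθ₀ : 0 < θ₀) :
    ∃ C, 0 ≤ C ∧ ∀ {M : ℝ} {χ : Mink → ℂ}, Good n δ M χ →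
      ∀ U ∈ SU, ∀ t r θ ϕ, 0 ≤ t → 0 ≤ r → t + r ≤ 4 → θ₀ ≤ θ → θ ≤ Real.pi - θ₀ →
        ‖O χ U t r θ ϕ‖ ≤ C * M := by
  induction h with
  | term hc hT =>
    obtain ⟨C₁, hC₁, h1⟩ := hc.exists_bound hθ₀
    obtain ⟨C₀, hC₀, h0⟩ := Good.bounded (δ - n)
    obtain ⟨C₂, hC₂, h2⟩ := hT.bound_of_good δ (s := {p | 0 ≤ p.1 ∧ p.1 + ‖p.2‖ ≤ 4})
      (ρ := fun _ => 1) ⟨C₀, hC₀, fun hg p hp => by rw [mul_one]; exact h0 hg p.1 p.2 hp.1 hp.2⟩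
    refine ⟨C₁ * C₂, by positivity, fun {M χ} hg U hU t r θ ϕ ht hr htr hθ1 hθ2 => ?_⟩
    have e1 := h1 U hU θ ϕ hθ1 hθ2
    have e2 := h2 hg (t, sphPoint U r θ ϕ) ⟨ht, by rwa [norm_sphPoint hU hr]⟩
    rw [mul_one] at e2
    rw [norm_mul, mul_assoc]
    exact mul_le_mul e1 e2 (norm_nonneg _) hC₁
  | add _ _ ih ih' =>
    obtain ⟨C, hC, h⟩ := ih
    obtain ⟨C', hC', h'⟩ := ih'
    refine ⟨C + C', by positivity, fun {M χ} hg U hU t r θ ϕ ht hr htr hθ1 hθ2 => ?_⟩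
    exact (norm_add_le _ _).trans ((add_le_add (h hg U hU t r θ ϕ ht hr htr hθ1 hθ2)
      (h' hg U hU t r θ ϕ ht hr htr hθ1 hθ2)).trans_eq (by ring))
  | congr _ he ih =>
    obtain ⟨C, hC, h⟩ := ih
    exact ⟨C, hC, fun {M χ} hg U hU t r θ ϕ ht hr htr hθ1 hθ2 => by
      rw [he χ hg.contDiff]; exact h hg U hU t r θ ϕ ht hr htr hθ1 hθ2⟩

/-! ### Locality -/

/-- The given χ is known to agree with Kirchhoff's solution only for t > 0. Differential operators
see only a neighbourhood of the point, so this is enough. -/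
lemma pd_congr {F G : Mink → ℂ} (h : ∀ p : Mink, 0 < p.1 → F p = G p) (μ : Fin 4) :
    ∀ p : Mink, 0 < p.1 → pd μ F p = pd μ G p := fun p hp => by
  have hU : IsOpen {p : Mink | 0 < p.1} := isOpen_lt continuous_const continuous_fst
  have : F =ᶠ[nhds p] G := Filter.eventually_of_mem (hU.mem_nhds hp) h
  rw [pd, pd, this.fderiv_eq]

lemma iterPd_congr {F G : Mink → ℂ} (h : ∀ p : Mink, 0 < p.1 → F p = G p) {n : ℕ}
    (α : Fin n → Fin 4) : ∀ p : Mink, 0 < p.1 → iterPd n α F p = iterPd n α G p := by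
  induction n with
  | zero => exact h
  | succ n ih => exact pd_congr (ih (Fin.tail α)) (α 0)

lemma hertzField_congr {q : ℕ} (ξ : Fin q → Fin 2 → ℂ) {F G : Mink → ℂ}
    (h : ∀ p : Mink, 0 < p.1 → F p = G p) (a : Fin q → Fin 2) :
    ∀ p : Mink, 0 < p.1 → hertzField q ξ F a p = hertzField q ξ G a p := by
  induction q with
  | zero => exact h
  | succ q ih =>
    intro p hp
    simp only [hertzField, nabla, pd_congr (ih (Fin.tail ξ) (Fin.tail a)) _ p hp]

/-- Functions of the spherical coordinates which agree for positive times. -/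
def EqPos (F G : CoordFun) : Prop := ∀ t, 0 < t → F t = G t

lemma EqPos.deriv_t {F G : CoordFun} (h : EqPos F G) {t : ℝ} (ht : 0 < t) (r θ ϕ : ℝ) :
    deriv (fun τ => F τ r θ ϕ) t = deriv (fun τ => G τ r θ ϕ) t :=
  Filter.EventuallyEq.deriv_eq <| Filter.eventually_of_mem (Ioi_mem_nhds ht) fun τ hτ => by
    simp only [h τ hτ]

lemma EqPos.opD {F G : CoordFun} (h : EqPos F G) : EqPos (opD F) (opD G) := fun t ht => by
  funext r θ ϕ
  simp only [SpinDecay.opD, h.deriv_t ht, h t ht]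

lemma EqPos.opD' {F G : CoordFun} (h : EqPos F G) : EqPos (opD' F) (opD' G) := fun t ht => by
  funext r θ ϕ
  simp only [SpinDecay.opD', h.deriv_t ht, h t ht]

lemma EqPos.angPow {F G : CoordFun} (h : EqPos F G) (U : Mat) (m : ℕ) (α : Fin m → Fin 3) :
    EqPos (angPow U m α F) (angPow U m α G) := by
  induction m with
  | zero => exact h
  | succ m ih =>
    intro t ht
    funext r θ ϕ
    simp only [SpinDecay.angPow, angGrad, opDelta, opDelta', ih (Fin.tail α) t ht]

lemma EqPos.iterate {T : CoordFun → CoordFun} (hT : ∀ {F G}, EqPos F G → EqPos (T F) (T G))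
    {F G : CoordFun} (h : EqPos F G) (k : ℕ) : EqPos (T^[k] F) (T^[k] G) := by
  induction k with
  | zero => exact h
  | succ k ih =>
    simp only [Function.iterate_succ_apply']
    exact hT ih

lemma nullDerivNorm_congr {q : ℕ} (ξ : Fin q → Fin 2 → ℂ) {F G : Mink → ℂ}
    (h : ∀ p : Mink, 0 < p.1 → F p = G p) (U : Mat) (i k l m : ℕ) {t : ℝ} (ht : 0 < t)
    (r θ ϕ : ℝ) :
    nullDerivNorm U k l m (component U (hertzField q ξ F) i) t r θ ϕ =
      nullDerivNorm U k l m (component U (hertzField q ξ G) i) t r θ ϕ := by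
  have hc : EqPos (component U (hertzField q ξ F) i) (component U (hertzField q ξ G) i) :=
    fun t ht => by
      funext r θ ϕ
      simp only [component, hertzField_congr ξ h _ (t, _) ht]
  have := fun α : Fin m → Fin 3 =>
    ((hc.angPow U m α).iterate EqPos.opD' l).iterate EqPos.opD k t ht
  simp only [nullDerivNorm, this]

/-! ### Decay estimates -/

/-- Solutions with data in the weighted Sobolev spaces. -/
lemma exists_good (N : ℕ) (δ : ℝ) : ∃ C, 0 ≤ C ∧ ∀ {χ : Mink → ℂ} {f g : Space → ℂ},
    IsCauchySolution χ f g → MemSobolev (N + 3) δ f → MemSobolev (N + 2) (δ - 1) g →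
      ∃ χ', Good N δ (C * (sobolevNorm (N + 3) δ f + sobolevNorm (N + 2) (δ - 1) g).toReal) χ' ∧
        ∀ p : Mink, 0 < p.1 → χ p = χ' p := by
  -- Kirchhoff's formula differentiates f once, so f needs N + 1 classical derivatives and g needs
  -- N. The embedding adds two to each.
  obtain ⟨C₁, hC₁, h1⟩ := exists_sym_of_wSob (N + 1) δ
  obtain ⟨C₂, hC₂, h2⟩ := exists_sym_of_wSob N (δ - 1)
  refine ⟨C₁ + C₂, by positivity, fun {χ f g} h hf hg => ?_⟩
  obtain ⟨f', hff, sf⟩ := h1 (wSob_of_memSobolev hf)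
  obtain ⟨g', hgg, sg⟩ := h2 (wSob_of_memSobolev hg)
  have hadd := ENNReal.toReal_add hf.ne hg.ne
  have p1 : 0 ≤ (sobolevNorm (N + 3) δ f).toReal := ENNReal.toReal_nonneg
  have p2 : 0 ≤ (sobolevNorm (N + 2) (δ - 1) g).toReal := ENNReal.toReal_nonneg
  refine ⟨waveP f' g', ⟨f', g', sf.mono ?_, sg.mono ?_, rfl⟩,
    h.eq_waveP hff hgg (sf.contDiff.of_le (by norm_cast; omega)) sg.continuous⟩
  · rw [hadd]
    have := mul_nonneg hC₂ p1
    have := mul_nonneg hC₂ p2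
    have := mul_nonneg hC₁ p2
    linarith
  · rw [hadd]
    have := mul_nonneg hC₂ p1
    have := mul_nonneg hC₁ p1
    have := mul_nonneg hC₁ p2
    linarith

lemma sqrt_sum_sq_le {ι : Type*} (s : Finset ι) {f : ι → ℝ} (hf : ∀ i ∈ s, 0 ≤ f i) :
    Real.sqrt (∑ i ∈ s, f i ^ 2) ≤ ∑ i ∈ s, f i :=
  Real.sqrt_le_iff.2 ⟨Finset.sum_nonneg hf, Finset.sum_sq_le_sq_sum_of_nonneg hf⟩

/-- In Cartesian components all derivatives have constant coefficients, so each of the q + n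
derivatives is a translation and lowers the order by one. -/
lemma nablaNorm_le {q : ℕ} (ξ : Fin q → Fin 2 → ℂ) (n : ℕ) (δ : ℝ) : ∃ C, 0 ≤ C ∧
    ∀ {M : ℝ} {χ : Mink → ℂ}, Good (q + n) δ M χ → ∀ (t : ℝ) (x : Space), 3 * ‖x‖ < t →
      nablaNorm n (hertzField q ξ χ) (t, x) ≤ C * M * bracket t ^ (δ - q - n) := by
  obtain ⟨C₀, hC₀, h0⟩ := Good.interior (δ - (q + n : ℕ))
  have hb := fun (α : Fin n → Fin 4) (a : Fin q → Fin 2) =>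
    ((ConstOp.hertzField ξ a).iterPd n α).bound_of_good δ (s := {p | 3 * ‖p.2‖ < p.1})
      (ρ := fun p => bracket p.1 ^ (δ - (q + n : ℕ)))
      ⟨C₀, hC₀, fun hg p hp => h0 hg p.1 p.2 hp⟩
  choose C hC h using hb
  refine ⟨∑ α, ∑ a, C α a, Finset.sum_nonneg fun α _ => Finset.sum_nonneg fun a _ => hC α a,
    fun {M χ} hg t x hx => ?_⟩
  rw [nablaNorm, ← Fintype.sum_prod_type' (f := fun α a => ‖iterPd n α (hertzField q ξ χ a) (t, x)‖ ^ 2)]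
  refine (sqrt_sum_sq_le _ fun _ _ => norm_nonneg _).trans ?_
  rw [Fintype.sum_prod_type, Finset.sum_mul, Finset.sum_mul]
  refine Finset.sum_le_sum fun α _ => ?_
  rw [Finset.sum_mul, Finset.sum_mul]
  refine Finset.sum_le_sum fun a _ => ?_
  have := h α a hg (t, x) hx
  push_cast at this
  rwa [sub_sub]

/-- On a bounded set the decay rate is bounded below, so there plain boundedness implies the decay
estimate. -/
lemma exists_pos_le_rpow_mul_extRate (γ β : ℝ) : ∃ c, 0 < c ∧ ∀ u v : ℝ, |u| ≤ 4 → |v| ≤ 4 →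
    c ≤ bracket v ^ γ * extRate β u v := by
  have hb : ∀ s, |s| ≤ 4 → bracket s ≤ 5 := fun s hs => by
    rw [bracket, Real.sqrt_le_left (by norm_num), ← sq_abs]
    nlinarith [abs_nonneg s]
  have hpow : ∀ s σ : ℝ, |s| ≤ 4 → (5 : ℝ) ^ (-|σ|) ≤ bracket s ^ σ := fun s σ hs => by
    have := rpow_le_of_comparable (γ := σ) one_pos (bracket_pos s) (by norm_num : (1 : ℝ) ≤ 5)
      (by linarith [one_le_bracket s]) (by linarith [hb s hs])
    rw [Real.one_rpow] at this
    rw [Real.rpow_neg (by norm_num), inv_le_iff_one_le_mul₀ (by positivity)]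
    linarith
  refine ⟨5 ^ (-|γ|) * min (5 ^ (-|1 + β|) / 5) (5 ^ (-|β|)), by positivity,
    fun u v hu hv => mul_le_mul (hpow v γ hv) ?_ (by positivity)
      (Real.rpow_nonneg (bracket_nonneg v) _)⟩
  unfold extRate
  split_ifs
  · exact (min_le_left _ _).trans
      (div_le_div₀ (Real.rpow_nonneg (bracket_nonneg u) _) (hpow u _ hu) (bracket_pos v) (hb v hv))
  · exact (min_le_right _ _).trans (hpow v β hv)

/-- For r > 1 this is `Cl.bound` for each tensor component. Otherwise m = 0 and t + r ≤ 4r ≤ 4,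
where `Cl₀.bound` applies. -/
lemma nullDerivNorm_le {q : ℕ} (ξ : Fin q → Fin 2 → ℂ) (k l m i : ℕ) {δ : ℝ}
    (hδ : ∀ z : ℤ, δ ≠ (z : ℝ)) {θ₀ : ℝ} (hθ₀ : 0 < θ₀) : ∃ C, 0 ≤ C ∧
    ∀ {M : ℝ} {χ : Mink → ℂ}, Good (q + m + l + k) δ M χ → ∀ U ∈ SU, ∀ t r θ ϕ,
      0 ≤ r → r / 3 < t → t < 3 * r → (1 < r ∨ m = 0) → θ₀ ≤ θ → θ ≤ Real.pi - θ₀ →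
        nullDerivNorm U k l m (component U (hertzField q ξ χ) i) t r θ ϕ ≤
          C * M * (bracket (t + r) ^ (((i + l : ℕ) : ℝ) - (q + m + l + k : ℕ)) *
            extRate (δ - (i + l : ℕ)) (t - r) (t + r)) := by
  have h1 := fun α => (Cl.nullDeriv ξ i k l m α).bound hδ hθ₀
  choose C hC h using h1
  obtain ⟨C₀, hC₀, h0⟩ := (Cl₀.nullDeriv ξ i k l).bound δ hθ₀
  obtain ⟨c, hc, hlow⟩ := exists_pos_le_rpow_mul_extRate
    (((i + l : ℕ) : ℝ) - (q + m + l + k : ℕ)) (δ - (i + l : ℕ))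
  have hsum : 0 ≤ ∑ α, C α := Finset.sum_nonneg fun α _ => hC α
  refine ⟨∑ α, C α + C₀ / c, by positivity,
    fun {M χ} hg U hU t r θ ϕ hr ht1 ht2 hm hθ1 hθ2 => ?_⟩
  have hM := hg.nonneg
  set ρ := bracket (t + r) ^ (((i + l : ℕ) : ℝ) - (q + m + l + k : ℕ)) *
    extRate (δ - (i + l : ℕ)) (t - r) (t + r) with hρ
  have hρ0 : 0 ≤ ρ := mul_nonneg (Real.rpow_nonneg (bracket_nonneg _) _) (extRate_nonneg _ _ _)
  have hs : nullDerivNorm U k l m (component U (hertzField q ξ χ) i) t r θ ϕ ≤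
      ∑ α : Fin m → Fin 3,
        ‖(opD^[k] (opD'^[l] (angPow U m α (component U (hertzField q ξ χ) i)))) t r θ ϕ‖ :=
    sqrt_sum_sq_le _ fun _ _ => norm_nonneg _
  by_cases h1r : 1 < r
  · refine hs.trans ((Finset.sum_le_sum fun α _ =>
      h α hg U hU t r θ ϕ h1r ht1 ht2 hθ1 hθ2).trans ?_)
    rw [← Finset.sum_mul, ← Finset.sum_mul]
    have : 0 ≤ C₀ / c := by positivity
    gcongr
    linarith
  · obtain rfl : m = 0 := by tauto
    -- For m = 0 there is a single tensor component and no angular derivative.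
    rw [Fintype.sum_unique] at hs
    have e := h0 hg U hU t r θ ϕ (by linarith) hr (by linarith) hθ1 hθ2
    have hl := hlow (t - r) (t + r) (abs_le.2 ⟨by linarith, by linarith⟩)
      (abs_le.2 ⟨by linarith, by linarith⟩)
    rw [← hρ] at hl
    calc _ ≤ C₀ * M := hs.trans e
      _ = C₀ / c * M * c := by field_simp
      _ ≤ C₀ / c * M * ρ := by gcongr
      _ ≤ _ := by
        gcongr
        linarith

end

end SpinDecay

/-! ### Assembly of the decay estimates -/

theorem proposition6p3 (q k l m : ℕ) (δ : ℝ) (hδ : ∀ z : ℤ, δ ≠ (z : ℝ))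
    (ξ : Fin q → Fin 2 → ℂ) (θ₀ : ℝ) (hθ₀ : 0 < θ₀) :
    ∃ c : ℝ, ∀ (j : ℕ), 2 + q + (k + l + m) < j →
      ∀ (χ : SpinDecay.Mink → ℂ) (f g : SpinDecay.Space → ℂ),
        SpinDecay.IsCauchySolution χ f g →
        SpinDecay.MemSobolev j δ f →
        SpinDecay.MemSobolev (j - 1) (δ - 1) g →
        -- the derivatives of `χ` below exist in the classical sense
        ContDiffOn ℝ ((q + (k + l + m) : ℕ) : WithTop ℕ∞) χ {p | 0 < p.1} ∧
        -- the interior region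
        (∀ (t : ℝ) (x : SpinDecay.Space), 0 ≤ t → 3 * ‖x‖ < t →
          SpinDecay.nablaNorm (k + l + m) (SpinDecay.hertzField q ξ χ) (t, x) ≤
            c * SpinDecay.bracket t ^ (δ - (q : ℝ) - ((k + l + m : ℕ) : ℝ)) *
              (SpinDecay.sobolevNorm (k + l + m + q + 3) δ f +
                SpinDecay.sobolevNorm (k + l + m + q + 2) (δ - 1) g).toReal) ∧
        -- the exterior region, in any spherical coordinate system
        (∀ U ∈ Matrix.specialUnitaryGroup (Fin 2) ℂ, ∀ i : ℕ, i ≤ q →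
          ∀ t r θ ϕ : ℝ, 0 ≤ t → 0 ≤ r → t < 3 * r → r / 3 < t → (1 < r ∨ m = 0) →
            θ₀ ≤ θ → θ ≤ Real.pi - θ₀ →
            (1 + δ - (l : ℝ) - (i : ℝ) < 0 →
              SpinDecay.nullDerivNorm U k l m
                  (SpinDecay.component U (SpinDecay.hertzField q ξ χ) i) t r θ ϕ ≤
                c * SpinDecay.bracket (t - r) ^ (1 + δ - (i : ℝ) - (l : ℝ)) /
                  SpinDecay.bracket (t + r) ^ (1 + (q : ℝ) - (i : ℝ) + (k : ℝ) + (m : ℝ)) *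
                  (SpinDecay.sobolevNorm (k + l + m + q + 3) δ f +
                    SpinDecay.sobolevNorm (k + l + m + q + 2) (δ - 1) g).toReal) ∧
            (0 < 1 + δ - (l : ℝ) - (i : ℝ) →
              SpinDecay.nullDerivNorm U k l m
                  (SpinDecay.component U (SpinDecay.hertzField q ξ χ) i) t r θ ϕ ≤
                c * SpinDecay.bracket (t + r) ^ (δ - (q : ℝ) - (l : ℝ) - (k : ℝ) - (m : ℝ)) *
                  (SpinDecay.sobolevNorm (k + l + m + q + 3) δ f +
                    SpinDecay.sobolevNorm (k + l + m + q + 2) (δ - 1) g).toReal)) := by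
  obtain ⟨C₀, hC₀, hgood⟩ := SpinDecay.exists_good (q + (k + l + m)) δ
  obtain ⟨C₁, hC₁, hint⟩ := SpinDecay.nablaNorm_le ξ (k + l + m) δ
  have hext := fun i => SpinDecay.nullDerivNorm_le ξ k l m i hδ hθ₀
  choose C₂ hC₂ hext using hext
  have hsum : 0 ≤ ∑ i ∈ Finset.range (q + 1), C₂ i := Finset.sum_nonneg fun i _ => hC₂ i
  -- The sum makes one constant serve all null components i ≤ q. C₀ is the constant of the Sobolev
  -- embedding.
  refine ⟨(C₁ + ∑ i ∈ Finset.range (q + 1), C₂ i) * C₀, fun j hj χ f g hχ hf hg => ?_⟩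
  have e3 : q + (k + l + m) + 3 = k + l + m + q + 3 := by omega
  have e2 : q + (k + l + m) + 2 = k + l + m + q + 2 := by omega
  -- The index j only guarantees that the norms of the fixed orders n + q + 3 and n + q + 2, with n
  -- = k + l + m, are finite.
  obtain ⟨χ', hg', he⟩ := hgood hχ
    ((SpinDecay.sobolevNorm_mono (by omega) δ f).trans_lt hf)
    ((SpinDecay.sobolevNorm_mono (by omega) (δ - 1) g).trans_lt hg)
  rw [e3, e2] at hg'
  set I := (SpinDecay.sobolevNorm (k + l + m + q + 3) δ f +
    SpinDecay.sobolevNorm (k + l + m + q + 2) (δ - 1) g).toReal with hI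
  have hI0 : 0 ≤ I := ENNReal.toReal_nonneg
  refine ⟨hg'.contDiff.contDiffOn.congr fun p hp => he p hp, fun t x ht hx => ?_,
    fun U hU i hi t r θ ϕ _ hr ht2 ht1 hm hθ1 hθ2 => ?_⟩
  · have htp : 0 < t := by linarith [norm_nonneg x]
    have e : SpinDecay.nablaNorm (k + l + m) (SpinDecay.hertzField q ξ χ) (t, x) =
        SpinDecay.nablaNorm (k + l + m) (SpinDecay.hertzField q ξ χ') (t, x) := by
      simp only [SpinDecay.nablaNorm, SpinDecay.iterPd_congr
        (SpinDecay.hertzField_congr ξ he _) _ (t, x) htp]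
    rw [e]
    refine (hint hg' t x hx).trans ?_
    have hb := Real.rpow_nonneg (SpinDecay.bracket_nonneg t)
      (δ - (q : ℝ) - ((k + l + m : ℕ) : ℝ))
    calc _ = C₁ * C₀ * SpinDecay.bracket t ^ (δ - (q : ℝ) - ((k + l + m : ℕ) : ℝ)) * I := by ring
      _ ≤ _ := by
        gcongr
        linarith
  · have htp : 0 < t := by linarith
    have hv := SpinDecay.bracket_pos (t + r)
    have hle : C₂ i ≤ C₁ + ∑ i ∈ Finset.range (q + 1), C₂ i := by
      have := Finset.single_le_sum (fun i _ => hC₂ i) (Finset.mem_range.2 (Nat.lt_succ_of_le hi))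
      linarith
    have key := hext i (hg'.of_le (by omega)) U hU t r θ ϕ hr ht1 ht2 hm hθ1 hθ2
    rw [← SpinDecay.nullDerivNorm_congr ξ he U i k l m htp r θ ϕ] at key
    have key' := key.trans (mul_le_mul_of_nonneg_right
      (mul_le_mul_of_nonneg_right hle (mul_nonneg hC₀ hI0))
      (mul_nonneg (Real.rpow_nonneg hv.le _) (SpinDecay.extRate_nonneg _ _ _)))
    refine ⟨fun hneg => key'.trans_eq ?_, fun hpos => key'.trans_eq ?_⟩
    · rw [SpinDecay.extRate, if_pos (by push_cast; linarith)]
      have e1 : 1 + (δ - ((i + l : ℕ) : ℝ)) = 1 + δ - (i : ℝ) - (l : ℝ) := by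
        push_cast
        ring
      -- The exponent (i+l) - (q+m+l+k) equals 1 - (1+q-i+k+m), and the additional power of ⟨v⟩
      -- cancels the denominator in `extRate`.
      have e2 : SpinDecay.bracket (t + r) ^ (((i + l : ℕ) : ℝ) - ((q + m + l + k : ℕ) : ℝ)) =
          SpinDecay.bracket (t + r) *
            (SpinDecay.bracket (t + r) ^ (1 + (q : ℝ) - (i : ℝ) + (k : ℝ) + (m : ℝ)))⁻¹ := by
        have h1 := Real.rpow_add hv 1 (-(1 + (q : ℝ) - (i : ℝ) + (k : ℝ) + (m : ℝ)))
        rw [Real.rpow_one] at h1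
        rw [← Real.rpow_neg hv.le, ← h1]
        congr 1
        push_cast
        ring
      rw [e1, e2]
      field_simp
    · rw [SpinDecay.extRate, if_neg (by push_cast; linarith), ← Real.rpow_add hv]
      -- In this regime the number i + l of translations drops out of the exponent, so the bound
      -- does not depend on i.
      have e1 : ((i + l : ℕ) : ℝ) - ((q + m + l + k : ℕ) : ℝ) + (δ - ((i + l : ℕ) : ℝ)) =
          δ - (q : ℝ) - (l : ℝ) - (k : ℝ) - (m : ℝ) := by
        push_cast
        ring
      rw [e1]
      ring
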